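/- Let $n\in\mathbb Z$. Let $T_{2n}\subset S^3$ be a knot with Conway's notation $C(2n,3)$, that is, a knot ambient isotopic to the one with the standard diagram consisting of $2n$ right-handed horizontal crossings and $3$ left-handed vertical crossings (for $n<0$: $2|n|$ left-handed horizontal crossings), in which the two right ends of the horizontal twist region are joined to the two left ends of the vertical one, the upper left end of the horizontal region is joined over the top to the upper right end of the vertical one, and the lower left end is joined around the bottom to the lower right end. Let $X_{2n}$ be the exterior of $T_{2n}$, meaning either the complement $S^3\setminus T_{2n}$ or $S^3$ minus an open tubular neighbourhood of $T_{2n}$. Then, for every base point, $$\pi_1(X_{2n})\cong\left\langle s,t \mid s w t^{-1} w^{-1}=1\right\rangle,\qquad w=(ts^{-1}tst^{-1}s)^n .$$ Moreover, for $n\neq 0$ let $\alpha=|6n+1|$ and $r=\frac{4n+1}{6n+1}$, and let $$u=t^{\varepsilon_1}s^{\varepsilon_2}t^{\varepsilon_3}\cdots s^{\varepsilon_{\alpha-1}},\qquad \varepsilon_i=(-1)^{\lfloor i r\rfloor},$$ be the word read along an underpass of Schubert's normal form of slope $r$, whose two overbridges have meridians $s$ and $t$; the relation read from this normal form is $s=utu^{-1}$.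 If $n>0$, then the reduced form of the word $swt^{-1}w^{-1}$ is $s\,u\,t^{-1}u^{-1}$, so the relation above is the one read from Schubert's normal form. If $n<0$, then the reduced form of $swt^{-1}w^{-1}$ is $u\,t^{-1}u^{-1}s$, so the reduced relation is $s^{-1}=ut^{-1}u^{-1}$, obtained from the one read from Schubert's normal form by taking the inverse of both sides. -/

import Mathlib

namespace TwoBridge

/-! ### Knots in the three-sphere -/

/-- The three-sphere, as Euclidean three-space with coordinates `(x, y, z)` together with one point
at infinity. -/
abbrev S3 : Type := OnePoint (ℝ × ℝ × ℝ)

/-- Two subsets of a space are ambient isotopic: there is a continuous family of self-homeomorphisms,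
starting at the identity, whose final member carries the first set onto the second. -/
def AmbientIsotopic {X : Type*} [TopologicalSpace X] (A B : Set X) : Prop :=
  ∃ H : unitInterval → (X ≃ₜ X),
    Continuous (fun p : unitInterval × X => H p.1 p.2) ∧
      H 0 = Homeomorph.refl X ∧ H 1 '' A = B

/-- A tubular neighbourhood of `K`: an open embedding `φ` of `S¹ × ℂ` whose core `S¹ × {0}`
is mapped onto `K`. The closed tube is the image of `S¹ ×` (closed unit disc). -/
def IsTubularNeighbourhood {X : Type*} [TopologicalSpace X] (φ : Circle × ℂ → X) (K : Set X) :
    Prop :=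
  Topology.IsOpenEmbedding φ ∧ φ '' {p | p.2 = 0} = K

/-- The exterior determined by a tubular neighbourhood: what is left of the ambient space once the
open tube `S¹ ×` (open unit disc) is removed. -/
def exterior {X : Type*} (φ : Circle × ℂ → X) : Set X :=
  (φ '' {p | ‖p.2‖ < 1})ᶜ

/-! ### The Conway diagram `C(a, b)`

The projection is `(x, y, z) ↦ (x, y)`, and larger `z` is in front. -/

/-- `a` right-handed horizontal crossings (left-handed if `a < 0`): two strands winding around the
segment from `(-3, 0, 0)` to `(-1, 0, 0)`, making `a` half turns. The four ends are
`(-3, ±1, 0)` and `(-1, ±1, 0)`. -/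
def horizontalTwists (a : ℤ) : Set (ℝ × ℝ × ℝ) :=
  {p | ∃ u ∈ Set.Icc (0 : ℝ) 1, ∃ σ : ℝ, (σ = 1 ∨ σ = -1) ∧
    p = (-3 + 2 * u, σ * Real.cos (a * Real.pi * u), σ * Real.sin (a * Real.pi * u))}

/-- `b` left-handed vertical crossings (right-handed if `b < 0`): two strands winding around the
segment from `(2, -1, 0)` to `(2, 1, 0)`, making `b` half turns. The four ends are
`(1, ±1, 0)` and `(3, ±1, 0)`. -/
def verticalTwists (b : ℤ) : Set (ℝ × ℝ × ℝ) :=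
  {p | ∃ v ∈ Set.Icc (0 : ℝ) 1, ∃ σ : ℝ, (σ = 1 ∨ σ = -1) ∧
    p = (2 + σ * Real.cos (b * Real.pi * v), -1 + 2 * v, σ * Real.sin (b * Real.pi * v))}

/-- The crossingless arcs joining the two twist regions. The upper and the lower right ends of the
horizontal region are joined by straight segments to the left ends of the vertical region; the upper
left end of the horizontal region is joined over the top to the upper right end of the vertical
region, and the lower ones are joined symmetrically around the bottom. -/
def connectingArcs : Set (ℝ × ℝ × ℝ) :=
  {p | p.2.2 = 0 ∧
    (((p.2.1 = 1 ∨ p.2.1 = -1) ∧ p.1 ∈ Set.Icc (-1 : ℝ) 1) ∨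
      ((p.2.1 = 2 ∨ p.2.1 = -2) ∧ p.1 ∈ Set.Icc (-3 : ℝ) 3) ∨
      ((p.1 = 3 ∨ p.1 = -3) ∧ |p.2.1| ∈ Set.Icc (1 : ℝ) 2))}

/-- The standard picture of Conway's `C(a, b)`: `a` horizontal and `b` vertical crossings, with the
handedness for which the diagram is alternating when `a` and `b` have the same sign. -/
def conwayModel (a b : ℤ) : Set S3 :=
  (fun p : ℝ × ℝ × ℝ => (p : S3)) '' (horizontalTwists a ∪ verticalTwists b ∪ connectingArcs)

/-- `K` is the knot (or link) in `S³` with Conway's notation `C(a, b)`. -/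
def HasConwayNotation (a b : ℤ) (K : Set S3) : Prop :=
  AmbientIsotopic (conwayModel a b) K

/-! ### The presentation -/

/-- The two generators. -/
inductive Gen
  | s
  | t
  deriving DecidableEq

/-- The generator `s` of the free group on `s, t`. -/
def s : FreeGroup Gen := FreeGroup.of Gen.s

/-- The generator `t` of the free group on `s, t`. -/
def t : FreeGroup Gen := FreeGroup.of Gen.t

/-- `w = (t s⁻¹ t s t⁻¹ s)ⁿ`. -/
def w (n : ℤ) : FreeGroup Gen := (t * s⁻¹ * t * s * t⁻¹ * s) ^ n

/-- The relator `s w t⁻¹ w⁻¹`. -/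
def relator (n : ℤ) : FreeGroup Gen := s * w n * t⁻¹ * (w n)⁻¹

/-- The group `⟨s, t | s w t⁻¹ w⁻¹ = 1⟩`. -/
abbrev knotGroup (n : ℤ) : Type := PresentedGroup {relator n}

/-! ### Schubert's normal form

The normal form of slope `r = β / α` (in lowest terms, `α` and `β` odd) is drawn on the sphere
`ℝ² / Γ`, where `Γ` is generated by the half-turns about the points of `ℤ²`. Its two straight
overbridges are the images of the vertical segments `{0} × [0, 1]` and `{1} × [0, 1]`, both oriented
upwards, with meridians `s` and `t` respectively. One of the two underpasses is the image of the
straight segment from `(0, 0)` to `(α, β)`; it runs from the first bridge to the second one. -/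

/-- The vertical line `{i} × ℝ` covers the bridge of `s` if `i` is even, that of `t` if `i`
is odd. -/
def bridge (i : ℕ) : Gen := if Even i then Gen.s else Gen.t

/-- The lift `{i} × [j, j + 1]` of a bridge is a translate of the oriented bridge by an element
of `2ℤ²`, hence oriented upwards, if `j` is even; if `j` is odd it is obtained by a half-turn and is
oriented downwards. -/
def pointsUp (j : ℤ) : Bool := decide (Even j)

/-- The word read along the underpass in the normal form of slope `r`. The interior of the segment
from `(0, 0)` to `(α, β)` meets the lifted bridges at the points `(i, i r)`, `0 < i < α`, in this
order. Each crossing contributes the generator of the bridge, with exponent `1` (`true`) or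
`-1` (`false`) according to the direction in which the bridge crosses. -/
def schubertWord (r : ℚ) : List (Gen × Bool) :=
  (List.range (r.den - 1)).map fun k => (bridge (k + 1), pointsUp ⌊((k + 1 : ℕ) : ℚ) * r⌋)

end TwoBridge

/-! The complement of the standard diagram is covered by five simply connected open sets: the part
`upSet` seen from above, its mirror image `downSet`, a neighbourhood of infinity, and one box for
each twist region. The whole cover is treated at once by `nonempty_fundamentalGroup_mulEquiv`. A
locally constant cocycle with values in `G` defines a covering with fibre `G`, whose monodromy is a
homomorphism from the fundamental group to `G`. It is onto if the values of the cocycle generate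
`G`. It is injective if every cocycle is, up to a coboundary, the image of the given one, as one
sees from the tautological cocycle formed by homotopy classes of paths.

The intersection of `upSet` and `downSet` consists of the four thickened faces of the diagram, so a
cocycle gives one group element per face. These are normalised to 1 on the outer face and called
`T`, `B`, `M` on the others. A twist region needs only one box, whatever its number of crossings: it
is a fat cylinder from which, outside the core, the ruled surface through the strands is removed.
The shell around the core then consists of two helical sectors joined at both ends. Along a sector
the faces on the two sides are crossed alternately, which produces powers of `N * P⁻¹`
(`turnValue`), and closing up at the far end costs exactly one relation, `BoxRelation`. Hence the
group is generated by the faces with one relation per twist region (`exists_faceSystem`,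
`nonempty_mulEquiv_of_faceSystem`).

The three vertical crossings give `B * M * T = M * M`, which eliminates `B`. With `s = T⁻¹` and `t =
T⁻¹ * M` the horizontal crossings give `s w = w t` (`isFaceSystem_iff`). An ambient isotopy and a
radial retraction transfer the result to every such knot and to its exteriors.

For Schubert's word, `r` differs from `2/3` by `1/(3α)`. So `⌊i r⌋` is the floor of `2i/3` or of
`(2i-1)/3`, the exponents have period six in `i`, and the word represents `w` if `n > 0` and `s w t`
if `n < 0`. Neighbouring letters always belong to different generators, so nothing cancels. -/

/-! ### The fundamental group from a cocycle on an open cover -/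

namespace TwoBridge

open Topology Filter Set unitInterval

section Cocycle

variable {X ι G : Type*} [Group G]

/-- A Čech cocycle with values in a group. -/
def IsCocycle (U : ι → Set X) (c : ι → ι → X → G) : Prop :=
  ∀ i j k, ∀ x, x ∈ U i → x ∈ U j → x ∈ U k → c i j x * c j k x = c i k x

theorem IsCocycle.self {U : ι → Set X} {c : ι → ι → X → G} (hc : IsCocycle U c) {i : ι} {x : X}
    (hx : x ∈ U i) : c i i x = 1 := by
  simpa using hc i i i x hx hx hx

theorem IsCocycle.inv {U : ι → Set X} {c : ι → ι → X → G} (hc : IsCocycle U c) {i j : ι} {x : X}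
    (hi : x ∈ U i) (hj : x ∈ U j) : (c i j x)⁻¹ = c j i x := by
  rw [inv_eq_iff_mul_eq_one, hc i j i x hi hj hi, hc.self hi]

end Cocycle

section Nerve

variable {X ι : Type*} [TopologicalSpace X]

theorem pathClass_trans_symm {x y z : X} (p : Path.Homotopic.Quotient x y)
    (q : Path.Homotopic.Quotient y z) : (p.trans q).symm = q.symm.trans p.symm := by
  induction p with | mk p => ?_
  induction q with | mk q => ?_
  simp only [← Path.Homotopic.Quotient.mk_trans, ← Path.Homotopic.Quotient.mk_symm,
    Path.trans_symm]

theorem pathClass_trans_symm_trans {x y z : X} (p : Path.Homotopic.Quotient x y)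
    (q : Path.Homotopic.Quotient x z) : p.trans (p.symm.trans q) = q := by
  grind

theorem pathClass_symm_trans_trans {x y z : X} (p : Path.Homotopic.Quotient x y)
    (q : Path.Homotopic.Quotient y z) : p.symm.trans (p.trans q) = q := by
  grind

/-- A property of homotopy classes of paths that is stable under concatenation and holds for
paths inside a member of an open cover holds for all paths. -/
theorem pathClass_induction {U : ι → Set X} (hU : ∀ i, IsOpen (U i)) (hcov : ∀ x, ∃ i, x ∈ U i)
    {P : ∀ {x y : X}, Path.Homotopic.Quotient x y → Prop}
    (short : ∀ i {x y : X} (γ : Path x y), (∀ τ, γ τ ∈ U i) → P (.mk γ))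
    (trans : ∀ {x y z : X} (p : Path.Homotopic.Quotient x y) (q : Path.Homotopic.Quotient y z),
      P p → P q → P (p.trans q))
    {x y : X} (p : Path.Homotopic.Quotient x y) : P p := by
  induction p with | mk γ =>
  -- The subpaths below start at `γ 0` and end at `γ 1`, which agree with the given end points only
  -- up to a propositional equality.
  have hcast : ∀ {x y x' y' : X} (p : Path.Homotopic.Quotient x y) (hx : x' = x) (hy : y' = y),
      P p → P (p.cast hx hy) := by
    rintro x y x' y' p rfl rfl h
    simpa using h
  obtain ⟨τ, τ0, τmono, ⟨N, hN⟩, hτ⟩ := exists_monotone_Icc_subset_open_cover_unitInterval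
    (c := fun i => γ ⁻¹' U i) (fun i => (hU i).preimage γ.continuous)
    (fun r _ => by simpa using hcov (γ r))
  have key : ∀ m, P (.mk (γ.subpath 0 (τ m))) := by
    intro m
    induction m with
    | zero =>
      obtain ⟨i, hi⟩ := hcov (γ 0)
      rw [τ0]
      exact short i _ fun r => by simpa using hi
    | succ m ih =>
      obtain ⟨i, hi⟩ := hτ m
      have h1 : P (.mk (γ.subpath (τ m) (τ (m + 1)))) := by
        refine short i _ fun r => ?_
        have : γ.subpath (τ m) (τ (m + 1)) r ∈ range (γ.subpath (τ m) (τ (m + 1))) := ⟨r, rfl⟩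
        rw [Path.range_subpath_of_le _ _ _ (τmono (Nat.le_succ m))] at this
        obtain ⟨r', hr', h⟩ := this
        rw [← h]
        exact hi hr'
      have h2 := trans _ _ ih h1
      rwa [← Path.Homotopic.Quotient.mk_trans,
        Path.Homotopic.Quotient.eq.2 ⟨Path.Homotopy.subpathTransSubpath γ 0 (τ m) (τ (m + 1))⟩]
        at h2
  have h := key N
  rw [hN N le_rfl, Path.subpath_zero_one] at h
  have h' := hcast _ γ.source.symm γ.target.symm h
  simpa using h'

/-- In a path-connected space with a base point, the points of a simply connected subset can be
joined to the base point compatibly with the paths in that subset. -/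
theorem exists_pathClass_family [PathConnectedSpace X] {S : Set X} (hS : IsSimplyConnected S)
    (x₀ : X) : ∃ q : ∀ x, Path.Homotopic.Quotient x₀ x,
      ∀ x y (γ : Path x y), (∀ τ, γ τ ∈ S) → (q x).trans (.mk γ) = q y := by
  classical
  have := hS.simplyConnectedSpace
  obtain ⟨b, hb⟩ := hS.nonempty
  -- Points of `S` are all reached through `b` and then inside `S`; the choice made off `S` is
  -- arbitrary and plays no role.
  let q : ∀ x, Path.Homotopic.Quotient x₀ x := fun x =>
    if h : x ∈ S then .trans (.mk (PathConnectedSpace.somePath x₀ b))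
      (.mk ((PathConnectedSpace.somePath (⟨b, hb⟩ : S) ⟨x, h⟩).map continuous_subtype_val))
    else .mk (PathConnectedSpace.somePath x₀ x)
  refine ⟨q, fun x y γ hγ => ?_⟩
  have hx : x ∈ S := by simpa using hγ 0
  have hy : y ∈ S := by simpa using hγ 1
  let γ' : Path (⟨x, hx⟩ : S) ⟨y, hy⟩ :=
    { toFun := fun τ => ⟨γ τ, hγ τ⟩, source' := by simp, target' := by simp }
  have hγ' : γ = γ'.map continuous_subtype_val := by ext; rfl
  have h1 := SimplyConnectedSpace.paths_homotopic
    ((PathConnectedSpace.somePath (⟨b, hb⟩ : S) ⟨x, hx⟩).trans γ')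
    (PathConnectedSpace.somePath (⟨b, hb⟩ : S) ⟨y, hy⟩)
  have h2 := Path.Homotopic.Quotient.eq.2 (h1.map ⟨_, continuous_subtype_val⟩)
  simp only [q, dif_pos hx, dif_pos hy]
  rw [← h2, hγ']
  simp only [ContinuousMap.coe_mk, Path.map_trans, Path.Homotopic.Quotient.mk_trans]
  grind

variable {G : Type*} [Group G]

/-- The principal bundle of a locally constant cocycle. -/
noncomputable def cocycleCore [TopologicalSpace G] [DiscreteTopology G] {U : ι → Set X}
    (hU : ∀ i, IsOpen (U i)) (hcov : ∀ x, ∃ i, x ∈ U i) {c : ι → ι → X → G} (hc : IsCocycle U c)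
    (hloc : ∀ i j, ∀ x ∈ U i ∩ U j, ∀ᶠ y in 𝓝 x, c i j y = c i j x) : FiberBundleCore ι X G where
  baseSet := U
  isOpen_baseSet := hU
  indexAt x := (hcov x).choose
  mem_baseSet_at x := (hcov x).choose_spec
  coordChange i j x v := c j i x * v
  coordChange_self i x hx v := by rw [hc.self hx, one_mul]
  continuousOn_coordChange i j := by
    rintro ⟨x, v⟩ ⟨hx, -⟩
    have h1 : ContinuousAt (fun p : X × G => c j i p.1) (x, v) := by
      refine ContinuousAt.comp (f := Prod.fst) (g := c j i) (x := (x, v)) ?_ continuousAt_fst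
      have := hloc j i x ⟨hx.2, hx.1⟩
      exact (continuousAt_const (y := c j i x)).congr (this.mono fun y hy => hy.symm)
    exact (h1.mul continuousAt_snd).continuousWithinAt
  coordChange_comp i j k x hx v := by
    rw [← mul_assoc, hc k j i x hx.2 hx.1.2 hx.1.1]

/-- The nerve form of the theorem of Seifert and van Kampen: if an open cover consists of simply
connected sets, a universal locally constant cocycle computes the fundamental group. -/
theorem nonempty_fundamentalGroup_mulEquiv [PathConnectedSpace X] {U : ι → Set X}
    (hU : ∀ i, IsOpen (U i)) (hcov : ∀ x, ∃ i, x ∈ U i) (hsc : ∀ i, IsSimplyConnected (U i))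
    {c : ι → ι → X → G} (hc : IsCocycle U c)
    (hloc : ∀ i j, ∀ x ∈ U i ∩ U j, ∀ᶠ y in 𝓝 x, c i j y = c i j x)
    (i₀ : ι) (x₀ : X) (hx₀ : x₀ ∈ U i₀)
    (hgen : Subgroup.closure {g | ∃ j, ∃ x ∈ U i₀ ∩ U j, ∃ y ∈ U i₀ ∩ U j,
      g = c i₀ j y * (c i₀ j x)⁻¹} = ⊤)
    (huniv : ∀ d : ι → ι → X → FundamentalGroup X x₀, IsCocycle U d →
      (∀ i j x y, JoinedIn (U i ∩ U j) x y → d i j x = d i j y) →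
      ∃ (f : G →* FundamentalGroup X x₀) (h : ι → FundamentalGroup X x₀),
        ∀ i j, ∀ x ∈ U i ∩ U j, d i j x = h i * f (c i j x) * (h j)⁻¹) :
    Nonempty (FundamentalGroup X x₀ ≃* G) := by
  let _ : TopologicalSpace G := ⊥
  have : DiscreteTopology G := ⟨rfl⟩
  let Z := cocycleCore hU hcov hc hloc
  have cov : IsCoveringMap Z.proj := FiberBundle.isCoveringMap
  have hidx : ∀ x, x ∈ U (Z.indexAt x) := Z.mem_baseSet_at
  -- `pt i x v` is the point over `x` whose coordinate in the chart `i` is `v`; changes of chart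
  -- multiply `v` on the left.
  let pt : ι → X → G → Z.TotalSpace := fun i x v => ⟨x, c (Z.indexAt x) i x * v⟩
  let fib : ∀ (i : ι) (x : X) (v : G), Z.proj ⁻¹' {x} := fun i x v => ⟨pt i x v, rfl⟩
  have pt_inj : ∀ i x v v', pt i x v = pt i x v' → v = v' := by
    intro i x v v' h
    have h1 := (Bundle.TotalSpace.mk.injEq _ _ _ _ ▸ h : x = x ∧ HEq _ _).2
    exact mul_left_cancel (eq_of_heq h1)
  have fib_change : ∀ i j x v, x ∈ U i → x ∈ U j → fib i x v = fib j x (c j i x * v) := by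
    intro i j x v hi hj
    apply Subtype.ext
    change (⟨x, _⟩ : Z.TotalSpace) = ⟨x, _⟩
    congr 1
    rw [← mul_assoc, hc _ _ _ x (hidx x) hj hi]
  -- transport along a path inside one member of the cover
  have short : ∀ k {x y : X} (γ : Path x y), (∀ τ, γ τ ∈ U k) → ∀ v,
      cov.monodromy (.mk γ) (fib k x v) = fib k y v := by
    intro k x y γ hγ v
    have hcont : Continuous fun τ => pt k (γ τ) v := by
      have h1 := (Z.localTriv k).continuousOn_invFun
      refine h1.comp_continuous (f := fun τ => (γ τ, v)) (by fun_prop) fun τ => ?_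
      exact ⟨hγ τ, trivial⟩
    let Γ : Path (fib k x v).1 (fib k y v).1 :=
      { toFun := fun τ => pt k (γ τ) v
        continuous_toFun := hcont
        source' := by simp [fib]
        target' := by simp [fib] }
    refine cov.monodromy_eq_of_map_eq (.mk Γ) ?_
    exact congrArg Path.Homotopic.Quotient.mk (Path.ext (funext fun _ => rfl))
  obtain ⟨q, hq⟩ : ∃ q : ∀ (_ : ι) x, Path.Homotopic.Quotient x₀ x,
      ∀ i x y (γ : Path x y), (∀ τ, γ τ ∈ U i) → (q i x).trans (.mk γ) = q i y := by
    choose q hq using fun i => exists_pathClass_family (hsc i) x₀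
    exact ⟨q, hq⟩
  -- The tautological cocycle. A product in the fundamental group runs through its right factor
  -- first, hence this order.
  let d : ι → ι → X → FundamentalGroup X x₀ := fun i j x => (q j x).trans (q i x).symm
  have dmul : ∀ i j k x, d i j x * d j k x = d i k x := by
    intro i j k x
    change ((q k x).trans (q j x).symm).trans ((q j x).trans (q i x).symm) =
      (q k x).trans (q i x).symm
    simp only [Path.Homotopic.Quotient.trans_assoc, pathClass_symm_trans_trans]
  obtain ⟨f, h, hfh⟩ := huniv d (fun i j k x _ _ _ => dmul i j k x) (by
    rintro i j x y ⟨γ, hγ⟩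
    change (q j x).trans (q i x).symm = (q j y).trans (q i y).symm
    rw [← hq i x y γ fun τ => (hγ τ).1, ← hq j x y γ fun τ => (hγ τ).2]
    simp only [Path.Homotopic.Quotient.trans_assoc, pathClass_trans_symm,
      pathClass_trans_symm_trans])
  -- The invariant carried along paths: one and the same `g` describes the monodromy and, after
  -- applying `f` and correcting by `h`, the class of the path closed up by `q`. It is
  -- multiplicative, so short paths suffice.
  have main : ∀ {x y : X} (p : Path.Homotopic.Quotient x y), ∀ i j, x ∈ U i → y ∈ U j →
      ∃ g : G, (∀ v, cov.monodromy p (fib i x v) = fib j y (g * v)) ∧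
        ((q i x).trans (p.trans (q j y).symm) : FundamentalGroup X x₀) = h j * f g * (h i)⁻¹ := by
    intro x y p
    induction p using pathClass_induction hU hcov with
    | short k γ hγ =>
      rename_i x y
      intro i j hi hj
      have hxk : x ∈ U k := by simpa using hγ 0
      have hyk : y ∈ U k := by simpa using hγ 1
      refine ⟨c j k y * c k i x, fun v => ?_, ?_⟩
      · rw [fib_change i k x v hi hxk, short k γ hγ, fib_change k j y _ hyk hj, mul_assoc]
      · have e1 : ((q i x).trans ((Path.Homotopic.Quotient.mk γ).trans (q j y).symm) :
            FundamentalGroup X x₀) = d j k y * d k i x := by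
          change _ = ((q i x).trans (q k x).symm).trans ((q k y).trans (q j y).symm)
          rw [← hq k x y γ hγ]
          simp only [Path.Homotopic.Quotient.trans_assoc, pathClass_symm_trans_trans]
        rw [e1, hfh j k y ⟨hj, hyk⟩, hfh k i x ⟨hxk, hi⟩, map_mul]
        group
    | trans p₁ p₂ ih₁ ih₂ =>
      rename_i x y z
      intro i j hi hj
      obtain ⟨k, hk⟩ := hcov y
      obtain ⟨g₁, h₁, h₁'⟩ := ih₁ i k hi hk
      obtain ⟨g₂, h₂, h₂'⟩ := ih₂ k j hk hj
      refine ⟨g₂ * g₁, fun v => ?_, ?_⟩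
      · rw [cov.monodromy_trans_apply, h₁, h₂, mul_assoc]
      · have e1 : ((q i x).trans ((p₁.trans p₂).trans (q j z).symm) : FundamentalGroup X x₀) =
            (h j * f g₂ * (h k)⁻¹) * (h k * f g₁ * (h i)⁻¹) := by
          rw [← h₁', ← h₂']
          change _ = ((q i x).trans (p₁.trans (q k y).symm)).trans
            ((q k y).trans (p₂.trans (q j z).symm))
          simp only [Path.Homotopic.Quotient.trans_assoc, pathClass_symm_trans_trans]
        rw [e1, map_mul]
        group
  choose T hT hT' using fun p : FundamentalGroup X x₀ => main p i₀ i₀ hx₀ hx₀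
  have T_unique : ∀ (p : FundamentalGroup X x₀) (g : G),
      cov.monodromy p (fib i₀ x₀ 1) = fib i₀ x₀ g → T p = g := by
    intro p g hg
    have h1 := (hT p 1).symm.trans hg
    simpa using pt_inj _ _ _ _ (congrArg Subtype.val h1)
  let Φ : FundamentalGroup X x₀ →* G :=
    { toFun := T
      map_one' := T_unique _ _ (by
        rw [FundamentalGroup.one_def, cov.monodromy_refl]; rfl)
      map_mul' := fun p p' => T_unique _ _ (by
        rw [FundamentalGroup.mul_def, cov.monodromy_trans_apply, hT, hT, mul_one]) }
  refine ⟨MulEquiv.ofBijective Φ ⟨?_, ?_⟩⟩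
  · rw [injective_iff_map_eq_one]
    -- If the monodromy of `p` is trivial, then so is its conjugate by `q i₀ x₀`, hence `p` itself.
    intro p hp
    have h1 := hT' p
    rw [show T p = 1 from hp, map_one, mul_one, mul_inv_cancel] at h1
    have h2 : (q i₀ x₀).trans (Path.Homotopic.Quotient.trans p (q i₀ x₀).symm) =
      Path.Homotopic.Quotient.refl x₀ := h1
    change p = Path.Homotopic.Quotient.refl x₀
    have h3 : p = (q i₀ x₀).symm.trans
        (((q i₀ x₀).trans (Path.Homotopic.Quotient.trans p (q i₀ x₀).symm)).trans (q i₀ x₀)) := by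
      simp only [Path.Homotopic.Quotient.trans_assoc, pathClass_symm_trans_trans,
        Path.Homotopic.Quotient.symm_trans, Path.Homotopic.Quotient.trans_refl]
    rw [h3, h2]
    simp
  · rw [← MonoidHom.range_eq_top, ← top_le_iff, ← hgen, Subgroup.closure_le]
    rintro _ ⟨j, x, hx, y, hy, rfl⟩
    have hi := (hsc i₀).isPathConnected
    have hj := (hsc j).isPathConnected
    obtain ⟨γ₁, hγ₁⟩ := hi.joinedIn x₀ hx₀ x hx.1
    obtain ⟨γ₂, hγ₂⟩ := hj.joinedIn x hx.2 y hy.2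
    obtain ⟨γ₃, hγ₃⟩ := hi.joinedIn y hy.1 x₀ hx₀
    -- This loop leaves `U i₀` for `U j` at `x` and returns at `y`, so its monodromy is the given
    -- generator.
    refine ⟨((Path.Homotopic.Quotient.mk γ₁).trans (.mk γ₂)).trans (.mk γ₃), T_unique _ _ ?_⟩
    rw [cov.monodromy_trans_apply, cov.monodromy_trans_apply, short i₀ γ₁ hγ₁,
      fib_change i₀ j x _ hx.1 hx.2, short j γ₂ hγ₂, fib_change j i₀ y _ hy.2 hy.1,
      short i₀ γ₃ hγ₃, hc.inv hx.1 hx.2, mul_one]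

end Nerve


-- Seifert–van Kampen for a subset of an ambient space

universe u

theorem joinedIn_subtype {Y : Type*} [TopologicalSpace Y] {S V : Set Y} {x y : Y}
    (h : JoinedIn V x y) (hV : V ⊆ S) :
    JoinedIn ((↑) ⁻¹' V : Set S) ⟨x, hV h.source_mem⟩ ⟨y, hV h.target_mem⟩ := by
  obtain ⟨γ, hγ⟩ := h
  exact ⟨{ toFun := fun τ => ⟨γ τ, hV (hγ τ)⟩, source' := by simp, target' := by simp }, hγ⟩

/-- The nerve form of the theorem of Seifert and van Kampen for a subset `S` of a space, covered
by open simply connected sets. -/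
theorem nonempty_fundamentalGroup_mulEquiv_of_cover {Y : Type u} {ι G : Type*}
    [TopologicalSpace Y] [Group G] {S : Set Y} {U : ι → Set Y}
    (hU : ∀ i, IsOpen (U i)) (hS : ∀ x, x ∈ S ↔ ∃ i, x ∈ U i) (hsc : ∀ i, IsSimplyConnected (U i))
    {c : ι → ι → Y → G} (hc : IsCocycle U c)
    (hloc : ∀ i j, ∀ x ∈ U i ∩ U j, ∀ᶠ y in 𝓝 x, c i j y = c i j x)
    (i₀ : ι) (hne : ∀ j, (U i₀ ∩ U j).Nonempty)
    (hgen : Subgroup.closure {g | ∃ j, ∃ x ∈ U i₀ ∩ U j, ∃ y ∈ U i₀ ∩ U j,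
      g = c i₀ j y * (c i₀ j x)⁻¹} = ⊤)
    (huniv : ∀ (H : Type u) [Group H] (d : ι → ι → Y → H), IsCocycle U d →
      (∀ i j x y, JoinedIn (U i ∩ U j) x y → d i j x = d i j y) →
      ∃ (f : G →* H) (h : ι → H), ∀ i j, ∀ x ∈ U i ∩ U j, d i j x = h i * f (c i j x) * (h j)⁻¹)
    (x : S) : Nonempty (FundamentalGroup S x ≃* G) := by
  classical
  have hUS : ∀ i, U i ⊆ S := fun i y hy => (hS y).2 ⟨i, hy⟩
  obtain ⟨x₀, hx₀, -⟩ := hne i₀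
  have hjoin : ∀ y ∈ S, JoinedIn S x₀ y := by
    intro y hy
    obtain ⟨j, hj⟩ := (hS y).1 hy
    obtain ⟨z, hz, hz'⟩ := hne j
    exact (((hsc i₀).isPathConnected.joinedIn x₀ hx₀ z hz).mono (hUS i₀)).trans
      (((hsc j).isPathConnected.joinedIn z hz' y hj).mono (hUS j))
  have : PathConnectedSpace S := isPathConnected_iff_pathConnectedSpace.1
    ⟨x₀, hUS i₀ hx₀, fun {y} hy => hjoin y hy⟩
  let V : ι → Set S := fun i => (↑) ⁻¹' U i
  have hV : ∀ i j y (hy : y ∈ U i ∩ U j), (⟨y, hUS i hy.1⟩ : S) ∈ V i ∩ V j := fun i j y hy => hy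
  have key : Nonempty (FundamentalGroup S ⟨x₀, hUS i₀ hx₀⟩ ≃* G) := by
    refine nonempty_fundamentalGroup_mulEquiv (U := V) (c := fun i j y => c i j y)
      (fun i => (hU i).preimage continuous_subtype_val) (fun y => (hS y).1 y.2) (fun i => ?_)
      (fun i j k y hi hj hk => hc i j k y hi hj hk)
      (fun i j y hy => continuous_subtype_val.continuousAt.eventually (hloc i j y hy))
      i₀ _ hx₀ ?_ ?_
    · rw [← IsEmbedding.subtypeVal.isSimplyConnected_image]
      convert hsc i
      exact (Subtype.image_preimage_coe _ _).trans (inter_eq_right.2 (hUS i))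
    · rw [← top_le_iff, ← hgen]
      refine Subgroup.closure_mono ?_
      rintro _ ⟨j, y, hy, z, hz, rfl⟩
      exact ⟨j, _, hV i₀ j y hy, _, hV i₀ j z hz, rfl⟩
    · intro d hd hdj
      obtain ⟨f, h, hf⟩ := huniv _ (fun i j y => if hy : y ∈ S then d i j ⟨y, hy⟩ else 1)
        (fun i j k y hi hj hk => by
          simp only [dif_pos (hUS i hi)]
          exact hd i j k ⟨y, hUS i hi⟩ hi hj hk)
        (fun i j y z hyz => by
          simp only [dif_pos (hUS i hyz.source_mem.1), dif_pos (hUS i hyz.target_mem.1)]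
          exact hdj i j _ _ (joinedIn_subtype hyz fun w hw => hUS i hw.1))
      refine ⟨f, h, fun i j y hy => ?_⟩
      have := hf i j y hy
      rwa [dif_pos y.2] at this
  exact key.map fun e =>
    (FundamentalGroup.fundamentalGroupMulEquivOfPathConnected x _).trans e

/-! ### Contractibility criteria -/

section Segments

variable {E : Type*} [AddCommGroup E] [Module ℝ E] [TopologicalSpace E] [ContinuousAdd E]
  [ContinuousSMul ℝ E]

/-- A set which can be moved along straight segments into a position from which it can be moved
along straight segments to a point is simply connected. -/
theorem isSimplyConnected_of_segments {S : Set E} {r : E → E} (hr : Continuous r) {c : E}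
    (hc : c ∈ S) (h₁ : ∀ p ∈ S, segment ℝ p (r p) ⊆ S) (h₂ : ∀ p ∈ S, segment ℝ (r p) c ⊆ S) :
    IsSimplyConnected S := by
  have line : ∀ (f g : C(S, E)) (h : ∀ p, segment ℝ (f p) (g p) ⊆ S),
      ContinuousMap.Homotopic
        (⟨fun p => ⟨f p, h p (left_mem_segment ℝ _ _)⟩, by fun_prop⟩ : C(S, S))
        (⟨fun p => ⟨g p, h p (right_mem_segment ℝ _ _)⟩, by fun_prop⟩ : C(S, S)) := by
    intro f g h
    refine ⟨⟨⟨fun q => ⟨(1 - (q.1 : ℝ)) • f q.2 + (q.1 : ℝ) • g q.2, h q.2 ?_⟩, ?_⟩, ?_, ?_⟩⟩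
    · exact ⟨1 - (q.1 : ℝ), q.1, by linarith [q.1.2.2], q.1.2.1, by ring, rfl⟩
    · fun_prop
    · intro p; simp
    · intro p; simp
  have h : ContractibleSpace S := by
    rw [contractible_iff_id_nullhomotopic]
    refine ⟨⟨c, hc⟩, ?_⟩
    exact (line ⟨Subtype.val, by fun_prop⟩ ⟨fun p => r p, by fun_prop⟩ fun p => h₁ p p.2).trans
      (line ⟨fun p => r p, by fun_prop⟩ ⟨fun _ => c, by fun_prop⟩ fun p => h₂ p p.2)
  exact SimplyConnectedSpace.ofContractible S

end Segments

/-! ### Contractibility of the neighbourhoods of infinity -/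

section Infinity

variable {E : Type*} [NormedAddCommGroup E]

/-- The part of the one-point compactification outside the closed ball of radius `R`. -/
def outside (E : Type*) [NormedAddCommGroup E] (R : ℝ) : Set (OnePoint E) :=
  ((↑) '' {v : E | ‖v‖ ≤ R})ᶜ

@[simp] theorem coe_mem_outside {R : ℝ} {v : E} : (v : OnePoint E) ∈ outside E R ↔ R < ‖v‖ := by
  simp [outside]

@[simp] theorem infty_mem_outside {R : ℝ} : (OnePoint.infty : OnePoint E) ∈ outside E R := by
  simp [outside]

variable [ProperSpace E]

theorem mem_nhds_infty_iff_exists_norm {s : Set (OnePoint E)} :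
    s ∈ 𝓝 (OnePoint.infty : OnePoint E) ↔
      OnePoint.infty ∈ s ∧ ∃ M : ℝ, ∀ v : E, M < ‖v‖ → (v : OnePoint E) ∈ s := by
  rw [OnePoint.nhds_infty_eq, mem_sup, mem_map, coclosedCompact_eq_cocompact,
    ← Metric.cobounded_eq_cocompact, and_comm]
  simp only [mem_pure]
  refine and_congr Iff.rfl ?_
  rw [← comap_norm_atTop, mem_comap]
  constructor
  · rintro ⟨t, ht, hts⟩
    obtain ⟨M, hM⟩ := mem_atTop_sets.1 ht
    exact ⟨M, fun v hv => hts (hM _ hv.le)⟩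
  · rintro ⟨M, hM⟩
    exact ⟨Ioi M, Ioi_mem_atTop M, fun v hv => hM v hv⟩

theorem isOpen_outside (R : ℝ) : IsOpen (outside E R) := by
  have h : IsCompact {v : E | ‖v‖ ≤ R} := by
    have := isCompact_closedBall (0 : E) R
    simpa [Metric.closedBall, dist_zero_right] using this
  rw [outside, OnePoint.isOpen_compl_image_coe]
  exact ⟨h.isClosed, h⟩

variable [NormedSpace ℝ E]

/-- Pushing a point towards infinity. -/
noncomputable def pushOut (τ : ℝ) : OnePoint E → OnePoint E
  | OnePoint.infty => OnePoint.infty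
  | OnePoint.some v => if τ = 1 then OnePoint.infty else (((1 - τ)⁻¹ • v : E) : OnePoint E)

/-- Only points sent to infinity need care: there the norms of nearby finite images must become
arbitrarily large. Near infinity this holds because pushing never decreases a norm. Near `τ = 1` it
holds because norms stay above `R > 0` while the factor `(1 - τ)⁻¹` blows up. -/
theorem continuousAt_pushOut {R : ℝ} (hR : 0 < R) {q : ℝ × OnePoint E} (hq : q.2 ∈ outside E R)
    (hτ : q.1 ∈ Icc (0 : ℝ) 1) :
    ContinuousWithinAt (fun q : ℝ × OnePoint E => pushOut q.1 q.2) (Icc 0 1 ×ˢ outside E R) q := by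
  obtain ⟨τ, x⟩ := q
  have hmain : ∀ x : OnePoint E, x ∈ outside E R → pushOut τ x = OnePoint.infty →
      (∀ M : ℝ, ∀ᶠ q : ℝ × OnePoint E in 𝓝[Icc 0 1 ×ˢ outside E R] (τ, x),
        ∀ v : E, q.2 = v → q.1 ≠ 1 → M < ‖(1 - q.1)⁻¹ • v‖) →
      ContinuousWithinAt (fun q : ℝ × OnePoint E => pushOut q.1 q.2) (Icc 0 1 ×ˢ outside E R)
        (τ, x) := by
    intro x hx h0 hev
    change Tendsto _ _ (𝓝 (pushOut τ x))
    rw [h0]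
    intro s hs
    obtain ⟨h1, M, hM⟩ := mem_nhds_infty_iff_exists_norm.1 hs
    rw [mem_map]
    filter_upwards [hev M] with q hq'
    obtain ⟨τ', y⟩ := q
    induction y using OnePoint.rec with
    | infty => exact h1
    | coe v =>
      change pushOut τ' (OnePoint.some v) ∈ s
      by_cases h : τ' = 1
      · simpa [pushOut, h] using h1
      · simp only [pushOut, if_neg h]
        exact hM _ (hq' v rfl h)
  induction x using OnePoint.rec with
  | infty =>
    refine hmain _ hq rfl fun M => ?_
    have h1 : ∀ᶠ y : OnePoint E in 𝓝 OnePoint.infty, ∀ v : E, y = v → |M| < ‖v‖ := by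
      have : {y : OnePoint E | ∀ v : E, y = v → |M| < ‖v‖} ∈ 𝓝 OnePoint.infty := by
        rw [mem_nhds_infty_iff_exists_norm]
        refine ⟨fun v hv => absurd hv (OnePoint.infty_ne_coe v), |M|, fun v hv w hw => ?_⟩
        rwa [← OnePoint.coe_injective hw]
      exact this
    have h2 : ∀ᶠ q : ℝ × OnePoint E in 𝓝 (τ, OnePoint.infty), ∀ v : E, q.2 = v → |M| < ‖v‖ :=
      (continuousAt_snd (p := (τ, (OnePoint.infty : OnePoint E)))).eventually h1
    filter_upwards [mem_nhdsWithin_of_mem_nhds h2, self_mem_nhdsWithin] with q hq' hq'' v hv hne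
    have h3 := hq' v hv
    have h4 : 0 < 1 - q.1 := by
      rcases lt_or_eq_of_le hq''.1.2 with h | h
      · linarith
      · exact absurd h hne
    have h5 : 1 ≤ (1 - q.1)⁻¹ := by
      rw [one_le_inv₀ h4]; linarith [hq''.1.1]
    rw [norm_smul, Real.norm_of_nonneg (by positivity)]
    nlinarith [le_abs_self M, norm_nonneg v]
  | coe v₀ =>
    by_cases h : τ = 1
    · subst h
      refine hmain _ hq (by simp [pushOut]) fun M => ?_
      have h2 : ∀ᶠ q : ℝ × OnePoint E in 𝓝 (1, (v₀ : OnePoint E)), 1 - q.1 < R / (|M| + 1) := by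
        have h3 : ContinuousAt (fun q : ℝ × OnePoint E => 1 - q.1) (1, (v₀ : OnePoint E)) := by
          fun_prop
        refine h3.eventually_lt continuousAt_const ?_
        simp only [sub_self]
        positivity
      filter_upwards [mem_nhdsWithin_of_mem_nhds h2, self_mem_nhdsWithin] with q hq' hq'' v hv hne
      have h3 : R < ‖v‖ := by simpa [hv] using hq''.2
      have h4 : 0 < 1 - q.1 := by
        rcases lt_or_eq_of_le hq''.1.2 with h | h
        · linarith
        · exact absurd h hne
      rw [norm_smul, Real.norm_of_nonneg (by positivity), inv_mul_eq_div, lt_div_iff₀ h4]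
      rw [lt_div_iff₀ (by positivity)] at hq'
      nlinarith [le_abs_self M]
    · refine ContinuousAt.continuousWithinAt ?_
      have h0 : Tendsto (fun q : ℝ × E => (((1 - q.1)⁻¹ • q.2 : E) : OnePoint E)) (𝓝 (τ, v₀))
          (𝓝 ((((1 - τ)⁻¹ • v₀ : E) : OnePoint E))) := by
        refine (OnePoint.continuous_coe.tendsto _).comp ?_
        have : 1 - τ ≠ 0 := fun h' => h (by linarith)
        exact ((continuousAt_const.sub continuousAt_fst).inv₀ this).smul continuousAt_snd
      have h1 : 𝓝 (τ, (v₀ : OnePoint E)) = map (Prod.map id (↑)) (𝓝 (τ, v₀)) := by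
        rw [nhds_prod_eq, OnePoint.nhds_coe_eq, nhds_prod_eq, ← Filter.prod_map_map_eq', map_id]
      have h2 : pushOut τ (v₀ : OnePoint E) = (((1 - τ)⁻¹ • v₀ : E) : OnePoint E) := by
        simp [pushOut, h]
      change Tendsto _ _ (𝓝 (pushOut τ (v₀ : OnePoint E)))
      rw [h2, h1, tendsto_map'_iff]
      refine h0.congr' ?_
      have h3 : ∀ᶠ q : ℝ × E in 𝓝 (τ, v₀), q.1 ≠ 1 :=
        (continuousAt_fst (p := (τ, v₀))).eventually_ne h
      filter_upwards [h3] with q hq'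
      change _ = pushOut q.1 (OnePoint.some q.2)
      simp [pushOut, hq']

theorem isSimplyConnected_outside {R : ℝ} (hR : 0 < R) : IsSimplyConnected (outside E R) := by
  have hmem : ∀ τ ∈ Icc (0 : ℝ) 1, ∀ x ∈ outside E R, pushOut τ x ∈ outside E R := by
    intro τ hτ x hx
    induction x using OnePoint.rec with
    | infty => exact hx
    | coe v =>
      by_cases h : τ = 1
      · simp [pushOut, h]
      · simp only [pushOut, if_neg h]
        have h4 : 0 < 1 - τ := by
          rcases lt_or_eq_of_le hτ.2 with h' | h'
          · linarith
          · exact absurd h' h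
        have h5 : 1 ≤ (1 - τ)⁻¹ := by
          rw [one_le_inv₀ h4]; linarith [hτ.1]
        change (((1 - τ)⁻¹ • v : E) : OnePoint E) ∈ _
        rw [coe_mem_outside] at hx ⊢
        rw [norm_smul, Real.norm_of_nonneg (by positivity)]
        nlinarith [norm_nonneg v]
  have hcont : Continuous fun q : I × outside E R => pushOut (q.1 : ℝ) (q.2 : OnePoint E) := by
    have h1 : ContinuousOn (fun q : ℝ × OnePoint E => pushOut q.1 q.2) (Icc 0 1 ×ˢ outside E R) :=
      fun q hq => continuousAt_pushOut hR hq.2 hq.1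
    exact h1.comp_continuous (f := fun q : I × outside E R => ((q.1 : ℝ), (q.2 : OnePoint E)))
      (by fun_prop) fun q => ⟨q.1.2, q.2.2⟩
  have h : ContractibleSpace (outside E R) := by
    rw [contractible_iff_id_nullhomotopic]
    refine ⟨⟨OnePoint.infty, by simp⟩, ⟨⟨⟨fun q => ⟨pushOut (q.1 : ℝ) (q.2 : OnePoint E),
      hmem _ q.1.2 _ q.2.2⟩, ?_⟩, ?_, ?_⟩⟩⟩
    · exact hcont.subtype_mk _
    · rintro ⟨x, hx⟩
      apply Subtype.ext
      induction x using OnePoint.rec with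
      | infty => rfl
      | coe v =>
        change pushOut (0 : ℝ) (OnePoint.some v) = v
        simp [pushOut]
    · rintro ⟨x, hx⟩
      apply Subtype.ext
      induction x using OnePoint.rec with
      | infty => rfl
      | coe v =>
        change pushOut (1 : ℝ) (OnePoint.some v) = _
        simp [pushOut]
  exact SimplyConnectedSpace.ofContractible _

end Infinity

open scoped ContinuousMap

/-! ### Isotopies and exteriors -/

theorem nonempty_fundamentalGroup_mulEquiv_of_homotopyEquiv {X Y : Type} {G : Type*}
    [TopologicalSpace X] [TopologicalSpace Y] [Group G] (e : X ≃ₕ Y)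
    (h : ∀ y : Y, Nonempty (FundamentalGroup Y y ≃* G)) (x : X) :
    Nonempty (FundamentalGroup X x ≃* G) := by
  let F := FundamentalGroupoidFunctor.equivOfHomotopyEquiv e
  let x' : FundamentalGroupoid X := ⟨x⟩
  have h1 : FundamentalGroup X x ≃* CategoryTheory.End (F.functor.obj x') :=
    F.fullyFaithfulFunctor.mulEquivEnd x'
  exact (h (F.functor.obj x').as).map fun e' => h1.trans e'

theorem AmbientIsotopic.nonempty_homeomorph_compl {X : Type*} [TopologicalSpace X] {A B : Set X}
    (h : AmbientIsotopic A B) : Nonempty (↥(Bᶜ) ≃ₜ ↥(Aᶜ)) := by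
  obtain ⟨H, -, -, hAB⟩ := h
  have h1 : H 1 '' Aᶜ = Bᶜ := by rw [image_compl_eq (H 1).bijective, hAB]
  exact ⟨(Homeomorph.setCongr h1.symm).trans ((H 1).image Aᶜ).symm⟩

section Exterior

variable {X : Type} [TopologicalSpace X] [T2Space X]

/-- The radial factor which pushes a nonzero vector of norm at most one towards the unit circle. -/
noncomputable def radialFactor (τ : ℝ) (v : ℂ) : ℝ := 1 - τ + τ * ‖v‖⁻¹

theorem norm_radialFactor_smul {τ : ℝ} (hτ : τ ∈ Icc (0 : ℝ) 1) {v : ℂ} (hv : v ≠ 0) :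
    ‖radialFactor τ v • v‖ = (1 - τ) * ‖v‖ + τ := by
  have h0 : 0 < ‖v‖ := norm_pos_iff.2 hv
  have h1 : 0 ≤ radialFactor τ v := by
    have := hτ.1
    have := hτ.2
    unfold radialFactor
    have : 0 ≤ τ * ‖v‖⁻¹ := by positivity
    linarith
  rw [norm_smul, Real.norm_of_nonneg h1, radialFactor]
  field_simp

/-- The punctured tube is pushed radially outwards onto its boundary torus, which makes the exterior
a deformation retract of the complement of `K`. -/
theorem isTubularNeighbourhood_homotopyEquiv {φ : Circle × ℂ → X} {K : Set X}
    (hφ : IsTubularNeighbourhood φ K) : Nonempty (↥(exterior φ) ≃ₕ ↥(Kᶜ)) := by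
  classical
  obtain ⟨hemb, hK⟩ := hφ
  have hinj := hemb.injective
  have hmemK : ∀ p : Circle × ℂ, φ p ∈ K ↔ p.2 = 0 := by
    intro p
    rw [← hK]
    exact hinj.mem_set_image
  have hext : ∀ p : Circle × ℂ, φ p ∈ exterior φ ↔ 1 ≤ ‖p.2‖ := by
    intro p
    rw [exterior, mem_compl_iff, hinj.mem_set_image]
    simp
  have hsub : exterior φ ⊆ Kᶜ := by
    intro x hx hxK
    rw [← hK] at hxK
    obtain ⟨p, hp, rfl⟩ := hxK
    rw [hext, show p.2 = 0 from hp, norm_zero] at hx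
    linarith
  -- the closed pieces of the complement
  let A : Set (I × ↥(Kᶜ)) := {q | (q.2 : X) ∈ exterior φ}
  let B : Set (I × ↥(Kᶜ)) := {q | (q.2 : X) ∈ φ '' {p | ‖p.2‖ ≤ 1}}
  have hA : IsClosed A := by
    have h1 : IsClosed (exterior φ) := by
      have h2 : IsOpen {p : Circle × ℂ | ‖p.2‖ < 1} :=
        isOpen_lt (by fun_prop) continuous_const
      exact (hemb.isOpenMap _ h2).isClosed_compl
    exact h1.preimage (by fun_prop)
  have hB : IsClosed B := by
    have h1 : IsCompact {p : Circle × ℂ | ‖p.2‖ ≤ 1} := by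
      have h2 : {p : Circle × ℂ | ‖p.2‖ ≤ 1} = univ ×ˢ Metric.closedBall 0 1 := by
        ext p; simp
      rw [h2]
      exact isCompact_univ.prod (isCompact_closedBall _ _)
    exact (h1.image hemb.continuous).isClosed.preimage (by fun_prop)
  have hAB : A ∪ B = univ := by
    refine eq_univ_of_forall fun q => ?_
    by_cases h : (q.2 : X) ∈ exterior φ
    · exact Or.inl h
    · obtain ⟨p, hp, hpq⟩ := not_not.1 h
      exact Or.inr ⟨p, le_of_lt (show ‖p.2‖ < 1 from hp), hpq⟩
  let ψ := (hemb.toOpenPartialHomeomorph φ).symm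
  have hψ : ∀ p, ψ (φ p) = p := fun p =>
    hemb.toOpenPartialHomeomorph_left_inv φ
  let push : ℝ → X → X := fun τ x =>
    φ ((ψ x).1, radialFactor τ (ψ x).2 • (ψ x).2)
  -- On the boundary torus the radial factor is 1, so both formulas agree there, and they can be
  -- pasted along the closed sets `A` and `B`.
  let f : I × ↥(Kᶜ) → X := fun q => if (q.2 : X) ∈ exterior φ then (q.2 : X) else push q.1 q.2
  have hpush : ∀ τ p, push τ (φ p) = φ (p.1, radialFactor τ p.2 • p.2) := by
    intro τ p
    simp only [push, hψ]
  have fA : EqOn f (fun q => (q.2 : X)) A := fun q hq => if_pos hq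
  have fB : EqOn f (fun q => push q.1 q.2) B := by
    intro q hq
    by_cases h : (q.2 : X) ∈ exterior φ
    · obtain ⟨p, hp, hpq⟩ := hq
      change f q = push q.1 q.2
      rw [← hpq, hext] at h
      have h1 : ‖p.2‖ = 1 := le_antisymm hp h
      rw [show f q = q.2 from if_pos (by rw [← hpq, hext]; exact h), ← hpq, hpush]
      simp [radialFactor, h1]
    · exact if_neg h
  have hf : Continuous f := by
    rw [← continuousOn_univ, ← hAB]
    refine ContinuousOn.union_of_isClosed ?_ ?_ hA hB
    · exact ContinuousOn.congr (by fun_prop) fA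
    · refine ContinuousOn.congr ?_ fB
      have h1 : ContinuousOn (fun q : I × ↥(Kᶜ) => ψ q.2) B := by
        have h2 : ContinuousOn ψ (range φ) := by
          have := ψ.continuousOn
          simpa [ψ] using this
        refine h2.comp (by fun_prop) ?_
        rintro q ⟨p, -, hp⟩
        exact ⟨p, hp⟩
      have h3 : ∀ q ∈ B, (ψ q.2).2 ≠ 0 := by
        rintro q ⟨p, -, hp⟩ h0
        rw [← hp, hψ] at h0
        exact q.2.2 (hp ▸ (hmemK p).2 h0)
      have h4 : ContinuousOn (fun q : I × ↥(Kᶜ) => radialFactor q.1 (ψ q.2).2) B := by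
        unfold radialFactor
        have h5 : ContinuousOn (fun q : I × ↥(Kᶜ) => ‖(ψ q.2).2‖⁻¹) B :=
          (continuous_norm.comp_continuousOn (continuous_snd.comp_continuousOn h1)).inv₀
            fun q hq => norm_ne_zero_iff.2 (h3 q hq)
        fun_prop
      exact hemb.continuous.comp_continuousOn
        ((continuous_fst.comp_continuousOn h1).prodMk
          (h4.smul (continuous_snd.comp_continuousOn h1)))
  have hfK : ∀ q, f q ∈ Kᶜ := by
    intro q
    by_cases h : (q.2 : X) ∈ exterior φ
    · rw [fA h]; exact q.2.2
    · obtain ⟨p, hp, hpq⟩ := not_not.1 h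
      have hp0 : p.2 ≠ 0 := fun h0 => q.2.2 (hpq ▸ (hmemK p).2 h0)
      rw [show f q = push q.1 q.2 from if_neg h, ← hpq, hpush, mem_compl_iff, hmemK]
      rw [← norm_eq_zero, norm_radialFactor_smul q.1.2 hp0]
      have h1 := q.1.2.1
      have h2 := q.1.2.2
      have h3 : 0 < ‖p.2‖ := norm_pos_iff.2 hp0
      have h4 : ‖p.2‖ < 1 := hp
      nlinarith
  have hf1 : ∀ x : ↥(Kᶜ), f (1, x) ∈ exterior φ := by
    intro x
    by_cases h : (x : X) ∈ exterior φ
    · rw [fA h]; exact h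
    · obtain ⟨p, hp, hpq⟩ := not_not.1 h
      have hp0 : p.2 ≠ 0 := fun h0 => x.2 (hpq ▸ (hmemK p).2 h0)
      rw [show f (1, x) = push 1 x from if_neg h, ← hpq, hpush, hext,
        norm_radialFactor_smul (by simp) hp0]
      simp
  have hf0 : ∀ x : ↥(Kᶜ), f (0, x) = x := by
    intro x
    by_cases h : (x : X) ∈ exterior φ
    · rw [fA h]
    · obtain ⟨p, hp, hpq⟩ := not_not.1 h
      rw [show f (0, x) = push 0 x from if_neg h, ← hpq, hpush]
      simp [radialFactor]
  let incl : C(↥(exterior φ), ↥(Kᶜ)) := ⟨fun x => ⟨x, hsub x.2⟩, by fun_prop⟩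
  let retr : C(↥(Kᶜ), ↥(exterior φ)) := ⟨fun x => ⟨f (1, x), hf1 x⟩, by fun_prop⟩
  refine ⟨⟨incl, retr, ?_, ?_⟩⟩
  · have h1 : retr.comp incl = ContinuousMap.id _ := by
      ext x
      exact fA (show _ ∈ A from x.2)
    rw [h1]
  · refine ContinuousMap.Homotopic.symm ⟨⟨⟨fun q => ⟨f q, hfK q⟩, by fun_prop⟩, ?_, ?_⟩⟩
    · intro x
      exact Subtype.ext (hf0 x)
    · intro x
      rfl

end Exterior

/-- To identify the groups of a knot and of its exteriors it is enough to do so for the complement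
of one representative. -/
theorem nonempty_fundamentalGroup_mulEquiv_of_ambientIsotopic {X : Type} {G : Type*}
    [TopologicalSpace X] [T2Space X] [Group G] {K₀ K : Set X} (hK : AmbientIsotopic K₀ K)
    (h : ∀ x : ↥(K₀ᶜ), Nonempty (FundamentalGroup ↥(K₀ᶜ) x ≃* G)) :
    (∀ x : ↥(Kᶜ), Nonempty (FundamentalGroup ↥(Kᶜ) x ≃* G)) ∧
      ∀ φ : Circle × ℂ → X, IsTubularNeighbourhood φ K →
        ∀ x : ↥(exterior φ), Nonempty (FundamentalGroup ↥(exterior φ) x ≃* G) := by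
  obtain ⟨e⟩ := hK.nonempty_homeomorph_compl
  have h1 : ∀ x : ↥(Kᶜ), Nonempty (FundamentalGroup ↥(Kᶜ) x ≃* G) :=
    nonempty_fundamentalGroup_mulEquiv_of_homotopyEquiv e.toHomotopyEquiv h
  refine ⟨h1, fun φ hφ => ?_⟩
  obtain ⟨e'⟩ := isTubularNeighbourhood_homotopyEquiv hφ
  exact nonempty_fundamentalGroup_mulEquiv_of_homotopyEquiv e' h1

end TwoBridge

namespace TwoBridge

open Topology Filter Set

/-! ### Locally constant functions glued across a hypersurface -/

/-- A function which is constant near each point of a preconnected set is constant on it. -/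
theorem eq_of_isPreconnected {E α : Type*} [TopologicalSpace E] {S : Set E}
    (hS : IsPreconnected S) {f : E → α} (hf : ∀ p ∈ S, ∀ᶠ q in 𝓝 p, f q = f p) {p q : E}
    (hp : p ∈ S) (hq : q ∈ S) : f p = f q := by
  let _ : TopologicalSpace α := ⊥
  have : DiscreteTopology α := ⟨rfl⟩
  refine hS.constant (f := f) (fun x hx => ContinuousAt.continuousWithinAt ?_) hp hq
  exact (continuousAt_const (y := f x)).congr ((hf x hx).mono fun y hy => hy.symm)

/-- This builds the transition functions from a chart `V` to the upper set `Ap` and the lower set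
`Am` out of a function `κ` that prescribes the first above the wall `z = 0` and the second below it.
As the two must differ by `F`, the only obstruction is the jump of `κ` across the wall, which has to
be `F`. -/
theorem exists_glue {E G : Type*} [TopologicalSpace E] [Group G] {V Ap Am : Set E} {z : E → ℝ}
    {F κ : E → G} (hV : IsOpen V) (hAp : IsOpen Ap) (hAm : IsOpen Am) (hz : Continuous z)
    (hfreq : ∀ p, z p = 0 → ∃ᶠ q in 𝓝 p, 0 < z q)
    (hκ : ∀ p ∈ V ∩ (Ap ∪ Am), z p ≠ 0 → ∀ᶠ q in 𝓝 p, κ q = κ p)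
    (hup : ∀ p ∈ V ∩ Am, 0 ≤ z p → p ∈ Ap) (hdn : ∀ p ∈ V ∩ Ap, z p ≤ 0 → p ∈ Am)
    (hF : ∀ p ∈ Ap ∩ Am, ∀ᶠ q in 𝓝 p, F q = F p)
    (hjump : ∀ p ∈ V ∩ (Ap ∩ Am), z p = 0 →
      ∃ g, ∀ᶠ q in 𝓝 p, (0 < z q → κ q = g) ∧ (z q < 0 → κ q = g * F p)) :
    ∃ cp cm : E → G, (∀ p ∈ V ∩ Ap, ∀ᶠ q in 𝓝 p, cp q = cp p) ∧
      (∀ p ∈ V ∩ Am, ∀ᶠ q in 𝓝 p, cm q = cm p) ∧ (∀ p, cp p * F p = cm p) ∧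
      (∀ p, 0 < z p → cp p = κ p) ∧ ∀ p, z p < 0 → cm p = κ p := by
  classical
  have hch : ∀ p, ∃ g, p ∈ V ∩ (Ap ∩ Am) → z p = 0 →
      ∀ᶠ q in 𝓝 p, (0 < z q → κ q = g) ∧ (z q < 0 → κ q = g * F p) := by
    intro p
    by_cases h : p ∈ V ∩ (Ap ∩ Am) ∧ z p = 0
    · obtain ⟨g, hg⟩ := hjump p h.1 h.2
      exact ⟨g, fun _ _ => hg⟩
    · exact ⟨1, fun h1 h2 => absurd ⟨h1, h2⟩ h⟩
  choose g hg using hch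
  let cp : E → G := fun p => if 0 < z p then κ p else if z p < 0 then κ p * (F p)⁻¹ else g p
  have cp_pos : ∀ p, 0 < z p → cp p = κ p := fun p hp => if_pos hp
  have cp_neg : ∀ p, z p < 0 → cp p = κ p * (F p)⁻¹ := fun p hp => by
    simp only [cp, if_neg (not_lt.2 hp.le), if_pos hp]
  have cp_zero : ∀ p, z p = 0 → cp p = g p := fun p hp => by simp [cp, hp]
  have posEv : ∀ p, 0 < z p → ∀ᶠ q in 𝓝 p, 0 < z q := fun p hp =>
    hz.continuousAt.eventually_const_lt hp
  have negEv : ∀ p, z p < 0 → ∀ᶠ q in 𝓝 p, z q < 0 := fun p hp =>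
    hz.continuousAt.eventually_lt_const hp
  have hcp0 : ∀ p ∈ V ∩ (Ap ∩ Am), z p = 0 → ∀ᶠ q in 𝓝 p, cp q = cp p := by
    intro p hp h0
    rw [cp_zero p h0]
    have hopen : V ∩ (Ap ∩ Am) ∈ 𝓝 p := (hV.inter (hAp.inter hAm)).mem_nhds hp
    filter_upwards [(hg p hp h0).eventually_nhds, hF p hp.2, hopen] with q hq hFq hqV
    rcases lt_trichotomy (z q) 0 with h | h | h
    · rw [cp_neg q h, hq.self_of_nhds.2 h, hFq, mul_inv_cancel_right]
    · rw [cp_zero q h]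
      -- The wall point `q` is a limit of points above the wall, where `κ` equals both `g p` and `g
      -- q`.
      obtain ⟨y, ⟨hy1, hy2⟩, hy⟩ := ((hfreq q h).and_eventually
        (hq.and (hg q hqV h))).exists.imp fun y hy => And.intro hy.2 hy.1
      rw [← hy2.1 hy, hy1.1 hy]
    · rw [cp_pos q h, hq.self_of_nhds.1 h]
  refine ⟨cp, fun p => cp p * F p, ?_, ?_, fun p => rfl, cp_pos, fun p hp => ?_⟩
  · intro p hp
    rcases lt_trichotomy (z p) 0 with h | h | h
    · have hm := hdn p hp h.le
      filter_upwards [hκ p ⟨hp.1, Or.inl hp.2⟩ h.ne, hF p ⟨hp.2, hm⟩, negEv p h] with q h1 h2 h3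
      rw [cp_neg p h, cp_neg q h3, h1, h2]
    · exact hcp0 p ⟨hp.1, hp.2, hdn p hp h.le⟩ h
    · filter_upwards [hκ p ⟨hp.1, Or.inl hp.2⟩ h.ne', posEv p h] with q h1 h2
      rw [cp_pos p h, cp_pos q h2, h1]
  · intro p hp
    rcases lt_trichotomy (z p) 0 with h | h | h
    · filter_upwards [hκ p ⟨hp.1, Or.inr hp.2⟩ h.ne, negEv p h] with q h1 h2
      simp only [cp_neg p h, cp_neg q h2, h1, inv_mul_cancel_right]
    · have hpp := hup p hp h.ge
      filter_upwards [hcp0 p ⟨hp.1, hpp, hp.2⟩ h, hF p ⟨hpp, hp.2⟩] with q h1 h2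
      rw [h1, h2]
    · have hpp := hup p hp h.le
      filter_upwards [hκ p ⟨hp.1, Or.inr hp.2⟩ h.ne', hF p ⟨hpp, hp.2⟩, posEv p h] with q h1 h2 h3
      rw [cp_pos p h, cp_pos q h3, h1, h2]
  · simp only [cp_neg p hp, inv_mul_cancel_right]

/-! ### The model twist region -/

open Real

/-- Euclidean three-space. -/
abbrev R3 : Type := ℝ × ℝ × ℝ

/-- The angle by which the two strands have turned at the height `u`. -/
noncomputable def twistAngle (a : ℤ) (u : ℝ) : ℝ := a * π * max 0 (min 1 ((u + 1) / 2))

/-- The first cross-sectional coordinate after untwisting. -/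
noncomputable def untwistY (a : ℤ) (p : R3) : ℝ :=
  p.2.1 * cos (twistAngle a p.1) + p.2.2 * sin (twistAngle a p.1)

/-- The second cross-sectional coordinate after untwisting. -/
noncomputable def untwistZ (a : ℤ) (p : R3) : ℝ :=
  -p.2.1 * sin (twistAngle a p.1) + p.2.2 * cos (twistAngle a p.1)

/-- A fat cylinder from which the part of the ruled surface through the two strands outside the
cylinder of radius one is removed. -/
def twistBox (a : ℤ) : Set R3 :=
  {p | |p.1| < 2 ∧ p.2.1 ^ 2 + p.2.2 ^ 2 < 4 ∧ (1 ≤ p.2.1 ^ 2 + p.2.2 ^ 2 → untwistZ a p ≠ 0)}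

/-- The closed cylinder whose boundary carries the two strands. -/
def twistCore : Set R3 := {p | |p.1| ≤ 1 ∧ p.2.1 ^ 2 + p.2.2 ^ 2 ≤ 1}

@[fun_prop] theorem continuous_twistAngle (a : ℤ) : Continuous (twistAngle a) := by
  unfold twistAngle; fun_prop

@[fun_prop] theorem continuous_untwistY (a : ℤ) : Continuous (untwistY a) := by
  unfold untwistY; fun_prop

@[fun_prop] theorem continuous_untwistZ (a : ℤ) : Continuous (untwistZ a) := by
  unfold untwistZ; fun_prop

theorem twistAngle_of_le {a : ℤ} {u : ℝ} (hu : u ≤ -1) : twistAngle a u = 0 := by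
  rw [twistAngle, max_eq_left (min_le_of_right_le (by linarith)), mul_zero]

theorem twistAngle_of_ge {a : ℤ} {u : ℝ} (hu : 1 ≤ u) : twistAngle a u = a * π := by
  rw [twistAngle, min_eq_left (by linarith), max_eq_right zero_le_one, mul_one]

theorem twistAngle_of_mem {a : ℤ} {u : ℝ} (hu : |u| ≤ 1) :
    twistAngle a u = a * π * ((u + 1) / 2) := by
  rw [abs_le] at hu
  rw [twistAngle, min_eq_right (by linarith), max_eq_right (by linarith)]

theorem untwist_of_le {a : ℤ} {p : R3} (hp : p.1 ≤ -1) :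
    untwistY a p = p.2.1 ∧ untwistZ a p = p.2.2 := by
  simp [untwistY, untwistZ, twistAngle_of_le hp]

theorem untwist_of_ge {a : ℤ} {p : R3} (hp : 1 ≤ p.1) :
    untwistZ a p = if Even a then p.2.2 else -p.2.2 := by
  rw [untwistZ, twistAngle_of_ge hp, sin_int_mul_pi, mul_zero, zero_add]
  split_ifs with h
  · rw [cos_int_mul_pi, h.neg_one_zpow, mul_one]
  · rw [cos_int_mul_pi, (Int.not_even_iff_odd.1 h).neg_one_zpow, mul_neg_one]

theorem untwist_sq (a : ℤ) (p : R3) :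
    untwistY a p ^ 2 + untwistZ a p ^ 2 = p.2.1 ^ 2 + p.2.2 ^ 2 := by
  unfold untwistY untwistZ
  linear_combination (p.2.1 ^ 2 + p.2.2 ^ 2) * sin_sq_add_cos_sq (twistAngle a p.1)

theorem isOpen_twistBox (a : ℤ) : IsOpen (twistBox a) := by
  have h1 : IsClosed ({p : R3 | 1 ≤ p.2.1 ^ 2 + p.2.2 ^ 2} ∩ {p : R3 | untwistZ a p = 0}) :=
    (isClosed_le (by fun_prop) (by fun_prop)).inter (isClosed_eq (by fun_prop) (by fun_prop))
  have h2 : twistBox a = {p : R3 | |p.1| < 2} ∩ ({p : R3 | p.2.1 ^ 2 + p.2.2 ^ 2 < 4} ∩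
      ({p : R3 | 1 ≤ p.2.1 ^ 2 + p.2.2 ^ 2} ∩ {p : R3 | untwistZ a p = 0})ᶜ) := by
    ext p
    simp [twistBox]
  rw [h2]
  exact (isOpen_lt (by fun_prop) (by fun_prop)).inter
    ((isOpen_lt (by fun_prop) (by fun_prop)).inter h1.isOpen_compl)

/-- The removed surface lies outside the core and is ruled by radial lines. Shrinking a point
radially to the axis therefore never meets it, and the axis then shrinks to its midpoint. -/
theorem isSimplyConnected_twistBox (a : ℤ) : IsSimplyConnected (twistBox a) := by
  have axis : ∀ u : ℝ, |u| < 2 → ((u, 0, 0) : R3) ∈ twistBox a := by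
    intro u hu
    refine ⟨hu, by norm_num, fun h => ?_⟩
    norm_num at h
  refine isSimplyConnected_of_segments (r := fun p => (p.1, 0, 0)) (by fun_prop)
    (c := (0, 0, 0)) (axis 0 (by norm_num)) ?_ ?_
  · rintro ⟨u, y, z⟩ ⟨h1, h2, h3⟩ _ ⟨α, β, hα, hβ, hαβ, rfl⟩
    have hu : α * u + β * u = u := by rw [← add_mul, hαβ, one_mul]
    simp only [Prod.smul_mk, smul_eq_mul, mul_zero, Prod.mk_add_mk, add_zero, hu]
    simp only at h1 h2 h3
    have hα1 : α ≤ 1 := by linarith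
    have hle : (α * y) ^ 2 + (α * z) ^ 2 ≤ y ^ 2 + z ^ 2 := by
      have : α ^ 2 ≤ 1 := by nlinarith
      nlinarith [sq_nonneg y, sq_nonneg z]
    refine ⟨h1, lt_of_le_of_lt hle h2, fun h => ?_⟩
    simp only at h
    have h4 := h3 (h.trans hle)
    have hα0 : α ≠ 0 := by
      rintro rfl
      norm_num at h
    have h5 : untwistZ a (u, α * y, α * z) = α * untwistZ a (u, y, z) := by
      simp only [untwistZ]; ring
    rw [h5]
    exact mul_ne_zero hα0 h4
  · rintro ⟨u, y, z⟩ ⟨h1, -, -⟩ _ ⟨α, β, hα, hβ, hαβ, rfl⟩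
    simp only [Prod.smul_mk, smul_eq_mul, mul_zero, Prod.mk_add_mk, add_zero]
    refine axis _ ?_
    rw [abs_mul, abs_of_nonneg hα]
    have : α ≤ 1 := by linarith
    have := abs_nonneg u
    simp only at h1
    nlinarith

/-- Away from the strands, a horizontal position in the fat cylinder outside the core is either
beside the core or in front of one of its two ends. -/
theorem twistBox_diff_core_cases {a : ℤ} {p : R3} (hp : p ∈ twistBox a) (hc : p ∉ twistCore)
    (hz : p.2.2 = 0) :
    (untwistZ a p ≠ 0 ∧ |p.1| < 1 ∧ 1 < |p.2.1| ∧ |p.2.1| < 2) ∨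
      (p.1 < -1 ∧ -2 < p.1 ∧ |p.2.1| < 1) ∨ (1 < p.1 ∧ p.1 < 2 ∧ |p.2.1| < 1) := by
  obtain ⟨h1, h2, h3⟩ := hp
  have hy2 : |p.2.1| < 2 := by
    rw [hz] at h2
    exact abs_lt_of_sq_lt_sq (by linarith) (by norm_num)
  have hend : ∀ (_ : 1 ≤ |p.1|), untwistZ a p = 0 := by
    intro h
    rcases le_abs.1 h with h | h
    · rw [untwist_of_ge h, hz]; simp
    · rw [(untwist_of_le (by linarith)).2, hz]
  have hsmall : ∀ (_ : 1 ≤ |p.1|), |p.2.1| < 1 := by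
    intro h
    by_contra h'
    refine h3 ?_ (hend h)
    have : 1 ≤ |p.2.1| := not_lt.1 h'
    nlinarith [sq_abs p.2.1, sq_nonneg p.2.2]
  rcases lt_or_ge (|p.1|) 1 with h | h
  · left
    have hr : 1 < p.2.1 ^ 2 + p.2.2 ^ 2 := not_le.1 fun h' => hc ⟨h.le, h'⟩
    refine ⟨h3 hr.le, h, ?_, hy2⟩
    rw [hz] at hr
    refine lt_of_pow_lt_pow_left₀ 2 (abs_nonneg _) ?_
    rw [sq_abs]; linarith
  · right
    have hne : |p.1| ≠ 1 := by
      intro h'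
      have := hsmall h
      refine hc ⟨h'.le, ?_⟩
      rw [hz]
      nlinarith [sq_abs p.2.1, abs_nonneg p.2.1]
    have hlt : 1 < |p.1| := lt_of_le_of_ne h (Ne.symm hne)
    rcases abs_lt.1 h1 with ⟨h5, h6⟩
    rcases lt_abs.1 hlt with h' | h'
    · exact Or.inr ⟨h', h6, hsmall h⟩
    · exact Or.inl ⟨by linarith, h5, hsmall h⟩

/-- Off the core, the box meets the ruled surface only beyond the two ends, where the untwisted
height is the true height up to sign. -/
theorem untwistZ_ne_zero {a : ℤ} {p : R3} (hp : p ∈ twistBox a) (hc : p ∉ twistCore)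
    (hz : p.2.2 ≠ 0) : untwistZ a p ≠ 0 := by
  intro h0
  have hr : p.2.1 ^ 2 + p.2.2 ^ 2 < 1 := not_le.1 fun h => hp.2.2 h h0
  have hu : 1 < |p.1| := not_le.1 fun h => hc ⟨h, hr.le⟩
  rcases lt_abs.1 hu with h | h
  · rw [untwist_of_ge h.le] at h0
    split_ifs at h0
    · exact hz h0
    · exact hz (neg_eq_zero.1 h0)
  · rw [(untwist_of_le (by linarith)).2] at h0
    exact hz h0

/-! ### Winding along the twist region -/

/-- The total angle of a point of the twist region. -/
noncomputable def windAngle (a : ℤ) (p : R3) : ℝ :=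
  Complex.arg ⟨untwistY a p, untwistZ a p⟩ + twistAngle a p.1

theorem polar_windAngle (a : ℤ) (p : R3) :
    p.2.1 = ‖(⟨untwistY a p, untwistZ a p⟩ : ℂ)‖ * cos (windAngle a p) ∧
      p.2.2 = ‖(⟨untwistY a p, untwistZ a p⟩ : ℂ)‖ * sin (windAngle a p) := by
  have h1 := Complex.norm_mul_cos_arg (⟨untwistY a p, untwistZ a p⟩ : ℂ)
  have h2 := Complex.norm_mul_sin_arg (⟨untwistY a p, untwistZ a p⟩ : ℂ)
  have h3 := sin_sq_add_cos_sq (twistAngle a p.1)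
  simp only at h1 h2
  rw [windAngle, cos_add, sin_add]
  constructor
  · rw [mul_sub, ← mul_assoc, ← mul_assoc, h1, h2, untwistY, untwistZ]
    linear_combination (-p.2.1) * h3
  · rw [mul_add, ← mul_assoc, ← mul_assoc, h1, h2, untwistY, untwistZ]
    linear_combination (-p.2.2) * h3

/-- The jump of `Complex.arg` is along a half-axis contained in `untwistZ = 0`, so the angle is
continuous on each of the two sectors. -/
theorem continuousAt_windAngle {a : ℤ} {p : R3} (hp : untwistZ a p ≠ 0) :
    ContinuousAt (windAngle a) p := by
  have h1 : ContinuousAt (fun q : R3 => (⟨untwistY a q, untwistZ a q⟩ : ℂ)) p := by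
    have : (fun q : R3 => (⟨untwistY a q, untwistZ a q⟩ : ℂ)) =
        fun q => (untwistY a q : ℂ) + (untwistZ a q : ℂ) * Complex.I := by
      ext q
      rw [Complex.mk_eq_add_mul_I]
    rw [this]
    exact Continuous.continuousAt (by fun_prop)
  have h2 : ContinuousAt Complex.arg (⟨untwistY a p, untwistZ a p⟩ : ℂ) :=
    Complex.continuousAt_arg (Or.inr hp)
  have h3 : ContinuousAt (fun q : R3 => Complex.arg (⟨untwistY a q, untwistZ a q⟩ : ℂ)) p :=
    ContinuousAt.comp (g := Complex.arg) h2 h1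
  exact h3.add (by fun_prop)

/-- The number of half-turns made by a point of the twist region. -/
noncomputable def halfTurns (a : ℤ) (p : R3) : ℤ := ⌊windAngle a p / π⌋

theorem eventually_floor_eq {x : ℝ} (hx : ∀ m : ℤ, x ≠ m) : ∀ᶠ y in 𝓝 x, ⌊y⌋ = ⌊x⌋ := by
  have h1 : (⌊x⌋ : ℝ) < x := lt_of_le_of_ne (Int.floor_le x) (hx _).symm
  filter_upwards [Ioo_mem_nhds h1 (Int.lt_floor_add_one x)] with y hy
  exact Int.floor_eq_iff.2 ⟨hy.1.le, hy.2⟩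

/-- The floor can jump only where the angle is a multiple of `π`, that is, in the plane of
projection. -/
theorem eventually_halfTurns_eq {a : ℤ} {p : R3} (hp : untwistZ a p ≠ 0) (hz : p.2.2 ≠ 0) :
    ∀ᶠ q in 𝓝 p, halfTurns a q = halfTurns a p := by
  refine ((continuousAt_windAngle hp).div_const π).eventually (eventually_floor_eq fun m hm => ?_)
  apply hz
  rw [(polar_windAngle a p).2, (div_eq_iff pi_ne_zero).1 hm, sin_int_mul_pi, mul_zero]

/-- The number of half-turns near a point of the horizontal plane. -/
theorem eventually_halfTurns_of_eq_zero {a : ℤ} {p : R3} (hp : untwistZ a p ≠ 0)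
    (hz : p.2.2 = 0) : ∃ m : ℤ, (0 < p.2.1 ↔ Even m) ∧ (p.2.1 < 0 ↔ ¬ Even m) ∧
      ∀ᶠ q in 𝓝 p, (0 < q.2.2 → halfTurns a q = if Even m then m else m - 1) ∧
        (q.2.2 < 0 → halfTurns a q = if Even m then m - 1 else m) := by
  have hpos : ∀ q : R3, untwistZ a q ≠ 0 → 0 < ‖(⟨untwistY a q, untwistZ a q⟩ : ℂ)‖ := by
    intro q hq
    rw [norm_pos_iff]
    intro h
    exact hq (congrArg Complex.im h)
  have h0 := hpos p hp
  obtain ⟨m, hm⟩ : ∃ m : ℤ, (m : ℝ) * π = windAngle a p := by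
    rw [← sin_eq_zero_iff]
    have := (polar_windAngle a p).2
    rw [hz] at this
    exact (mul_eq_zero.1 this.symm).resolve_left h0.ne'
  have hY := (polar_windAngle a p).1
  rw [← hm, cos_int_mul_pi] at hY
  refine ⟨m, ?_, ?_, ?_⟩
  · rcases Int.even_or_odd m with h | h
    · rw [h.neg_one_zpow, mul_one] at hY
      simp [h, hY, h0]
    · rw [h.neg_one_zpow, mul_neg_one] at hY
      simp [Int.not_even_iff_odd.2 h, hY, h0.le]
  · rcases Int.even_or_odd m with h | h
    · rw [h.neg_one_zpow, mul_one] at hY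
      simp [h, hY, h0.le]
    · rw [h.neg_one_zpow, mul_neg_one] at hY
      simp only [Int.not_even_iff_odd.2 h, hY]
      simpa using h0
  · have hc := continuousAt_windAngle hp
    have h1 : ∀ᶠ q in 𝓝 p, windAngle a q ∈ Ioo (m * π - π) (m * π + π) := by
      refine hc.eventually (Ioo_mem_nhds ?_ ?_) <;> linarith [pi_pos]
    have h2 : ∀ᶠ q in 𝓝 p, untwistZ a q ≠ 0 :=
      (continuous_untwistZ a).continuousAt.eventually_ne hp
    filter_upwards [h1, h2] with q hq hq'
    have hr := hpos q hq'
    have hZ := (polar_windAngle a q).2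
    -- After subtracting `m * π` the angle lies between `-π` and `π`, where it has the sign of its
    -- sine.
    have hsin : sin (windAngle a q) = (-1 : ℝ) ^ m * sin (windAngle a q - m * π) := by
      rw [sin_sub_int_mul_pi, ← mul_assoc, ← zpow_add₀ (by norm_num : (-1 : ℝ) ≠ 0),
        (Even.neg_one_zpow ⟨m, rfl⟩ : (-1 : ℝ) ^ (m + m) = 1), one_mul]
    have hup : 0 < sin (windAngle a q - m * π) → halfTurns a q = m := by
      intro hs
      have h3 : 0 < windAngle a q - m * π := by
        by_contra h
        exact absurd hs (not_lt.2 (sin_nonpos_of_nonpos_of_neg_pi_le (not_lt.1 h)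
          (by linarith [hq.1])))
      rw [halfTurns, Int.floor_eq_iff, le_div_iff₀ pi_pos, div_lt_iff₀ pi_pos]
      constructor <;> linarith [hq.2]
    have hdn : sin (windAngle a q - m * π) < 0 → halfTurns a q = m - 1 := by
      intro hs
      have h3 : windAngle a q - m * π < 0 := by
        by_contra h
        exact absurd hs (not_lt.2 (sin_nonneg_of_nonneg_of_le_pi (not_lt.1 h)
          (by linarith [hq.2])))
      rw [halfTurns, Int.floor_eq_iff, le_div_iff₀ pi_pos, div_lt_iff₀ pi_pos]
      push_cast
      constructor <;> linarith [hq.1]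
    have hzs : q.2.2 = (-1 : ℝ) ^ m *
        (‖(⟨untwistY a q, untwistZ a q⟩ : ℂ)‖ * sin (windAngle a q - m * π)) := by
      rw [hZ, hsin]; ring
    rcases Int.even_or_odd m with h | h
    · rw [h.neg_one_zpow, one_mul] at hzs
      simp only [h, if_true]
      rw [hzs]
      exact ⟨fun h' => hup (pos_of_mul_pos_right h' hr.le),
        fun h' => hdn (neg_of_mul_neg_right h' hr.le)⟩
    · rw [h.neg_one_zpow, neg_one_mul] at hzs
      simp only [Int.not_even_iff_odd.2 h, if_false]
      rw [hzs, Left.neg_pos_iff, Left.neg_neg_iff]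
      exact ⟨fun h' => hdn (neg_of_mul_neg_right h' hr.le),
        fun h' => hup (pos_of_mul_pos_right h' hr.le)⟩

theorem arg_mem_of_pos {y z : ℝ} (hz : 0 < z) : Complex.arg ⟨y, z⟩ ∈ Ioo 0 π := by
  have h1 : 0 ≤ Complex.arg ⟨y, z⟩ := Complex.arg_nonneg_iff.2 hz.le
  have h2 : Complex.arg ⟨y, z⟩ ≠ 0 := fun h => hz.ne' (Complex.arg_eq_zero_iff.1 h).2
  have h3 : Complex.arg ⟨y, z⟩ ≠ π := fun h => hz.ne' (Complex.arg_eq_pi_iff.1 h).2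
  exact ⟨lt_of_le_of_ne h1 h2.symm, lt_of_le_of_ne (Complex.arg_le_pi _) h3⟩

theorem arg_mem_of_neg {y z : ℝ} (hz : z < 0) : Complex.arg ⟨y, z⟩ ∈ Ioo (-π) 0 :=
  ⟨Complex.neg_pi_lt_arg _, Complex.arg_neg_iff.2 hz⟩

/-- When the twisting is a whole number of half-turns, the sectors are upper and lower half-planes,
and the argument lies in `(0, π)` or in `(-π, 0)`. -/
theorem halfTurns_of_twistAngle {a k : ℤ} {p : R3} (hk : twistAngle a p.1 = k * π) :
    (0 < untwistZ a p → halfTurns a p = k) ∧ (untwistZ a p < 0 → halfTurns a p = k - 1) := by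
  constructor
  · intro h
    have h1 := arg_mem_of_pos (y := untwistY a p) h
    rw [halfTurns, Int.floor_eq_iff, le_div_iff₀ pi_pos, div_lt_iff₀ pi_pos, windAngle, hk]
    constructor <;> linarith [h1.1, h1.2]
  · intro h
    have h1 := arg_mem_of_neg (y := untwistY a p) h
    rw [halfTurns, Int.floor_eq_iff, le_div_iff₀ pi_pos, div_lt_iff₀ pi_pos, windAngle, hk]
    push_cast
    constructor <;> linarith [h1.1, h1.2]

end TwoBridge

namespace TwoBridge

open Topology Filter Set Real

/-! ### The local system on a twist region -/

section Kappa

variable {G H : Type*} [Group G] [Group H]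

/-- The value after `m` half-turns around the core, if the two sides of the core have face
values `P` and `N`. -/
def turnValue (P N : G) (m : ℤ) : G := (N * P⁻¹) ^ (m / 2) * if Even m then 1 else N

theorem turnValue_even (P N : G) (k : ℤ) : turnValue P N (2 * k) = (N * P⁻¹) ^ k := by
  rw [turnValue, if_pos (even_two_mul k), mul_one, Int.mul_ediv_cancel_left _ two_ne_zero]

theorem turnValue_odd (P N : G) (k : ℤ) : turnValue P N (2 * k + 1) = (N * P⁻¹) ^ k * N := by
  rw [turnValue, if_neg (Int.not_even_iff_odd.2 (odd_two_mul_add_one k))]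
  congr 2
  omega

/-- The effect of crossing the plane downwards through the face `P`; `turnValue_of_odd` is its
counterpart for the face `N`. -/
theorem turnValue_sub_one_of_even (P N : G) {m : ℤ} (hm : Even m) :
    turnValue P N (m - 1) = turnValue P N m * P := by
  obtain ⟨k, rfl⟩ := even_iff_two_dvd.1 hm
  rw [turnValue_even, show 2 * k - 1 = 2 * (k - 1) + 1 by ring, turnValue_odd, zpow_sub_one]
  group

theorem turnValue_of_odd (P N : G) {m : ℤ} (hm : ¬ Even m) :
    turnValue P N m = turnValue P N (m - 1) * N := by
  obtain ⟨k, rfl⟩ := Int.not_even_iff_odd.1 hm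
  rw [turnValue_odd, show 2 * k + 1 - 1 = 2 * k by ring, turnValue_even]

theorem map_turnValue (f : G →* H) (P N : G) (m : ℤ) :
    f (turnValue P N m) = turnValue (f P) (f N) m := by
  unfold turnValue
  split_ifs <;> simp

/-- The transition value from the twist region to the upper (for positive height) or the
lower (for negative height) half-space; `P`, `N`, `L` are the values of the faces on the two sides
and on the left of the core. -/
noncomputable def boxValue (P N L : G) (a : ℤ) (p : R3) : G :=
  (if 0 < untwistZ a p then 1 else L * P⁻¹) * turnValue P N (halfTurns a p)

theorem map_boxValue (f : G →* H) (P N L : G) (a : ℤ) (p : R3) :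
    f (boxValue P N L a p) = boxValue (f P) (f N) (f L) a p := by
  unfold boxValue
  rw [map_mul, map_turnValue]
  split_ifs <;> simp

/-- The relation between the face values around a twist region. -/
def BoxRelation (P N L R : G) (a : ℤ) : Prop :=
  if Even a then turnValue P N a * R = L * P⁻¹ * turnValue P N (a - 1)
  else L * P⁻¹ * turnValue P N (a - 1) * R = turnValue P N a

theorem eventually_untwistZ_pos_iff {a : ℤ} {p : R3} (hp : untwistZ a p ≠ 0) :
    ∀ᶠ q in 𝓝 p, (0 < untwistZ a q ↔ 0 < untwistZ a p) := by
  have hc := (continuous_untwistZ a).continuousAt (x := p)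
  rcases lt_or_gt_of_ne hp with h | h
  · filter_upwards [hc.eventually_lt_const h] with q hq
    exact iff_of_false (not_lt.2 hq.le) (not_lt.2 h.le)
  · filter_upwards [hc.eventually_const_lt h] with q hq
    exact iff_of_true hq h

theorem eventually_boxValue_eq (P N L : G) {a : ℤ} {p : R3} (hp : untwistZ a p ≠ 0)
    (hz : p.2.2 ≠ 0) : ∀ᶠ q in 𝓝 p, boxValue P N L a q = boxValue P N L a p := by
  filter_upwards [eventually_untwistZ_pos_iff hp, eventually_halfTurns_eq hp hz] with q h1 h2
  simp only [boxValue, h1, h2]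

/-- Beside the core the sector does not change, only the number of half-turns. Even multiples of `π`
lie on the side of `P` and odd ones on the side of `N`, and one step of `turnValue` is the required
jump. -/
theorem boxValue_jump_side (P N L : G) {a : ℤ} {p : R3} (hp : untwistZ a p ≠ 0)
    (hz : p.2.2 = 0) : ∃ g, ∀ᶠ q in 𝓝 p, (0 < q.2.2 → boxValue P N L a q = g) ∧
      (q.2.2 < 0 → boxValue P N L a q = g * if 0 < p.2.1 then P else N) := by
  obtain ⟨m, hm1, hm2, hm⟩ := eventually_halfTurns_of_eq_zero hp hz
  refine ⟨(if 0 < untwistZ a p then 1 else L * P⁻¹) * turnValue P N (if Even m then m else m - 1),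
    ?_⟩
  filter_upwards [eventually_untwistZ_pos_iff hp, hm] with q h1 h2
  simp only [boxValue, h1]
  refine ⟨fun h => by rw [h2.1 h], fun h => ?_⟩
  rw [h2.2 h, mul_assoc]
  congr 1
  by_cases he : Even m
  · simp only [he, hm1.2 he, if_true]
    exact turnValue_sub_one_of_even P N he
  · simp only [he, not_lt.2 (hm2.2 he).le, if_false]
    exact turnValue_of_odd P N he

/-- This explains the factor `L * P⁻¹`: on the left the lower sector has turned `-1` times, where
`turnValue` is `P`, and the jump across the left face becomes `L`. -/
theorem boxValue_left (P N L : G) {a : ℤ} {p : R3} (hp : p.1 ≤ -1) :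
    (0 < p.2.2 → boxValue P N L a p = 1) ∧ (p.2.2 < 0 → boxValue P N L a p = L) := by
  have h1 := halfTurns_of_twistAngle (a := a) (k := 0) (p := p) (by
    rw [twistAngle_of_le hp]; simp)
  have h2 := (untwist_of_le (a := a) hp).2
  rw [h2] at h1
  constructor
  · intro h
    rw [boxValue, h1.1 h, h2, if_pos h]
    simp [turnValue]
  · intro h
    rw [boxValue, h1.2 h, h2, if_neg (not_lt.2 h.le), turnValue_sub_one_of_even P N Even.zero]
    simp [turnValue]

/-- At the right end the sectors have made `a` half-turns and have exchanged sides if `a` is odd. No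
freedom is left here: the jump across the right face is `R` precisely when `BoxRelation` holds. -/
theorem boxValue_right (P N L : G) {a : ℤ} {p : R3} (hp : 1 ≤ p.1) :
    (0 < p.2.2 → boxValue P N L a p =
      if Even a then turnValue P N a else L * P⁻¹ * turnValue P N (a - 1)) ∧
    (p.2.2 < 0 → boxValue P N L a p =
      if Even a then L * P⁻¹ * turnValue P N (a - 1) else turnValue P N a) := by
  have h1 := halfTurns_of_twistAngle (a := a) (k := a) (p := p) (twistAngle_of_ge hp)
  have h2 := untwist_of_ge (a := a) hp
  by_cases ha : Even a
  · simp only [ha, if_true] at h2 ⊢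
    rw [h2] at h1
    constructor
    · intro h
      rw [boxValue, h1.1 h, h2, if_pos h, one_mul]
    · intro h
      rw [boxValue, h1.2 h, h2, if_neg (not_lt.2 h.le)]
  · simp only [ha, if_false] at h2 ⊢
    rw [h2] at h1
    constructor
    · intro h
      rw [boxValue, h1.2 (by linarith), h2, if_neg (by linarith)]
    · intro h
      rw [boxValue, h1.1 (by linarith), h2, if_pos (by linarith), one_mul]

end Kappa

/-! ### The shell around the core -/

/-- Cylindrical coordinates adapted to the twisting. -/
noncomputable def twistPolar (a : ℤ) (q : (ℝ × ℝ) × ℝ) : R3 :=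
  (q.1.1, q.1.2 * cos (q.2 + twistAngle a q.1.1), q.1.2 * sin (q.2 + twistAngle a q.1.1))

@[fun_prop] theorem continuous_twistPolar (a : ℤ) : Continuous (twistPolar a) := by
  unfold twistPolar; fun_prop

theorem twistPolar_sq (a : ℤ) (q : (ℝ × ℝ) × ℝ) :
    (twistPolar a q).2.1 ^ 2 + (twistPolar a q).2.2 ^ 2 = q.1.2 ^ 2 := by
  simp only [twistPolar]
  linear_combination q.1.2 ^ 2 * sin_sq_add_cos_sq (q.2 + twistAngle a q.1.1)

theorem untwistZ_twistPolar (a : ℤ) (q : (ℝ × ℝ) × ℝ) :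
    untwistZ a (twistPolar a q) = q.1.2 * sin q.2 := by
  have h := sin_sub (q.2 + twistAngle a q.1.1) (twistAngle a q.1.1)
  rw [add_sub_cancel_right] at h
  simp only [twistPolar, untwistZ]
  rw [h]
  ring

theorem exists_twistPolar (a : ℤ) (p : R3) :
    p = twistPolar a ((p.1, ‖(⟨untwistY a p, untwistZ a p⟩ : ℂ)‖),
      Complex.arg ⟨untwistY a p, untwistZ a p⟩) := by
  obtain ⟨h1, h2⟩ := polar_windAngle a p
  rw [windAngle] at h1 h2
  exact Prod.ext rfl (Prod.ext h1 h2)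

theorem norm_untwist_sq (a : ℤ) (p : R3) :
    ‖(⟨untwistY a p, untwistZ a p⟩ : ℂ)‖ ^ 2 = p.2.1 ^ 2 + p.2.2 ^ 2 := by
  rw [← untwist_sq a p, Complex.sq_norm, Complex.normSq_mk]
  ring

/-- The fat cylinder without the core and without the horizontal slit on its right. -/
def slitShell (a : ℤ) : Set R3 := (twistBox a \ twistCore) \ {p | p.2.2 = 0 ∧ 1 ≤ p.1}

/-- The part of the parameter domain of the shell with given bounds for the angle. -/
def shellDomain : Set (ℝ × ℝ) :=
  {q | |q.1| < 2 ∧ 0 < q.2 ∧ q.2 < 2 ∧ (|q.1| ≤ 1 → 1 < q.2)}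

theorem isPreconnected_shellDomain : IsPreconnected shellDomain := by
  have h0 : IsPreconnected (Ioo (-2 : ℝ) 2 ×ˢ Ioo (1 : ℝ) 2) :=
    isPreconnected_Ioo.prod isPreconnected_Ioo
  have h1 : IsPreconnected (Ioo (-2 : ℝ) (-1) ×ˢ Ioo (0 : ℝ) 2) :=
    isPreconnected_Ioo.prod isPreconnected_Ioo
  have h2 : IsPreconnected (Ioo (1 : ℝ) 2 ×ˢ Ioo (0 : ℝ) 2) :=
    isPreconnected_Ioo.prod isPreconnected_Ioo
  have h3 := (h0.union ((-3 / 2 : ℝ), (3 / 2 : ℝ)) (by norm_num) (by norm_num) h1).union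
    ((3 / 2 : ℝ), (3 / 2 : ℝ)) (by norm_num) (by norm_num) h2
  convert h3 using 1
  ext ⟨u, r⟩
  simp only [shellDomain, mem_union, mem_prod, mem_Ioo, mem_ofPred_eq, abs_lt, abs_le]
  constructor
  · rintro ⟨⟨h1, h2⟩, h3, h4, h5⟩
    by_cases hu : u < -1
    · exact Or.inl (Or.inr ⟨⟨h1, hu⟩, h3, h4⟩)
    by_cases hu' : 1 < u
    · exact Or.inr ⟨⟨hu', h2⟩, h3, h4⟩
    · exact Or.inl (Or.inl ⟨⟨h1, h2⟩, h5 ⟨by linarith, by linarith⟩, h4⟩)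
  · rintro ((⟨⟨h1, h2⟩, h3, h4⟩ | ⟨⟨h1, h2⟩, h3, h4⟩) | ⟨⟨h1, h2⟩, h3, h4⟩)
    · exact ⟨⟨h1, h2⟩, by linarith, h4, fun _ => h3⟩
    · exact ⟨⟨h1, by linarith⟩, h3, h4, fun h => by linarith [h.1]⟩
    · exact ⟨⟨by linarith, h2⟩, h3, h4, fun h => by linarith [h.2]⟩

/-- The two sectors are connected images of polar coordinates and are joined through the disc beyond
the left end. The slit closes the passage on the right, which would otherwise allow a circuit with
nontrivial holonomy. -/
theorem isPreconnected_slitShell (a : ℤ) : IsPreconnected (slitShell a) := by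
  have hpart : ∀ α β : ℝ, IsPreconnected (twistPolar a '' (shellDomain ×ˢ Ioo α β)) := fun α β =>
    (isPreconnected_shellDomain.prod isPreconnected_Ioo).image _
      (continuous_twistPolar a).continuousOn
  let left : Set R3 := {p | p.1 ∈ Ioo (-2 : ℝ) (-1) ∧ p.2.1 ^ 2 + p.2.2 ^ 2 < 1}
  have hleft : IsPreconnected left := by
    have h1 : IsPreconnected ((fun q : (ℝ × ℝ) × ℝ =>
        ((q.1.1, q.1.2 * cos q.2, q.1.2 * sin q.2) : R3)) ''
          ((Ioo (-2 : ℝ) (-1) ×ˢ Ico (0 : ℝ) 1) ×ˢ univ)) :=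
      ((isPreconnected_Ioo.prod isPreconnected_Ico).prod isPreconnected_univ).image _
        (by fun_prop)
    convert h1 using 1
    ext ⟨u, y, z⟩
    simp only [left, mem_ofPred_eq, mem_image, mem_prod, Prod.exists, mem_univ, and_true,
      Prod.mk.injEq, mem_Ico]
    constructor
    · rintro ⟨hu, hr⟩
      -- With zero twists the adapted coordinates are ordinary cylindrical ones.
      have h2 := norm_untwist_sq 0 ((u, y, z) : R3)
      have h3 := exists_twistPolar 0 ((u, y, z) : R3)
      simp only [twistPolar, twistAngle, Int.cast_zero, zero_mul, add_zero, Prod.mk.injEq] at h3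
      refine ⟨u, _, _, ⟨hu, norm_nonneg _, ?_⟩, rfl, h3.2.1.symm, h3.2.2.symm⟩
      simp only at h2
      nlinarith [norm_nonneg (⟨untwistY 0 (u, y, z), untwistZ 0 (u, y, z)⟩ : ℂ)]
    · rintro ⟨u', r, φ, ⟨hu, hr0, hr1⟩, rfl, rfl, rfl⟩
      refine ⟨hu, ?_⟩
      have : (r * cos φ) ^ 2 + (r * sin φ) ^ 2 = r ^ 2 := by
        linear_combination r ^ 2 * sin_sq_add_cos_sq φ
      rw [this]
      nlinarith
  have key : slitShell a = (twistPolar a '' (shellDomain ×ˢ Ioo 0 π) ∪ left) ∪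
      twistPolar a '' (shellDomain ×ˢ Ioo (-π) 0) := by
    have hsub : ∀ α β : ℝ, (∀ φ ∈ Ioo α β, sin φ ≠ 0) →
        twistPolar a '' (shellDomain ×ˢ Ioo α β) ⊆ slitShell a := by
      rintro α β hs _ ⟨⟨⟨u, r⟩, φ⟩, ⟨⟨h1, h2, h3, h4⟩, hφ⟩, rfl⟩
      simp only at h1 h2 h3 h4 hφ
      have hr := twistPolar_sq a ((u, r), φ)
      have hZ := untwistZ_twistPolar a ((u, r), φ)
      simp only at hr hZ
      have hZ0 : untwistZ a (twistPolar a ((u, r), φ)) ≠ 0 := by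
        rw [hZ]; exact mul_ne_zero h2.ne' (hs φ hφ)
      refine ⟨⟨⟨h1, ?_, fun _ => hZ0⟩, ?_⟩, ?_⟩
      · rw [hr]; nlinarith
      · rintro ⟨h5, h6⟩
        have := h4 h5
        rw [hr] at h6
        nlinarith
      · rintro ⟨h5, h6⟩
        apply hZ0
        rw [untwist_of_ge h6, h5]
        simp
    apply Subset.antisymm
    · rintro p ⟨⟨⟨h1, h2, h3⟩, h4⟩, h5⟩
      have hr := norm_untwist_sq a p
      by_cases h0 : untwistZ a p = 0
      · have hr1 : p.2.1 ^ 2 + p.2.2 ^ 2 < 1 := not_le.1 fun h => h3 h h0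
        have hu : 1 < |p.1| := not_le.1 fun h => h4 ⟨h, hr1.le⟩
        rcases lt_abs.1 hu with h | h
        · exfalso
          refine h5 ⟨?_, h.le⟩
          rw [untwist_of_ge h.le] at h0
          split_ifs at h0
          · exact h0
          · exact neg_eq_zero.1 h0
        · exact Or.inl (Or.inr ⟨⟨(abs_lt.1 h1).1, by linarith⟩, hr1⟩)
      · set ρ := ‖(⟨untwistY a p, untwistZ a p⟩ : ℂ)‖ with hρ
        have hρ0 : 0 < ρ := by
          rw [hρ, norm_pos_iff]
          intro h
          exact h0 (congrArg Complex.im h)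
        have hD : ((p.1, ρ) : ℝ × ℝ) ∈ shellDomain := by
          refine ⟨h1, hρ0, by nlinarith, fun h => ?_⟩
          have : 1 < p.2.1 ^ 2 + p.2.2 ^ 2 := not_le.1 fun h' => h4 ⟨h, h'⟩
          simp only
          nlinarith
        rcases lt_or_gt_of_ne h0 with h | h
        · exact Or.inr ⟨_, ⟨hD, arg_mem_of_neg h⟩, (exists_twistPolar a p).symm⟩
        · exact Or.inl (Or.inl ⟨_, ⟨hD, arg_mem_of_pos h⟩, (exists_twistPolar a p).symm⟩)
    · refine union_subset (union_subset (hsub _ _ fun φ h => (sin_pos_of_mem_Ioo h).ne') ?_)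
        (hsub _ _ fun φ h => (sin_neg_of_neg_of_neg_pi_lt h.2 h.1).ne)
      rintro p ⟨⟨h1, h2⟩, h3⟩
      refine ⟨⟨⟨abs_lt.2 ⟨h1, by linarith⟩, by linarith, fun h => by linarith⟩, ?_⟩, ?_⟩
      · rintro ⟨h4, -⟩
        linarith [(abs_le.1 h4).1]
      · rintro ⟨-, h4⟩
        linarith
  have hpt : ∀ φ : ℝ, twistPolar a ((-3 / 2, 1 / 2), φ) ∈ left := by
    intro φ
    refine ⟨by constructor <;> norm_num [twistPolar], ?_⟩
    rw [twistPolar_sq]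
    norm_num
  have hdom : ((-3 / 2, 1 / 2) : ℝ × ℝ) ∈ shellDomain := by
    refine ⟨by norm_num [abs_lt], by norm_num, by norm_num, fun h => ?_⟩
    norm_num [abs_le] at h
  rw [key]
  have hπ := pi_pos
  have hup : twistPolar a ((-3 / 2, 1 / 2), π / 2) ∈ twistPolar a '' (shellDomain ×ˢ Ioo 0 π) :=
    mem_image_of_mem _ ⟨hdom, by dsimp only; linarith, by dsimp only; linarith⟩
  have hdn : twistPolar a ((-3 / 2, 1 / 2), -(π / 2)) ∈
      twistPolar a '' (shellDomain ×ˢ Ioo (-π) 0) :=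
    mem_image_of_mem _ ⟨hdom, by dsimp only; linarith, by dsimp only; linarith⟩
  exact ((hpart 0 π).union _ hup (hpt _) hleft).union _ (Or.inr (hpt _)) hdn (hpart _ _)

theorem frequently_height_pos (p : R3) (hp : p.2.2 = 0) : ∃ᶠ q : R3 in 𝓝 p, 0 < q.2.2 := by
  have h1 : Tendsto (fun τ : ℝ => ((p.1, p.2.1, τ) : R3)) (𝓝 0) (𝓝 p) := by
    have h2 : Continuous fun τ : ℝ => ((p.1, p.2.1, τ) : R3) := by fun_prop
    have h3 := h2.tendsto 0
    rwa [show ((p.1, p.2.1, (0 : ℝ)) : R3) = p from Prod.ext rfl (Prod.ext rfl hp.symm)] at h3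
  exact h1.frequently (frequently_gt_nhds (0 : ℝ))

/-- Two open sets, lying above and below, that together cover a fat cylinder except for its core. -/
structure IsBoxFrame (a : ℤ) (Ap Am : Set R3) : Prop where
  isOpen_up : IsOpen Ap
  isOpen_down : IsOpen Am
  up_core : ∀ p ∈ Ap, p ∉ twistCore
  down_core : ∀ p ∈ Am, p ∉ twistCore
  up_mem : ∀ p ∈ twistBox a, p ∉ twistCore → 0 ≤ p.2.2 → p ∈ Ap
  down_mem : ∀ p ∈ twistBox a, p ∉ twistCore → p.2.2 ≤ 0 → p ∈ Am

/-- A locally constant function with values `P`, `N`, `L`, `R` on the four faces that meet at a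
twist region. -/
structure IsFaceFunction {G : Type*} (Ap Am : Set R3) (F : R3 → G) (P N L R : G) : Prop where
  eventually_eq : ∀ p ∈ Ap ∩ Am, ∀ᶠ q in 𝓝 p, F q = F p
  pos : ∀ p : R3, |p.1| < 1 → 1 < p.2.1 → p.2.1 < 2 → p.2.2 = 0 → F p = P
  neg : ∀ p : R3, |p.1| < 1 → p.2.1 < -1 → -2 < p.2.1 → p.2.2 = 0 → F p = N
  left : ∀ p : R3, p.1 < -1 → -2 < p.1 → |p.2.1| < 1 → p.2.2 = 0 → F p = L
  right : ∀ p : R3, 1 < p.1 → p.1 < 2 → |p.2.1| < 1 → p.2.2 = 0 → F p = R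

section Box

variable {G H : Type*} [Group G] [Group H] {a : ℤ} {Ap Am : Set R3}

/-- Gluing the transition values on an open part of the fat cylinder on which they are
consistent. -/
theorem IsBoxFrame.exists_glue (hA : IsBoxFrame a Ap Am) {F : R3 → G} {P N L R : G}
    (hF : IsFaceFunction Ap Am F P N L R) {V : Set R3} (hV : IsOpen V) (hVa : V ⊆ twistBox a)
    (hrel : ∀ p ∈ V, p.2.2 = 0 → 1 ≤ p.1 → BoxRelation P N L R a) :
    ∃ cp cm : R3 → G, (∀ p ∈ V ∩ Ap, ∀ᶠ q in 𝓝 p, cp q = cp p) ∧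
      (∀ p ∈ V ∩ Am, ∀ᶠ q in 𝓝 p, cm q = cm p) ∧ (∀ p, cp p * F p = cm p) ∧
      (∀ p : R3, 0 < p.2.2 → cp p = boxValue P N L a p) ∧
      ∀ p : R3, p.2.2 < 0 → cm p = boxValue P N L a p := by
  have hcore : ∀ p ∈ Ap ∪ Am, p ∉ twistCore := by
    rintro p (h | h)
    · exact hA.up_core p h
    · exact hA.down_core p h
  refine TwoBridge.exists_glue (z := fun p : R3 => p.2.2) hV hA.isOpen_up hA.isOpen_down
    (by fun_prop) frequently_height_pos ?_ ?_ ?_ hF.eventually_eq ?_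
  · intro p hp hz
    exact eventually_boxValue_eq P N L (untwistZ_ne_zero (hVa hp.1) (hcore p hp.2) hz) hz
  · intro p hp hz
    exact hA.up_mem p (hVa hp.1) (hA.down_core p hp.2) hz
  · intro p hp hz
    exact hA.down_mem p (hVa hp.1) (hA.up_core p hp.2) hz
  · intro p hp hz
    have hc := hA.up_core p hp.2.1
    rcases twistBox_diff_core_cases (hVa hp.1) hc hz with
      ⟨h0, h1, h2, h3⟩ | ⟨h1, h2, h3⟩ | ⟨h1, h2, h3⟩
    · obtain ⟨g, hg⟩ := boxValue_jump_side P N L h0 hz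
      refine ⟨g, ?_⟩
      rcases lt_abs.1 h2 with h | h
      · rw [hF.pos p h1 h (abs_lt.1 h3).2 hz]
        rwa [if_pos (by linarith)] at hg
      · rw [hF.neg p h1 (by linarith) (abs_lt.1 h3).1 hz]
        rwa [if_neg (by linarith)] at hg
    · refine ⟨1, ?_⟩
      have h4 : ∀ᶠ q : R3 in 𝓝 p, q.1 < -1 :=
        continuousAt_fst.eventually_lt_const h1
      filter_upwards [h4] with q hq
      rw [hF.left p h1 h2 h3 hz, one_mul]
      exact boxValue_left P N L hq.le
    -- Only this end imposes a condition on the face values.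
    · refine ⟨if Even a then turnValue P N a else L * P⁻¹ * turnValue P N (a - 1), ?_⟩
      have h4 : ∀ᶠ q : R3 in 𝓝 p, 1 < q.1 :=
        continuousAt_fst.eventually_const_lt h1
      filter_upwards [h4] with q hq
      rw [hF.right p h1 h2 h3 hz]
      have h5 := boxValue_right P N L (a := a) hq.le
      refine ⟨h5.1, fun h => (h5.2 h).trans ?_⟩
      have h6 := hrel p hp.1 hz h1.le
      unfold BoxRelation at h6
      split_ifs at h6 ⊢
      · exact h6.symm
      · exact h6.symm

/-- A locally constant cocycle near a twist region forces the relation between the face values, and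
is equal to the standard one up to a constant. -/
theorem IsBoxFrame.exists_eq_mul_boxValue (hA : IsBoxFrame a Ap Am) {F : R3 → H} {P N L R : H}
    (hF : IsFaceFunction Ap Am F P N L R) {dp dm : R3 → H}
    (hdp : ∀ p ∈ twistBox a ∩ Ap, ∀ᶠ q in 𝓝 p, dp q = dp p)
    (hdm : ∀ p ∈ twistBox a ∩ Am, ∀ᶠ q in 𝓝 p, dm q = dm p)
    (hd : ∀ p ∈ twistBox a, p ∈ Ap → p ∈ Am → dp p * F p = dm p) :
    BoxRelation P N L R a ∧ ∃ h : H,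
      (∀ p ∈ twistBox a ∩ Ap, 0 < p.2.2 → dp p = h * boxValue P N L a p) ∧
      ∀ p ∈ twistBox a ∩ Am, p.2.2 < 0 → dm p = h * boxValue P N L a p := by
  classical
  -- On the slit box the standard cocycle exists without any relation, so it can serve to test an
  -- arbitrary cocycle.
  let V : Set R3 := twistBox a \ ({p | p.2.2 = 0} ∩ {p | 1 ≤ p.1})
  have hV : IsOpen V := (isOpen_twistBox a).sdiff
    ((isClosed_eq (by fun_prop) (by fun_prop)).inter (isClosed_le (by fun_prop) (by fun_prop)))
  obtain ⟨cp, cm, hcp, hcm, hcF, hcp', hcm'⟩ := hA.exists_glue hF hV sdiff_subset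
    (fun p hp h1 h2 => absurd ⟨h1, h2⟩ hp.2)
  -- The quotient of the two cocycles. Both change by the same right factor `F`, so it is well
  -- defined and locally constant, hence constant on the connected shell.
  let e : R3 → H := fun p => if p ∈ Ap then dp p * (cp p)⁻¹ else dm p * (cm p)⁻¹
  have e_up : ∀ p ∈ Ap, e p = dp p * (cp p)⁻¹ := fun p hp => if_pos hp
  have e_down : ∀ p ∈ twistBox a, p ∈ Am → e p = dm p * (cm p)⁻¹ := by
    intro p hp hm
    by_cases h : p ∈ Ap
    · rw [e_up p h, ← hd p hp h hm, ← hcF p]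
      group
    · exact if_neg h
  have hcover : ∀ p ∈ slitShell a, p ∈ Ap ∨ p ∈ Am := by
    intro p hp
    rcases le_total 0 p.2.2 with h | h
    · exact Or.inl (hA.up_mem p hp.1.1 hp.1.2 h)
    · exact Or.inr (hA.down_mem p hp.1.1 hp.1.2 h)
  have hSV : ∀ p ∈ slitShell a, p ∈ V := fun p hp => ⟨hp.1.1, hp.2⟩
  have he : ∀ p ∈ slitShell a, ∀ᶠ q in 𝓝 p, e q = e p := by
    intro p hp
    rcases hcover p hp with h | h
    · filter_upwards [hdp p ⟨hp.1.1, h⟩, hcp p ⟨hSV p hp, h⟩, hA.isOpen_up.mem_nhds h]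
        with q h1 h2 h3
      rw [e_up p h, e_up q h3, h1, h2]
    · filter_upwards [hdm p ⟨hp.1.1, h⟩, hcm p ⟨hSV p hp, h⟩, hA.isOpen_down.mem_nhds h,
        (isOpen_twistBox a).mem_nhds hp.1.1] with q h1 h2 h3 h4
      rw [e_down p hp.1.1 h, e_down q h4 h3, h1, h2]
  have hshell : ∀ p ∈ twistBox a, p ∉ twistCore → p.2.2 ≠ 0 → p ∈ slitShell a :=
    fun p h1 h2 h3 => ⟨⟨h1, h2⟩, fun h => h3 h.1⟩
  have hp₀ : ∀ τ : ℝ, |τ| < 1 → ((3 / 2, 0, τ) : R3) ∈ twistBox a := by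
    intro τ hτ
    have : τ ^ 2 < 1 := by rw [← sq_abs]; nlinarith [abs_nonneg τ]
    refine ⟨by norm_num [abs_lt], by norm_num; linarith, fun h => ?_⟩
    norm_num at h
    rw [sq_abs τ |>.symm] at this
    linarith
  have hp₀' : ∀ τ : ℝ, ((3 / 2, 0, τ) : R3) ∉ twistCore := by
    rintro τ ⟨h, -⟩
    norm_num [abs_le] at h
  have hstart := hshell _ (hp₀ (1 / 2) (by norm_num [abs_lt])) (hp₀' _) (by norm_num)
  have hconst : ∀ p ∈ slitShell a, e p = e (3 / 2, 0, 1 / 2) := fun p hp =>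
    eq_of_isPreconnected (isPreconnected_slitShell a) he hp hstart
  have hup : ∀ p ∈ twistBox a ∩ Ap, 0 < p.2.2 →
      dp p = e (3 / 2, 0, 1 / 2) * boxValue P N L a p := by
    intro p hp hz
    rw [← hconst p (hshell p hp.1 (hA.up_core p hp.2) hz.ne'), e_up p hp.2, hcp' p hz,
      inv_mul_cancel_right]
  have hdown : ∀ p ∈ twistBox a ∩ Am, p.2.2 < 0 →
      dm p = e (3 / 2, 0, 1 / 2) * boxValue P N L a p := by
    intro p hp hz
    rw [← hconst p (hshell p hp.1 (hA.down_core p hp.2) hz.ne), e_down p hp.1 hp.2, hcm' p hz,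
      inv_mul_cancel_right]
  refine ⟨?_, _, hup, hdown⟩
  -- compare the two sides of the slit
  let p₀ : R3 := (3 / 2, 0, 0)
  have hb₀ : p₀ ∈ twistBox a := hp₀ 0 (by norm_num)
  have hu₀ : p₀ ∈ Ap := hA.up_mem _ hb₀ (hp₀' 0) le_rfl
  have hd₀ : p₀ ∈ Am := hA.down_mem _ hb₀ (hp₀' 0) le_rfl
  have hcont : Tendsto (fun τ : ℝ => ((3 / 2, 0, τ) : R3)) (𝓝 0) (𝓝 p₀) :=
    Continuous.tendsto (by fun_prop) 0
  have hev : ∀ᶠ τ : ℝ in 𝓝 0, dp (3 / 2, 0, τ) = dp p₀ ∧ dm (3 / 2, 0, τ) = dm p₀ ∧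
      ((3 / 2, 0, τ) : R3) ∈ twistBox a ∧ ((3 / 2, 0, τ) : R3) ∈ Ap ∧
      ((3 / 2, 0, τ) : R3) ∈ Am :=
    hcont.eventually ((hdp p₀ ⟨hb₀, hu₀⟩).and ((hdm p₀ ⟨hb₀, hd₀⟩).and
      (((isOpen_twistBox a).eventually_mem hb₀).and ((hA.isOpen_up.eventually_mem hu₀).and
        (hA.isOpen_down.eventually_mem hd₀)))))
  obtain ⟨τ₁, hτ₁, h1⟩ := ((frequently_gt_nhds (0 : ℝ)).and_eventually hev).exists
  obtain ⟨τ₂, hτ₂, h2⟩ := ((frequently_lt_nhds (0 : ℝ)).and_eventually hev).exists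
  have e1 := hup _ ⟨h1.2.2.1, h1.2.2.2.1⟩ hτ₁
  have e2 := hdown _ ⟨h2.2.2.1, h2.2.2.2.2⟩ hτ₂
  have e3 := hd p₀ hb₀ hu₀ hd₀
  rw [hF.right p₀ (by norm_num [p₀]) (by norm_num [p₀]) (by norm_num [p₀]) rfl, ← h1.1,
    ← h2.2.1, e1, e2, mul_assoc, mul_left_cancel_iff] at e3
  have h5 := (boxValue_right P N L (a := a) (p := (3 / 2, 0, τ₁)) (by norm_num)).1 hτ₁
  have h6 := (boxValue_right P N L (a := a) (p := (3 / 2, 0, τ₂)) (by norm_num)).2 hτ₂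
  rw [h5, h6] at e3
  unfold BoxRelation
  split_ifs at e3 ⊢ <;> exact e3

/-- Comparison of an arbitrary cocycle near a twist region with the image of the standard one. -/
theorem IsBoxFrame.exists_eq_mul_map (hA : IsBoxFrame a Ap Am) {F : R3 → G} {F' : R3 → H}
    {P N L : G} (f : G →* H) (hFF : ∀ p ∈ Ap ∩ Am, F' p = f (F p))
    {cp cm : R3 → G} (hcp : ∀ p ∈ twistBox a ∩ Ap, ∀ᶠ q in 𝓝 p, cp q = cp p)
    (hcF : ∀ p, cp p * F p = cm p)
    (hcp' : ∀ p : R3, 0 < p.2.2 → cp p = boxValue P N L a p)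
    (hcm' : ∀ p : R3, p.2.2 < 0 → cm p = boxValue P N L a p)
    {dp dm : R3 → H} (hdp : ∀ p ∈ twistBox a ∩ Ap, ∀ᶠ q in 𝓝 p, dp q = dp p)
    (hd : ∀ p ∈ twistBox a, p ∈ Ap → p ∈ Am → dp p * F' p = dm p) {h : H}
    (hup : ∀ p ∈ twistBox a ∩ Ap, 0 < p.2.2 → dp p = h * boxValue (f P) (f N) (f L) a p)
    (hdown : ∀ p ∈ twistBox a ∩ Am, p.2.2 < 0 → dm p = h * boxValue (f P) (f N) (f L) a p) :
    (∀ p ∈ twistBox a ∩ Ap, dp p = h * f (cp p)) ∧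
      ∀ p ∈ twistBox a ∩ Am, dm p = h * f (cm p) := by
  have main : ∀ p ∈ twistBox a ∩ Ap, dp p = h * f (cp p) := by
    intro p hp
    have hpos : ∀ q ∈ twistBox a ∩ Ap, 0 < q.2.2 → dp q = h * f (cp q) := by
      intro q hq hz
      rw [hup q hq hz, hcp' q hz, map_boxValue]
    rcases lt_trichotomy p.2.2 0 with hz | hz | hz
    -- Below the plane the point also lies in `Am`, where the values are known; the common
    -- transition carries them back to `Ap`.
    · have hm := hA.down_mem p hp.1 (hA.up_core p hp.2) hz.le
      have h1 := hd p hp.1 hp.2 hm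
      rw [hdown p ⟨hp.1, hm⟩ hz, hFF p ⟨hp.2, hm⟩, ← map_boxValue, ← hcm' p hz, ← hcF p,
        map_mul, ← mul_assoc] at h1
      exact mul_right_cancel h1
    · obtain ⟨q, hq, h1, h2, h3⟩ := ((frequently_height_pos p hz).and_eventually
        ((hdp p hp).and ((hcp p hp).and
          (((isOpen_twistBox a).inter hA.isOpen_up).mem_nhds hp)))).exists
      rw [← h1, ← h2]
      exact hpos q h3 hq
    · exact hpos p hp hz
  refine ⟨main, fun p hp => ?_⟩
  rcases lt_or_ge p.2.2 0 with hz | hz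
  · rw [hdown p hp hz, hcm' p hz, map_boxValue]
  · have hu := hA.up_mem p hp.1 (hA.down_core p hp.2) hz
    rw [← hd p hp.1 hu hp.2, main p ⟨hp.1, hu⟩, hFF p ⟨hu, hp.2⟩, ← hcF p, map_mul, mul_assoc]

end Box

/-! ### The two strands of a twist region -/

/-- The two strands in the model twist region. -/
def strands (a : ℤ) : Set R3 :=
  {p | |p.1| ≤ 1 ∧ p.2.1 ^ 2 + p.2.2 ^ 2 = 1 ∧ untwistZ a p = 0}

theorem mem_strands_iff {a : ℤ} {p : R3} :
    p ∈ strands a ↔ ∃ u ∈ Icc (0 : ℝ) 1, ∃ σ : ℝ, (σ = 1 ∨ σ = -1) ∧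
      p = (-1 + 2 * u, σ * cos (a * π * u), σ * sin (a * π * u)) := by
  constructor
  · rintro ⟨h1, h2, h3⟩
    have h4 := untwist_sq a p
    have h5 := sin_sq_add_cos_sq (twistAngle a p.1)
    have hθ := twistAngle_of_mem (a := a) h1
    rw [h2, h3] at h4
    rw [abs_le] at h1
    -- The sign `σ` is the first untwisted coordinate, whose square is 1 because the second one
    -- vanishes.
    refine ⟨(p.1 + 1) / 2, ⟨by linarith, by linarith⟩, untwistY a p, ?_, ?_⟩
    · exact mul_self_eq_one_iff.1 (by linarith)
    · rw [← hθ]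
      unfold untwistY
      unfold untwistZ at h3
      refine Prod.ext (by ring) (Prod.ext ?_ ?_)
      · linear_combination (-p.2.1) * h5 - sin (twistAngle a p.1) * h3
      · linear_combination (-p.2.2) * h5 + cos (twistAngle a p.1) * h3
  · rintro ⟨u, ⟨h0, h1⟩, σ, hσ, rfl⟩
    have h5 := sin_sq_add_cos_sq (a * π * u)
    have hσ2 : σ ^ 2 = 1 := by rcases hσ with rfl | rfl <;> norm_num
    have hu : |-1 + 2 * u| ≤ 1 := abs_le.2 ⟨by linarith, by linarith⟩
    refine ⟨hu, by linear_combination h5 + (sin (a * π * u) ^ 2 + cos (a * π * u) ^ 2) * (hσ2), ?_⟩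
    rw [untwistZ, twistAngle_of_mem hu, show (-1 + 2 * u + 1) / 2 = u by ring]
    ring

theorem not_mem_twistBox_of_strands {a : ℤ} {p : R3} (hp : p ∈ strands a) : p ∉ twistBox a :=
  fun h => h.2.2 hp.2.1.ge hp.2.2

theorem mem_twistBox_of_core {a : ℤ} {p : R3} (hp : p ∈ twistCore) (hs : p ∉ strands a) :
    p ∈ twistBox a :=
  ⟨by linarith [hp.1], by linarith [hp.2], fun h h0 => hs ⟨hp.1, le_antisymm hp.2 h, h0⟩⟩

/-- Beyond the ends the ruled surface is flat and lies in the plane of projection, so the removed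
part contains the arcs arriving at the strands. -/
theorem not_mem_twistBox_of_arc {a : ℤ} {p : R3} (hz : p.2.2 = 0) (hu : 1 ≤ |p.1|)
    (hy : 1 ≤ |p.2.1|) : p ∉ twistBox a := by
  intro h
  refine h.2.2 ?_ ?_
  · nlinarith [sq_abs p.2.1, sq_nonneg p.2.2]
  · rcases le_abs.1 hu with h | h
    · rw [untwist_of_ge h, hz]; simp
    · rw [(untwist_of_le (by linarith)).2, hz]

/-! ### The pieces of the complement -/

/-- The positions of the horizontal (`false`) and the vertical (`true`) twist regions. -/
def boxChart : Bool → R3 ≃ₜ R3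
  | false =>
    { toFun := fun p => (p.1 + 2, p.2.1, p.2.2)
      invFun := fun p => (p.1 - 2, p.2.1, p.2.2)
      left_inv := fun p => by simp
      right_inv := fun p => by simp
      continuous_toFun := by fun_prop
      continuous_invFun := by fun_prop }
  -- Exchanging the two plane coordinates reverses orientation, which turns the right-handed model
  -- twists into left-handed vertical ones.
  | true =>
    { toFun := fun p => (p.2.1, p.1 - 2, p.2.2)
      invFun := fun p => (p.2.1 + 2, p.1, p.2.2)
      left_inv := fun p => by simp
      right_inv := fun p => by simp
      continuous_toFun := by fun_prop
      continuous_invFun := by fun_prop }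

@[simp] theorem boxChart_false (p : R3) : boxChart false p = (p.1 + 2, p.2.1, p.2.2) := rfl

@[simp] theorem boxChart_true (p : R3) : boxChart true p = (p.2.1, p.1 - 2, p.2.2) := rfl

@[simp] theorem boxChart_symm_false (p : R3) :
    (boxChart false).symm p = (p.1 - 2, p.2.1, p.2.2) := rfl

@[simp] theorem boxChart_symm_true (p : R3) :
    (boxChart true).symm p = (p.2.1 + 2, p.1, p.2.2) := rfl

theorem horizontalTwists_eq (a : ℤ) : horizontalTwists a = boxChart false ⁻¹' strands a := by
  ext ⟨x, y, z⟩
  simp only [horizontalTwists, mem_ofPred_eq, mem_preimage, boxChart_false, mem_strands_iff,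
    Prod.mk.injEq]
  constructor <;> rintro ⟨u, hu, σ, hσ, h1, h2, h3⟩ <;>
    exact ⟨u, hu, σ, hσ, by linarith, h2, h3⟩

theorem verticalTwists_eq (b : ℤ) : verticalTwists b = boxChart true ⁻¹' strands b := by
  ext ⟨x, y, z⟩
  simp only [verticalTwists, mem_ofPred_eq, mem_preimage, boxChart_true, mem_strands_iff,
    Prod.mk.injEq]
  constructor
  · rintro ⟨u, hu, σ, hσ, h1, h2, h3⟩
    exact ⟨u, hu, σ, hσ, h2, by linarith, h3⟩
  · rintro ⟨u, hu, σ, hσ, h1, h2, h3⟩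
    exact ⟨u, hu, σ, hσ, by linarith, h1, h3⟩

/-- The core of a twist region together with everything below it. -/
def coreShadow : Set R3 :=
  {p | |p.1| ≤ 1 ∧ |p.2.1| ≤ 1 ∧ (p.2.2 ≤ 0 ∨ p.2.1 ^ 2 + p.2.2 ^ 2 ≤ 1)}

/-- The points above or below the connecting arcs. -/
def arcShadow : Set R3 :=
  {p | ((p.2.1 = 1 ∨ p.2.1 = -1) ∧ p.1 ∈ Icc (-1 : ℝ) 1) ∨
    ((p.2.1 = 2 ∨ p.2.1 = -2) ∧ p.1 ∈ Icc (-3 : ℝ) 3) ∨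
    ((p.1 = 3 ∨ p.1 = -3) ∧ |p.2.1| ∈ Icc (1 : ℝ) 2)}

/-- What is hidden by the knot when one looks from above: the points below it, and everything
deep below the diagram. -/
def hidden : Set R3 :=
  ({p | |p.1| ≤ 3 ∧ |p.2.1| ≤ 2 ∧ p.2.2 ≤ -2} ∪ (arcShadow ∩ {p | p.2.2 ≤ 0})) ∪
    (boxChart false ⁻¹' coreShadow ∪ boxChart true ⁻¹' coreShadow)

/-- The reflection in the plane of projection. -/
def reflect (p : R3) : R3 := (p.1, p.2.1, -p.2.2)

@[fun_prop] theorem continuous_reflect : Continuous reflect := by unfold reflect; fun_prop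

@[simp] theorem reflect_reflect (p : R3) : reflect (reflect p) = p := by simp [reflect]

/-- The part of the complement seen from above. -/
def upSet : Set R3 := hiddenᶜ

/-- The part of the complement seen from below. -/
def downSet : Set R3 := reflect ⁻¹' upSet

theorem isClosed_arcShadow : IsClosed arcShadow := by
  have h : ∀ {f : R3 → ℝ} (_ : Continuous f) (b c : ℝ), IsClosed {p | f p ∈ Icc b c} :=
    fun hf b c => isClosed_Icc.preimage hf
  have h' : ∀ {f : R3 → ℝ} (_ : Continuous f) (b c : ℝ), IsClosed {p | f p = b ∨ f p = c} :=
    fun hf b c => (isClosed_eq hf continuous_const).union (isClosed_eq hf continuous_const)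
  exact ((h' (by fun_prop) _ _).inter (h (by fun_prop) _ _)).union
    (((h' (by fun_prop) _ _).inter (h (by fun_prop) _ _)).union
      ((h' (by fun_prop) _ _).inter (h (f := fun p => |p.2.1|) (by fun_prop) _ _)))

theorem isClosed_coreShadow : IsClosed coreShadow :=
  (isClosed_le (f := fun p : R3 => |p.1|) (by fun_prop) (by fun_prop)).inter
    ((isClosed_le (f := fun p : R3 => |p.2.1|) (by fun_prop) (by fun_prop)).inter
      ((isClosed_le (f := fun p : R3 => p.2.2) (by fun_prop) (by fun_prop)).union
        (isClosed_le (f := fun p : R3 => p.2.1 ^ 2 + p.2.2 ^ 2) (by fun_prop) (by fun_prop))))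

theorem isOpen_upSet : IsOpen upSet := by
  refine IsClosed.isOpen_compl (self := ?_)
  refine IsClosed.union (IsClosed.union ?_ ?_) (IsClosed.union ?_ ?_)
  · exact (isClosed_le (f := fun p : R3 => |p.1|) (by fun_prop) (by fun_prop)).inter
      ((isClosed_le (f := fun p : R3 => |p.2.1|) (by fun_prop) (by fun_prop)).inter
        (isClosed_le (f := fun p : R3 => p.2.2) (by fun_prop) (by fun_prop)))
  · exact isClosed_arcShadow.inter (isClosed_le (by fun_prop) (by fun_prop))
  · exact isClosed_coreShadow.preimage (boxChart false).continuous
  · exact isClosed_coreShadow.preimage (boxChart true).continuous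

theorem isOpen_downSet : IsOpen downSet := isOpen_upSet.preimage continuous_reflect

theorem mem_hidden_iff {p : R3} : p ∈ hidden ↔
    (|p.1| ≤ 3 ∧ |p.2.1| ≤ 2 ∧ p.2.2 ≤ -2) ∨ (p ∈ arcShadow ∧ p.2.2 ≤ 0) ∨
      (|p.1 + 2| ≤ 1 ∧ |p.2.1| ≤ 1 ∧ (p.2.2 ≤ 0 ∨ p.2.1 ^ 2 + p.2.2 ^ 2 ≤ 1)) ∨
      (|p.2.1| ≤ 1 ∧ |p.1 - 2| ≤ 1 ∧ (p.2.2 ≤ 0 ∨ (p.1 - 2) ^ 2 + p.2.2 ^ 2 ≤ 1)) := by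
  simp only [hidden, coreShadow, mem_union, mem_ofPred_eq, mem_inter_iff, mem_preimage,
    boxChart_false, boxChart_true, or_assoc]

theorem coreShadow_of_le {p : R3} (hp : p ∈ coreShadow) {τ : ℝ} (hτ : τ ≤ p.2.2) :
    ((p.1, p.2.1, τ) : R3) ∈ coreShadow := by
  refine ⟨hp.1, hp.2.1, ?_⟩
  rcases le_or_gt τ 0 with h | h
  · exact Or.inl h
  · rcases hp.2.2 with h' | h'
    · exact Or.inl (hτ.trans h')
    · right
      simp only
      nlinarith

theorem upSet_of_ge {p : R3} (hp : p ∈ upSet) {τ : ℝ} (hτ : p.2.2 ≤ τ) :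
    ((p.1, p.2.1, τ) : R3) ∈ upSet := by
  rintro ((h | h) | (h | h))
  · exact hp (Or.inl (Or.inl ⟨h.1, h.2.1, hτ.trans h.2.2⟩))
  · exact hp (Or.inl (Or.inr ⟨h.1, hτ.trans h.2⟩))
  · exact hp (Or.inr (Or.inl (coreShadow_of_le h hτ)))
  · exact hp (Or.inr (Or.inr (coreShadow_of_le h hτ)))

theorem upSet_of_one_lt {p : R3} (hp : 1 < p.2.2) : p ∈ upSet := by
  intro h
  rw [mem_hidden_iff] at h
  rcases h with h | h | h | h
  · linarith [h.2.2]
  · linarith [h.2]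
  · rcases h.2.2 with h | h <;> nlinarith [sq_nonneg p.2.1]
  · rcases h.2.2 with h | h <;> nlinarith [sq_nonneg (p.1 - 2)]

/-- Visibility from above persists when a point is raised, and nothing above height 1 is hidden. So
all points move vertically to height 10 (those higher up come down to it) and then contract inside
that plane. -/
theorem isSimplyConnected_upSet : IsSimplyConnected upSet := by
  refine isSimplyConnected_of_segments (r := fun p => (p.1, p.2.1, 10)) (by fun_prop)
    (c := (0, 0, 10)) (upSet_of_one_lt (by norm_num)) ?_ ?_
  · rintro p hp _ ⟨α, β, hα, hβ, hαβ, rfl⟩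
    have h1 : α • p + β • ((p.1, p.2.1, 10) : R3) = (p.1, p.2.1, α * p.2.2 + β * 10) := by
      refine Prod.ext ?_ (Prod.ext ?_ ?_)
      · simp [← add_mul, hαβ]
      · simp [← add_mul, hαβ]
      · simp
    rw [h1]
    rcases lt_or_ge 1 (α * p.2.2 + β * 10) with h | h
    · exact upSet_of_one_lt h
    · refine upSet_of_ge hp ?_
      obtain rfl : β = 1 - α := by linarith
      rcases le_or_gt p.2.2 10 with h2 | h2 <;> nlinarith
  · rintro p hp _ ⟨α, β, hα, hβ, hαβ, rfl⟩
    refine upSet_of_one_lt ?_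
    simp [← add_mul, hαβ]

/-- The reflection as a homeomorphism. -/
def reflectHomeomorph : R3 ≃ₜ R3 where
  toFun := reflect
  invFun := reflect
  left_inv := reflect_reflect
  right_inv := reflect_reflect

theorem reflect_image (S : Set R3) : reflect '' S = reflect ⁻¹' S :=
  reflectHomeomorph.image_eq_preimage_symm S

theorem isSimplyConnected_downSet : IsSimplyConnected downSet := by
  rw [downSet, ← reflect_image]
  exact (reflectHomeomorph.isEmbedding.isSimplyConnected_image).2 isSimplyConnected_upSet

/-! ### The faces -/

/-- The points above or below the outer, unbounded face of the diagram. -/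
def outerFace : Set R3 := {p | 3 < |p.1| ∨ 2 < |p.2.1|}

/-- The top face, thickened. -/
def topFace : Set R3 := Ioo (-3) 3 ×ˢ Ioo 1 2 ×ˢ Ioo (-2) 2

/-- The bottom face, thickened. -/
def bottomFace : Set R3 := Ioo (-3) 3 ×ˢ Ioo (-2) (-1) ×ˢ Ioo (-2) 2

/-- The middle face, thickened. -/
def middleFace : Set R3 := Ioo (-1) 1 ×ˢ Ioo (-1) 1 ×ˢ Ioo (-2) 2

theorem isOpen_outerFace : IsOpen outerFace :=
  (isOpen_lt (f := fun _ => (3 : ℝ)) (by fun_prop) (by fun_prop)).union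
    (isOpen_lt (f := fun _ => (2 : ℝ)) (by fun_prop) (by fun_prop))

theorem isOpen_topFace : IsOpen topFace := isOpen_Ioo.prod (isOpen_Ioo.prod isOpen_Ioo)

theorem isOpen_bottomFace : IsOpen bottomFace := isOpen_Ioo.prod (isOpen_Ioo.prod isOpen_Ioo)

theorem isOpen_middleFace : IsOpen middleFace := isOpen_Ioo.prod (isOpen_Ioo.prod isOpen_Ioo)

/-- Over the arcs and over the squares around the cores a point is hidden from one of the two sides,
according to the sign of its height. What remains inside the frame is three rectangles, and the deep
slabs bound the height by 2. -/
theorem face_of_mem {p : R3} (hu : p ∈ upSet) (hd : p ∈ downSet) :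
    p ∈ outerFace ∨ p ∈ topFace ∨ p ∈ bottomFace ∨ p ∈ middleFace := by
  by_cases h0 : p ∈ outerFace
  · exact Or.inl h0
  right
  have h1 : p ∉ hidden := hu
  have h2 : reflect p ∉ hidden := hd
  rw [mem_hidden_iff, not_or, not_or, not_or] at h1 h2
  obtain ⟨h11, h12, h13, h14⟩ := h1
  obtain ⟨h21, h22, h23, h24⟩ := h2
  obtain ⟨x, y, z⟩ := p
  simp only [reflect] at h11 h12 h13 h14 h21 h22 h23 h24
  obtain ⟨hx, hy⟩ : |x| ≤ 3 ∧ |y| ≤ 2 := by simpa [outerFace] using h0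
  have hz1 : -2 < z := not_le.1 fun h => h11 ⟨hx, hy, h⟩
  have hz2 : z < 2 := not_le.1 fun h => h21 ⟨hx, hy, by linarith⟩
  have harc : ((x, y, z) : R3) ∉ arcShadow := by
    intro h
    rcases le_total z 0 with h' | h'
    · exact h12 ⟨h, h'⟩
    · exact h22 ⟨h, neg_nonpos.2 h'⟩
  have hleft : |x + 2| ≤ 1 → 1 < |y| := by
    intro h
    refine not_le.1 fun hy => ?_
    rcases le_total z 0 with h' | h'
    · exact h13 ⟨h, hy, Or.inl h'⟩
    · exact h23 ⟨h, hy, Or.inl (neg_nonpos.2 h')⟩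
  have hright : |x - 2| ≤ 1 → 1 < |y| := by
    intro h
    refine not_le.1 fun hy => ?_
    rcases le_total z 0 with h' | h'
    · exact h14 ⟨hy, h, Or.inl h'⟩
    · exact h24 ⟨hy, h, Or.inl (neg_nonpos.2 h')⟩
  rw [abs_le] at hx
  rcases le_or_gt 1 |y| with h | h
  · have hx3 : x ≠ 3 := fun hx3 => harc (Or.inr (Or.inr ⟨Or.inl hx3, h, hy⟩))
    have hx3' : x ≠ -3 := fun hx3 => harc (Or.inr (Or.inr ⟨Or.inr hx3, h, hy⟩))
    have hy2 : y ≠ 2 := fun hy2 => harc (Or.inr (Or.inl ⟨Or.inl hy2, hx⟩))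
    have hy2' : y ≠ -2 := fun hy2 => harc (Or.inr (Or.inl ⟨Or.inr hy2, hx⟩))
    have hone : 1 < |y| := by
      rcases lt_or_ge 1 x with h1 | h1
      · exact hright (abs_le.2 ⟨by linarith, by linarith⟩)
      rcases lt_or_ge x (-1) with h2 | h2
      · exact hleft (abs_le.2 ⟨by linarith, by linarith⟩)
      refine lt_of_le_of_ne h fun h3 => harc (Or.inl ⟨?_, h2, h1⟩)
      exact eq_or_eq_neg_of_abs_eq h3.symm
    rw [abs_le] at hy
    have h1 : x ∈ Ioo (-3 : ℝ) 3 := ⟨lt_of_le_of_ne hx.1 hx3'.symm, lt_of_le_of_ne hx.2 hx3⟩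
    rcases lt_abs.1 hone with h' | h'
    · exact Or.inl ⟨h1, ⟨h', lt_of_le_of_ne hy.2 hy2⟩, hz1, hz2⟩
    · exact Or.inr (Or.inl ⟨h1, ⟨lt_of_le_of_ne hy.1 hy2'.symm, by linarith⟩, hz1, hz2⟩)
  · refine Or.inr (Or.inr ⟨⟨?_, ?_⟩, abs_lt.1 h, hz1, hz2⟩)
    · refine not_le.1 fun h' => h.not_gt (hleft (abs_le.2 ⟨by linarith, by linarith⟩))
    · refine not_le.1 fun h' => h.not_gt (hright (abs_le.2 ⟨by linarith, by linarith⟩))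

theorem outerFace_subset : outerFace ⊆ upSet := by
  intro p hp h
  rw [mem_hidden_iff] at h
  rcases hp with hp | hp
  · rcases h with h | h | h | h
    · linarith [h.1]
    · rcases h.1 with h | h | h
      · exact absurd (abs_le.2 h.2) (by linarith)
      · exact absurd (abs_le.2 h.2) (by linarith)
      · rcases h.1 with h | h <;> norm_num [h] at hp
    · have := abs_le.1 h.1
      exact absurd (abs_le.2 ⟨by linarith, by linarith⟩ : |p.1| ≤ 3) (by linarith)
    · have := abs_le.1 h.2.1
      exact absurd (abs_le.2 ⟨by linarith, by linarith⟩ : |p.1| ≤ 3) (by linarith)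
  · rcases h with h | h | h | h
    · linarith [h.2.1]
    · rcases h.1 with h | h | h
      · rcases h.1 with h | h <;> norm_num [h] at hp
      · rcases h.1 with h | h <;> norm_num [h] at hp
      · linarith [h.2.2]
    · linarith [h.2.1]
    · linarith [h.1]

theorem topFace_subset : topFace ⊆ upSet := by
  rintro p ⟨⟨h1, h2⟩, ⟨h3, h4⟩, h5, h6⟩ h
  have hy : |p.2.1| = p.2.1 := abs_of_pos (by linarith)
  rw [mem_hidden_iff, arcShadow, mem_ofPred_eq, hy] at h
  rcases h with h | ⟨⟨h | h, -⟩ | ⟨h | h, -⟩ | ⟨h | h, -⟩, -⟩ | h | h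
  · linarith [h.2.2]
  all_goals linarith

theorem bottomFace_subset : bottomFace ⊆ upSet := by
  rintro p ⟨⟨h1, h2⟩, ⟨h3, h4⟩, h5, h6⟩ h
  have hy : |p.2.1| = -p.2.1 := abs_of_neg (by linarith)
  rw [mem_hidden_iff, arcShadow, mem_ofPred_eq, hy] at h
  rcases h with h | ⟨⟨h | h, -⟩ | ⟨h | h, -⟩ | ⟨h | h, -⟩, -⟩ | h | h
  · linarith [h.2.2]
  all_goals linarith

theorem middleFace_subset : middleFace ⊆ upSet := by
  rintro p ⟨⟨h1, h2⟩, ⟨h3, h4⟩, h5, h6⟩ h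
  rw [mem_hidden_iff, arcShadow, mem_ofPred_eq] at h
  rcases h with h | ⟨⟨h | h, -⟩ | ⟨h | h, -⟩ | ⟨h | h, -⟩, -⟩ | h | h
  · linarith [h.2.2]
  all_goals first | linarith | linarith [(abs_le.1 h.1).2] | linarith [(abs_le.1 h.2.1).1]

theorem reflect_mem_face {p : R3} :
    (reflect p ∈ outerFace ↔ p ∈ outerFace) ∧ (reflect p ∈ topFace ↔ p ∈ topFace) ∧
      (reflect p ∈ bottomFace ↔ p ∈ bottomFace) ∧ (reflect p ∈ middleFace ↔ p ∈ middleFace) := by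
  have h : -p.2.2 ∈ Ioo (-2 : ℝ) 2 ↔ p.2.2 ∈ Ioo (-2 : ℝ) 2 := by
    constructor <;> rintro ⟨h1, h2⟩ <;> constructor <;> linarith
  refine ⟨Iff.rfl, ?_, ?_, ?_⟩ <;>
    simp only [topFace, bottomFace, middleFace, reflect, mem_prod, h]

theorem outerFace_subset_inter : outerFace ⊆ upSet ∩ downSet := fun _ hp =>
  ⟨outerFace_subset hp, outerFace_subset (reflect_mem_face.1.2 hp)⟩

theorem topFace_subset_inter : topFace ⊆ upSet ∩ downSet := fun _ hp =>
  ⟨topFace_subset hp, topFace_subset (reflect_mem_face.2.1.2 hp)⟩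

theorem bottomFace_subset_inter : bottomFace ⊆ upSet ∩ downSet := fun _ hp =>
  ⟨bottomFace_subset hp, bottomFace_subset (reflect_mem_face.2.2.1.2 hp)⟩

theorem middleFace_subset_inter : middleFace ⊆ upSet ∩ downSet := fun _ hp =>
  ⟨middleFace_subset hp, middleFace_subset (reflect_mem_face.2.2.2.2 hp)⟩

theorem isPathConnected_of_box {a b c d e f : ℝ} (h₁ : a < b) (h₂ : c < d) (h₃ : e < f) :
    IsPathConnected (Ioo a b ×ˢ Ioo c d ×ˢ Ioo e f : Set R3) :=
  ((convex_Ioo a b).prod ((convex_Ioo c d).prod (convex_Ioo e f))).isPathConnected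
    ((nonempty_Ioo.2 h₁).prod ((nonempty_Ioo.2 h₂).prod (nonempty_Ioo.2 h₃)))

theorem isPathConnected_topFace : IsPathConnected topFace :=
  isPathConnected_of_box (by norm_num) (by norm_num) (by norm_num)

theorem isPathConnected_bottomFace : IsPathConnected bottomFace :=
  isPathConnected_of_box (by norm_num) (by norm_num) (by norm_num)

theorem isPathConnected_middleFace : IsPathConnected middleFace :=
  isPathConnected_of_box (by norm_num) (by norm_num) (by norm_num)

theorem joinedIn_of_convex {S C : Set R3} (hC : Convex ℝ C) (hCS : C ⊆ S) {p q : R3} (hp : p ∈ C)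
    (hq : q ∈ C) : JoinedIn S p q :=
  JoinedIn.of_segment_subset ((hC.segment_subset hp hq).trans hCS)

theorem isPathConnected_outerFace : IsPathConnected outerFace := by
  have hx : ∀ ε : ℝ, |ε| = 1 → Convex ℝ {p : R3 | 3 < ε * p.1} ∧
      {p : R3 | 3 < ε * p.1} ⊆ outerFace := by
    intro ε hε
    refine ⟨convex_halfSpace_gt (f := fun p : R3 => ε * p.1)
      ⟨fun p q => by simp; ring, fun c p => by simp; ring⟩ 3, fun p hp => Or.inl ?_⟩
    have := (le_abs_self (ε * p.1))
    rw [abs_mul, hε, one_mul] at this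
    exact lt_of_lt_of_le hp this
  have hy : ∀ ε : ℝ, |ε| = 1 → Convex ℝ {p : R3 | 2 < ε * p.2.1} ∧
      {p : R3 | 2 < ε * p.2.1} ⊆ outerFace := by
    intro ε hε
    refine ⟨convex_halfSpace_gt (f := fun p : R3 => ε * p.2.1)
      ⟨fun p q => by simp; ring, fun c p => by simp; ring⟩ 2, fun p hp => Or.inr ?_⟩
    have := (le_abs_self (ε * p.2.1))
    rw [abs_mul, hε, one_mul] at this
    exact lt_of_lt_of_le hp this
  have h1 : |(1 : ℝ)| = 1 := abs_one
  have h2 : |(-1 : ℝ)| = 1 := by simp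
  have top : ∀ x y : ℝ, 2 < y → JoinedIn outerFace (10, 0, 0) (x, y, 0) := fun x y h =>
    (joinedIn_of_convex (hx 1 h1).1 (hx 1 h1).2 (q := (10, 10, 0)) (by norm_num)
      (by norm_num)).trans (joinedIn_of_convex (hy 1 h1).1 (hy 1 h1).2 (by norm_num)
        (by simpa using h))
  refine ⟨(10, 0, 0), Or.inl (by norm_num), fun {p} hp => ?_⟩
  rcases hp with hp | hp
  · rcases lt_abs.1 hp with h | h
    · exact joinedIn_of_convex (hx 1 h1).1 (hx 1 h1).2 (by norm_num) (by simpa using h)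
    · exact (top (-10) 10 (by norm_num)).trans
        (joinedIn_of_convex (hx (-1) h2).1 (hx (-1) h2).2 (by norm_num) (by simpa using h))
  · rcases lt_abs.1 hp with h | h
    · exact (top 0 10 (by norm_num)).trans
        (joinedIn_of_convex (hy 1 h1).1 (hy 1 h1).2 (by norm_num) (by simpa using h))
    · exact (joinedIn_of_convex (hx 1 h1).1 (hx 1 h1).2 (q := (10, -10, 0)) (by norm_num)
        (by norm_num)).trans
        (joinedIn_of_convex (hy (-1) h2).1 (hy (-1) h2).2 (by norm_num) (by simpa using h))

/-! ### The neighbourhood of infinity -/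

theorem lt_norm_iff {R : ℝ} {p : R3} : R < ‖p‖ ↔ R < |p.1| ∨ R < |p.2.1| ∨ R < |p.2.2| := by
  simp [Prod.norm_def, Real.norm_eq_abs]

/-- The finite part of a neighbourhood of infinity. -/
def farSet : Set R3 := {p | 5 < ‖p‖}

theorem mem_farSet {p : R3} : p ∈ farSet ↔ 5 < |p.1| ∨ 5 < |p.2.1| ∨ 5 < |p.2.2| := lt_norm_iff

theorem isOpen_farSet : IsOpen farSet := isOpen_lt (by fun_prop) (by fun_prop)

theorem far_cases {p : R3} (hp : p ∈ farSet) : p ∈ outerFace ∨ 5 < |p.2.2| := by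
  rcases mem_farSet.1 hp with h | h | h
  · exact Or.inl (Or.inl (by linarith))
  · exact Or.inl (Or.inr (by linarith))
  · exact Or.inr h

theorem not_far_of_face {p : R3} (hp : p ∈ topFace ∨ p ∈ bottomFace ∨ p ∈ middleFace) :
    p ∉ farSet := by
  rw [mem_farSet]
  rintro (h | h | h)
  all_goals
    rcases lt_abs.1 h with h | h <;> rcases hp with hp | hp | hp <;>
      linarith [hp.1.1, hp.1.2, hp.2.1.1, hp.2.1.2, hp.2.2.1, hp.2.2.2]

/-- This is why `hidden` contains everything deep below the diagram: far down, the visible points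
then lie only over the connected outer face. Otherwise the space under each bounded face would
contribute a further component. -/
theorem isPathConnected_far_inter_upSet : IsPathConnected (upSet ∩ farSet) := by
  have hfar : ∀ p : R3, p ∈ outerFace → 5 < |p.2.2| → p ∈ upSet ∩ farSet := fun p h1 h2 =>
    ⟨outerFace_subset h1, mem_farSet.2 (Or.inr (Or.inr h2))⟩
  have hO : ∀ p : R3, 5 < |p.1| ∨ 5 < |p.2.1| → p ∈ upSet ∩ farSet := by
    rintro p (h | h)
    · exact ⟨outerFace_subset (Or.inl (by linarith)), mem_farSet.2 (Or.inl h)⟩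
    · exact ⟨outerFace_subset (Or.inr (by linarith)), mem_farSet.2 (Or.inr (Or.inl h))⟩
  have hup : ∀ p : R3, 5 < p.2.2 → JoinedIn (upSet ∩ farSet) (0, 0, 10) p := by
    intro p hp
    refine joinedIn_of_convex (C := {q : R3 | 5 < q.2.2}) (convex_halfSpace_gt
      ⟨fun p q => rfl, fun c p => rfl⟩ 5) (fun q hq => ?_) (by norm_num) hp
    exact ⟨upSet_of_one_lt (by linarith [show 5 < q.2.2 from hq]),
      mem_farSet.2 (Or.inr (Or.inr (lt_abs.2 (Or.inl hq))))⟩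
  -- a vertical segment far away from the axis
  have hvert : ∀ p : R3, 5 < |p.1| ∨ 5 < |p.2.1| → JoinedIn (upSet ∩ farSet) (0, 0, 10) p := by
    intro p hp
    refine (hup (p.1, p.2.1, 10) (by norm_num)).trans (joinedIn_of_convex
      (C := {q : R3 | q.1 = p.1 ∧ q.2.1 = p.2.1}) ?_ (fun q hq => hO q ?_) ⟨rfl, rfl⟩ ⟨rfl, rfl⟩)
    · exact (convex_hyperplane (f := fun q : R3 => q.1) ⟨fun p q => rfl, fun c p => rfl⟩ _).inter
        (convex_hyperplane (f := fun q : R3 => q.2.1) ⟨fun p q => rfl, fun c p => rfl⟩ _)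
    · rwa [hq.1, hq.2]
  -- a horizontal segment far below the diagram
  have hhor : ∀ p : R3, 5 < |p.2.2| → p ∈ outerFace → ∃ q : R3, (5 < |q.1| ∨ 5 < |q.2.1|) ∧
      JoinedIn (upSet ∩ farSet) q p := by
    intro p h5 hp
    have key : ∀ (ℓ : R3 → ℝ) (_ : IsLinearMap ℝ ℓ) (r : ℝ) (q : R3), r < ℓ q → r < ℓ p →
        q.2.2 = p.2.2 → (∀ v, r < ℓ v → v ∈ outerFace) → JoinedIn (upSet ∩ farSet) q p := by
      intro ℓ hℓ r q hq hp' hz hO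
      refine joinedIn_of_convex (C := {v : R3 | r < ℓ v} ∩ {v | v.2.2 = p.2.2})
        ((convex_halfSpace_gt hℓ r).inter (convex_hyperplane ⟨fun p q => rfl, fun c p => rfl⟩ _))
        (fun v hv => hfar v (hO v hv.1) ?_) ⟨hq, hz⟩ ⟨hp', rfl⟩
      rwa [show v.2.2 = p.2.2 from hv.2]
    have lx : IsLinearMap ℝ fun v : R3 => v.1 := ⟨fun p q => rfl, fun c p => rfl⟩
    have ly : IsLinearMap ℝ fun v : R3 => v.2.1 := ⟨fun p q => rfl, fun c p => rfl⟩
    have lx' : IsLinearMap ℝ fun v : R3 => -v.1 := ⟨fun p q => by simp; ring, fun c p => by simp⟩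
    have ly' : IsLinearMap ℝ fun v : R3 => -v.2.1 :=
      ⟨fun p q => by simp; ring, fun c p => by simp⟩
    rcases hp with hp | hp
    · rcases lt_abs.1 hp with h | h
      · exact ⟨(10, 0, p.2.2), Or.inl (by norm_num), key _ lx 3 _ (by norm_num) h rfl
          fun v hv => Or.inl (lt_abs.2 (Or.inl hv))⟩
      · exact ⟨(-10, 0, p.2.2), Or.inl (by norm_num), key _ lx' 3 _ (by norm_num)
          h rfl fun v hv => Or.inl (lt_abs.2 (Or.inr hv))⟩
    · rcases lt_abs.1 hp with h | h
      · exact ⟨(0, 10, p.2.2), Or.inr (by norm_num), key _ ly 2 _ (by norm_num) h rfl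
          fun v hv => Or.inr (lt_abs.2 (Or.inl hv))⟩
      · exact ⟨(0, -10, p.2.2), Or.inr (by norm_num), key _ ly' 2 _ (by norm_num)
          h rfl fun v hv => Or.inr (lt_abs.2 (Or.inr hv))⟩
  refine ⟨(0, 0, 10), (hup (0, 0, 10) (by norm_num)).source_mem, fun {p} hp => ?_⟩
  rcases mem_farSet.1 hp.2 with h | h | h
  · exact hvert p (Or.inl h)
  · exact hvert p (Or.inr h)
  · rcases lt_abs.1 h with h' | h'
    · exact hup p h'
    · have hO : p ∈ outerFace := by
        by_contra hn
        simp only [outerFace, mem_ofPred_eq, not_or, not_lt] at hn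
        exact hp.1 (Or.inl (Or.inl ⟨hn.1, hn.2, by linarith⟩))
      obtain ⟨q, hq, hqp⟩ := hhor p h hO
      exact (hvert q hq).trans hqp

theorem isPathConnected_far_inter_downSet : IsPathConnected (downSet ∩ farSet) := by
  have h : downSet ∩ farSet = reflect '' (upSet ∩ farSet) := by
    rw [reflect_image, preimage_inter]
    congr 1
    ext p
    simp [mem_farSet, reflect]
  rw [h]
  exact isPathConnected_far_inter_upSet.image continuous_reflect

/-! ### The twist regions inside the diagram -/

/-- The two views hide opposite heights, so a point hidden in both is in the plane of projection or
in the round part of a core. -/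
theorem hidden_inter_reflect {p : R3} (hu : p ∉ upSet) (hd : p ∉ downSet) :
    p ∈ connectingArcs ∨ boxChart false p ∈ twistCore ∨ boxChart true p ∈ twistCore := by
  have h1 : p ∈ hidden := not_not.1 hu
  have h2 : reflect p ∈ hidden := not_not.1 hd
  rw [mem_hidden_iff] at h1 h2
  obtain ⟨x, y, z⟩ := p
  simp only [reflect, neg_sq] at h1 h2
  have harc : ∀ {τ : ℝ}, ((x, y, τ) : R3) ∈ arcShadow → z = 0 →
      ((x, y, z) : R3) ∈ connectingArcs := fun h h' => ⟨h', h⟩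
  -- Arcs touch the shadows of the cores only at distance at least 1 from the axis, where the round
  -- part of the core has height 0.
  have hcorner₁ : ∀ {τ : ℝ}, ((x, y, τ) : R3) ∈ arcShadow → 1 ≤ y ^ 2 := by
    rintro τ (⟨h | h, -⟩ | ⟨h | h, -⟩ | ⟨-, h, -⟩)
    all_goals simp only at h
    · norm_num [h]
    · norm_num [h]
    · norm_num [h]
    · norm_num [h]
    · exact (one_le_sq_iff_one_le_abs y).2 h
  have hcorner₂ : ∀ {τ : ℝ}, ((x, y, τ) : R3) ∈ arcShadow → |y| ≤ 1 → 1 ≤ (x - 2) ^ 2 := by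
    rintro τ (⟨-, -, h⟩ | ⟨h | h, -⟩ | ⟨h | h, -⟩) hy
    all_goals simp only at h
    · nlinarith
    · norm_num [h] at hy
    · norm_num [h] at hy
    · norm_num [h]
    · norm_num [h]
  rcases h1 with ⟨-, -, h1⟩ | ⟨ha, h1⟩ | ⟨hx, hy, h1⟩ | ⟨hy, hx, h1⟩
  · rcases h2 with ⟨-, -, h2⟩ | ⟨-, h2⟩ | ⟨-, -, h2 | h2⟩ | ⟨-, -, h2 | h2⟩
    · linarith
    · linarith
    · linarith
    · nlinarith [sq_nonneg y]
    · linarith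
    · nlinarith [sq_nonneg (x - 2)]
  · refine Or.inl (harc ha ?_)
    rcases h2 with ⟨-, -, h2⟩ | ⟨-, h2⟩ | ⟨-, -, h2 | h2⟩ | ⟨hy, -, h2 | h2⟩
    · linarith
    · linarith
    · linarith
    · exact pow_eq_zero_iff two_ne_zero |>.1 (le_antisymm (by linarith [hcorner₁ ha]) (sq_nonneg z))
    · linarith
    · exact pow_eq_zero_iff two_ne_zero |>.1
        (le_antisymm (by linarith [hcorner₂ ha hy]) (sq_nonneg z))
  · have hy2 : y ^ 2 ≤ 1 := (sq_le_one_iff_abs_le_one y).2 hy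
    have hcore : z = 0 ∨ y ^ 2 + z ^ 2 ≤ 1 → boxChart false (x, y, z) ∈ twistCore := by
      rintro (rfl | h)
      · exact ⟨hx, by simpa using hy⟩
      · exact ⟨hx, h⟩
    rcases h1 with h1 | h1
    swap
    · exact Or.inr (Or.inl (hcore (Or.inr h1)))
    rcases h2 with ⟨-, -, h2⟩ | ⟨-, h2⟩ | ⟨-, -, h2 | h2⟩ | ⟨-, hx', -⟩
    · linarith
    · exact Or.inr (Or.inl (hcore (Or.inl (by linarith))))
    · exact Or.inr (Or.inl (hcore (Or.inl (by linarith))))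
    · exact Or.inr (Or.inl (hcore (Or.inr h2)))
    · linarith [(abs_le.1 hx).2, (abs_le.1 hx').1]
  · have hx2 : (x - 2) ^ 2 ≤ 1 := (sq_le_one_iff_abs_le_one _).2 hx
    have hcore : z = 0 ∨ (x - 2) ^ 2 + z ^ 2 ≤ 1 → boxChart true (x, y, z) ∈ twistCore := by
      rintro (rfl | h)
      · exact ⟨hy, by simpa using hx⟩
      · exact ⟨hy, h⟩
    rcases h1 with h1 | h1
    swap
    · exact Or.inr (Or.inr (hcore (Or.inr h1)))
    rcases h2 with ⟨-, -, h2⟩ | ⟨-, h2⟩ | ⟨hx', -, -⟩ | ⟨-, -, h2 | h2⟩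
    · linarith
    · exact Or.inr (Or.inr (hcore (Or.inl (by linarith))))
    · linarith [(abs_le.1 hx).1, (abs_le.1 hx').2]
    · exact Or.inr (Or.inr (hcore (Or.inl (by linarith))))
    · exact Or.inr (Or.inr (hcore (Or.inr h2)))

/-- The numbers of half-twists of the diagram `C(2n, 3)`. -/
def twists (n : ℤ) : Bool → ℤ
  | false => 2 * n
  | true => 3

/-- The knot in space. -/
def knotSet (n : ℤ) : Set R3 := horizontalTwists (2 * n) ∪ verticalTwists 3 ∪ connectingArcs

theorem mem_knotSet_iff {n : ℤ} {p : R3} : p ∈ knotSet n ↔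
    p ∈ connectingArcs ∨ ∃ k, boxChart k p ∈ strands (twists n k) := by
  rw [knotSet, horizontalTwists_eq, verticalTwists_eq, Bool.exists_bool, or_comm]
  rfl

theorem box_bounds {n : ℤ} {k : Bool} {p : R3} (hp : boxChart k p ∈ twistBox (twists n k)) :
    |p.2.1| < 2 ∧ |p.2.2| < 2 ∧ ((k = false ∧ -4 < p.1 ∧ p.1 < 0) ∨
      (k = true ∧ 0 < p.1 ∧ p.1 < 4)) := by
  have h : ∀ y z : ℝ, y ^ 2 + z ^ 2 < 4 → |y| < 2 ∧ |z| < 2 := fun y z h =>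
    ⟨abs_lt_of_sq_lt_sq (by nlinarith) (by norm_num),
      abs_lt_of_sq_lt_sq (by nlinarith) (by norm_num)⟩
  cases k
  · obtain ⟨h1, h2, -⟩ := hp
    simp only [boxChart_false] at h1 h2
    rw [abs_lt] at h1
    exact ⟨(h _ _ h2).1, (h _ _ h2).2, Or.inl ⟨rfl, by linarith, by linarith⟩⟩
  · obtain ⟨h1, h2, -⟩ := hp
    simp only [boxChart_true] at h1 h2
    have h3 := abs_lt.1 (h _ _ h2).1
    exact ⟨h1, (h _ _ h2).2, Or.inr ⟨rfl, by linarith, by linarith⟩⟩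

theorem box_disjoint {n : ℤ} {j k : Bool} (hjk : j ≠ k) {p : R3}
    (hj : boxChart j p ∈ twistBox (twists n j)) : boxChart k p ∉ twistBox (twists n k) := by
  intro hk
  rcases (box_bounds hj).2.2 with ⟨rfl, h1, h2⟩ | ⟨rfl, h1, h2⟩ <;>
    rcases (box_bounds hk).2.2 with ⟨rfl, h3, h4⟩ | ⟨rfl, h3, h4⟩ <;>
    first | exact hjk rfl | linarith

theorem box_not_far {n : ℤ} {k : Bool} {p : R3} (hp : boxChart k p ∈ twistBox (twists n k)) :
    p ∉ farSet := by
  obtain ⟨h1, h2, h3⟩ := box_bounds hp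
  rw [mem_farSet]
  rintro (h | h | h)
  · rcases h3 with ⟨-, h3, h4⟩ | ⟨-, h3, h4⟩ <;> exact absurd
      (abs_lt.2 ⟨by linarith, by linarith⟩ : |p.1| < 5) (by linarith)
  · linarith
  · linarith

theorem box_not_arc {n : ℤ} {k : Bool} {p : R3} (hp : boxChart k p ∈ twistBox (twists n k))
    (hz : p.2.2 = 0) : p ∉ arcShadow := by
  obtain ⟨h1, h2, h3⟩ := box_bounds hp
  intro h
  have hy : 1 ≤ |p.2.1| := by
    rcases h with ⟨h | h, -⟩ | ⟨h | h, -⟩ | ⟨-, h, -⟩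
    all_goals first | exact h | norm_num [h]
  cases k
  · refine not_mem_twistBox_of_arc (p := boxChart false p) hz ?_ hy hp
    simp only [boxChart_false]
    rcases h with ⟨-, h, -⟩ | ⟨h | h, -⟩ | ⟨h | h, -⟩
    · exact le_abs.2 (Or.inl (by linarith))
    · norm_num [h] at h1
    · norm_num [h] at h1
    · norm_num [h]
    · norm_num [h]
  · refine not_mem_twistBox_of_arc (p := boxChart true p) hz hy ?_ hp
    simp only [boxChart_true]
    rcases h with ⟨-, -, h⟩ | ⟨h | h, -⟩ | ⟨h | h, -⟩
    · exact le_abs.2 (Or.inr (by linarith))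
    · norm_num [h] at h1
    · norm_num [h] at h1
    · norm_num [h]
    · norm_num [h]

theorem not_upSet_of_core {k : Bool} {p : R3} (hp : boxChart k p ∈ twistCore) : p ∉ upSet := by
  have h : ∀ q ∈ twistCore, q ∈ coreShadow := fun q hq =>
    ⟨hq.1, (sq_le_one_iff_abs_le_one _).1 (by nlinarith [hq.2, sq_nonneg q.2.2]), Or.inr hq.2⟩
  cases k
  · exact fun h' => h' (Or.inr (Or.inl (h _ hp)))
  · exact fun h' => h' (Or.inr (Or.inr (h _ hp)))

theorem boxChart_reflect (k : Bool) (p : R3) : boxChart k (reflect p) = reflect (boxChart k p) := by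
  cases k <;> rfl

theorem reflect_mem_core {p : R3} : reflect p ∈ twistCore ↔ p ∈ twistCore := by
  simp [twistCore, reflect]

theorem not_downSet_of_core {k : Bool} {p : R3} (hp : boxChart k p ∈ twistCore) : p ∉ downSet :=
  not_upSet_of_core (k := k) (by rwa [boxChart_reflect, reflect_mem_core])

/-- Here `τ` is the absolute value of the height, so that the same statement serves the view from
above and, after reflection, the one from below. -/
theorem not_hidden_of_box {n : ℤ} {k : Bool} {p : R3}
    (hp : boxChart k p ∈ twistBox (twists n k)) (hc : boxChart k p ∉ twistCore) {τ : ℝ}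
    (hτ : 0 ≤ τ) (hτp : τ ^ 2 = p.2.2 ^ 2) : ((p.1, p.2.1, τ) : R3) ∉ hidden := by
  obtain ⟨h1, h2, h3⟩ := box_bounds hp
  intro h
  rw [mem_hidden_iff] at h
  simp only [hτp] at h
  have hshadow : ∀ y : ℝ, |y| ≤ 1 → (τ ≤ 0 ∨ y ^ 2 + p.2.2 ^ 2 ≤ 1) →
      y ^ 2 + p.2.2 ^ 2 ≤ 1 := by
    rintro y hy (h | h)
    · rw [← hτp, le_antisymm h hτ]
      simpa using hy
    · exact h
  rcases h with h | h | h | h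
  · linarith [h.2.2]
  · rw [le_antisymm h.2 hτ] at hτp
    exact box_not_arc hp ((pow_eq_zero_iff two_ne_zero).1 (by linarith)) h.1
  · rcases h3 with ⟨rfl, -⟩ | ⟨rfl, h3, -⟩
    · exact hc ⟨h.1, hshadow _ h.2.1 h.2.2⟩
    · linarith [(abs_le.1 h.1).2]
  · rcases h3 with ⟨rfl, -, h3⟩ | ⟨rfl, -⟩
    · linarith [(abs_le.1 h.2.1).1]
    · exact hc ⟨h.1, hshadow _ h.2.1 h.2.2⟩

theorem isBoxFrame_twists (n : ℤ) (k : Bool) :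
    IsBoxFrame (twists n k) ((boxChart k).symm ⁻¹' upSet) ((boxChart k).symm ⁻¹' downSet) where
  isOpen_up := isOpen_upSet.preimage (boxChart k).symm.continuous
  isOpen_down := isOpen_downSet.preimage (boxChart k).symm.continuous
  up_core p hp hc := not_upSet_of_core (k := k) (by simpa using hc) hp
  down_core p hp hc := not_downSet_of_core (k := k) (by simpa using hc) hp
  up_mem p hp hc hz := not_hidden_of_box (n := n) (k := k) (p := (boxChart k).symm p)
    (by simpa using hp) (by simpa using hc) (by cases k <;> exact hz) rfl
  down_mem p hp hc hz := not_hidden_of_box (n := n) (k := k) (p := (boxChart k).symm p)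
    (by simpa using hp) (by simpa using hc) (by cases k <;> exact neg_nonneg.2 hz) (neg_sq _)

/-! ### The cover of the complement -/

/-- The names of the pieces of the complement of the knot. -/
inductive Piece
  | up
  | down
  | outer
  | box (k : Bool)

/-- The finite part of a piece. -/
def pieceSet (n : ℤ) : Piece → Set R3
  | Piece.up => upSet
  | Piece.down => downSet
  | Piece.outer => farSet
  | Piece.box k => boxChart k ⁻¹' twistBox (twists n k)

/-- The open cover of the complement of the knot. -/
def piece (n : ℤ) : Piece → Set S3
  | Piece.outer => outside R3 5
  | i => (↑) '' pieceSet n i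

theorem coe_mem_piece {n : ℤ} {i : Piece} {p : R3} : (p : S3) ∈ piece n i ↔ p ∈ pieceSet n i := by
  cases i <;> simp [piece, pieceSet, farSet]

theorem infty_mem_piece {n : ℤ} {i : Piece} :
    (OnePoint.infty : S3) ∈ piece n i ↔ i = Piece.outer := by
  cases i <;> simp [piece]

theorem isOpen_pieceSet (n : ℤ) (i : Piece) : IsOpen (pieceSet n i) := by
  cases i with
  | up => exact isOpen_upSet
  | down => exact isOpen_downSet
  | outer => exact isOpen_farSet
  | box k => exact (isOpen_twistBox _).preimage (boxChart k).continuous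

theorem isOpen_piece (n : ℤ) (i : Piece) : IsOpen (piece n i) := by
  cases i with
  | outer => exact isOpen_outside 5
  | up => exact OnePoint.isOpenEmbedding_coe.isOpenMap _ (isOpen_pieceSet n _)
  | down => exact OnePoint.isOpenEmbedding_coe.isOpenMap _ (isOpen_pieceSet n _)
  | box k => exact OnePoint.isOpenEmbedding_coe.isOpenMap _ (isOpen_pieceSet n _)

theorem isSimplyConnected_piece (n : ℤ) (i : Piece) : IsSimplyConnected (piece n i) := by
  have h : ∀ S : Set R3, IsSimplyConnected S → IsSimplyConnected ((↑) '' S : Set S3) := fun S hS =>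
    (OnePoint.isOpenEmbedding_coe.isEmbedding.isSimplyConnected_image).2 hS
  cases i with
  | outer => exact isSimplyConnected_outside (by norm_num)
  | up => exact h _ isSimplyConnected_upSet
  | down => exact h _ isSimplyConnected_downSet
  | box k =>
    refine h _ ?_
    rw [pieceSet, ← (boxChart k).isEmbedding.isSimplyConnected_image,
      image_preimage_eq _ (boxChart k).surjective]
    exact isSimplyConnected_twistBox _

theorem knotSet_bounds {n : ℤ} {p : R3} (hp : p ∈ knotSet n) : p ∉ upSet ∧ p ∉ downSet := by
  rcases mem_knotSet_iff.1 hp with h | ⟨k, h⟩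
  · refine ⟨fun h' => h' (Or.inl (Or.inr ⟨h.2, h.1.le⟩)),
      fun h' => h' (Or.inl (Or.inr ⟨h.2, ?_⟩))⟩
    simp [reflect, h.1]
  · have hc : boxChart k p ∈ twistCore := ⟨h.1, h.2.1.le⟩
    exact ⟨not_upSet_of_core hc, not_downSet_of_core hc⟩

/-- Points invisible from both sides lie on the arcs or in a core, and a core without its strands
lies in its box. Conversely the knot is hidden from both sides and lies on the removed surfaces. -/
theorem mem_compl_knotSet_iff {n : ℤ} {p : R3} : p ∉ knotSet n ↔ ∃ i, p ∈ pieceSet n i := by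
  constructor
  · intro h
    rw [mem_knotSet_iff, not_or, not_exists] at h
    by_cases hu : p ∈ upSet
    · exact ⟨Piece.up, hu⟩
    by_cases hd : p ∈ downSet
    · exact ⟨Piece.down, hd⟩
    rcases hidden_inter_reflect hu hd with h' | h' | h'
    · exact absurd h' h.1
    · exact ⟨Piece.box false, mem_twistBox_of_core h' (h.2 _)⟩
    · exact ⟨Piece.box true, mem_twistBox_of_core h' (h.2 _)⟩
  · rintro ⟨i, hi⟩ h
    obtain ⟨hu, hd⟩ := knotSet_bounds h
    cases i with
    | up => exact hu hi
    | down => exact hd hi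
    | outer =>
      rcases far_cases hi with h' | h'
      · exact hu (outerFace_subset h')
      · rcases lt_abs.1 h' with h' | h'
        · exact hu (upSet_of_one_lt (by linarith))
        · refine hd (upSet_of_one_lt ?_)
          simp only [reflect]
          linarith
    | box k =>
      rcases mem_knotSet_iff.1 h with h' | ⟨j, h'⟩
      · exact box_not_arc hi h'.1 h'.2
      · have hc : boxChart j p ∈ twistCore := ⟨h'.1, h'.2.1.le⟩
        by_cases hjk : j = k
        · subst hjk
          exact not_mem_twistBox_of_strands h' hi
        · rcases (box_bounds hi).2.2 with ⟨rfl, h1, h2⟩ | ⟨rfl, h1, h2⟩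
          · obtain rfl : j = true := by simpa using hjk
            have h3 : (p.1 - 2) ^ 2 + p.2.2 ^ 2 ≤ 1 := hc.2
            nlinarith [sq_nonneg p.2.2]
          · obtain rfl : j = false := by simpa using hjk
            have h3 : |p.1 + 2| ≤ 1 := hc.1
            linarith [(abs_le.1 h3).2]

theorem mem_compl_conwayModel_iff {n : ℤ} {x : S3} :
    x ∈ (conwayModel (2 * n) 3)ᶜ ↔ ∃ i, x ∈ piece n i := by
  induction x using OnePoint.rec with
  | infty => simp [conwayModel, infty_mem_piece]
  | coe p =>
    simp only [coe_mem_piece, ← mem_compl_knotSet_iff, mem_compl_iff, conwayModel, not_iff_not]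
    constructor
    · rintro ⟨q, hq, h⟩
      rwa [← OnePoint.coe_injective h]
    · exact fun h => ⟨p, h, rfl⟩

/-! ### Face values -/

section Face

variable {G : Type*} [Group G]

open Classical in
/-- The locally constant function with given values on the bounded faces. -/
noncomputable def faceValue (T B M : G) (p : R3) : G :=
  if p ∈ topFace then T else if p ∈ bottomFace then B else if p ∈ middleFace then M else 1

theorem faceValue_top (T B M : G) {p : R3} (hp : p ∈ topFace) : faceValue T B M p = T := if_pos hp

theorem faceValue_bottom (T B M : G) {p : R3} (hp : p ∈ bottomFace) : faceValue T B M p = B := by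
  have h : p ∉ topFace := fun h => by linarith [h.2.1.1, hp.2.1.2]
  rw [faceValue, if_neg h, if_pos hp]

theorem faceValue_middle (T B M : G) {p : R3} (hp : p ∈ middleFace) : faceValue T B M p = M := by
  have h : p ∉ topFace := fun h => by linarith [h.2.1.1, hp.2.1.2]
  have h' : p ∉ bottomFace := fun h => by linarith [h.2.1.2, hp.2.1.1]
  rw [faceValue, if_neg h, if_neg h', if_pos hp]

theorem faceValue_outer (T B M : G) {p : R3} (hp : p ∈ outerFace) : faceValue T B M p = 1 := by
  have h1 : p ∉ topFace := fun h => by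
    rcases hp with hp | hp
    · exact absurd (abs_lt.2 h.1) (by linarith)
    · exact absurd (abs_lt.2 ⟨by linarith [h.2.1.1], h.2.1.2⟩ : |p.2.1| < 2) (by linarith)
  have h2 : p ∉ bottomFace := fun h => by
    rcases hp with hp | hp
    · exact absurd (abs_lt.2 h.1) (by linarith)
    · exact absurd (abs_lt.2 ⟨h.2.1.1, by linarith [h.2.1.2]⟩ : |p.2.1| < 2) (by linarith)
  have h3 : p ∉ middleFace := fun h => by
    rcases hp with hp | hp
    · exact absurd (abs_lt.2 h.1) (by linarith)
    · exact absurd (abs_lt.2 h.2.1) (by linarith)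
  rw [faceValue, if_neg h1, if_neg h2, if_neg h3]

theorem faceValue_far (T B M : G) {p : R3} (hp : p ∈ farSet) : faceValue T B M p = 1 := by
  rw [faceValue, if_neg fun h => not_far_of_face (Or.inl h) hp,
    if_neg fun h => not_far_of_face (Or.inr (Or.inl h)) hp,
    if_neg fun h => not_far_of_face (Or.inr (Or.inr h)) hp]

theorem eventually_faceValue_eq (T B M : G) {p : R3} (hu : p ∈ upSet) (hd : p ∈ downSet) :
    ∀ᶠ q in 𝓝 p, faceValue T B M q = faceValue T B M p := by
  rcases face_of_mem hu hd with h | h | h | h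
  · filter_upwards [isOpen_outerFace.mem_nhds h] with q hq
    rw [faceValue_outer T B M h, faceValue_outer T B M hq]
  · filter_upwards [isOpen_topFace.mem_nhds h] with q hq
    rw [faceValue_top T B M h, faceValue_top T B M hq]
  · filter_upwards [isOpen_bottomFace.mem_nhds h] with q hq
    rw [faceValue_bottom T B M h, faceValue_bottom T B M hq]
  · filter_upwards [isOpen_middleFace.mem_nhds h] with q hq
    rw [faceValue_middle T B M h, faceValue_middle T B M hq]

/-- The values of the four faces around the twist regions. -/
def boxFaces (T B M : G) : Bool → G × G × G × G
  | false => (T, B, 1, M)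
  | true => (1, M, B, T)

theorem isFaceFunction_faceValue (T B M : G) (k : Bool) :
    IsFaceFunction ((boxChart k).symm ⁻¹' upSet) ((boxChart k).symm ⁻¹' downSet)
      (faceValue T B M ∘ (boxChart k).symm) (boxFaces T B M k).1 (boxFaces T B M k).2.1
      (boxFaces T B M k).2.2.1 (boxFaces T B M k).2.2.2 where
  eventually_eq p hp := (boxChart k).symm.continuous.continuousAt.eventually
    (eventually_faceValue_eq T B M hp.1 hp.2)
  pos p h1 h2 h3 h4 := by
    rw [abs_lt] at h1
    cases k
    · exact faceValue_top T B M ⟨⟨by simp; linarith, by simp; linarith⟩, ⟨h2, h3⟩, by simp [h4]⟩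
    · exact faceValue_outer T B M (Or.inl (lt_abs.2 (Or.inl (by simp; linarith))))
  neg p h1 h2 h3 h4 := by
    cases k
    · rw [abs_lt] at h1
      exact faceValue_bottom T B M
        ⟨⟨by simp; linarith, by simp; linarith⟩, ⟨h3, h2⟩, by simp [h4]⟩
    · exact faceValue_middle T B M
        ⟨⟨by simp; linarith, by simp; linarith⟩, abs_lt.1 h1, by simp [h4]⟩
  left p h1 h2 h3 h4 := by
    cases k
    · exact faceValue_outer T B M (Or.inl (lt_abs.2 (Or.inr (by simp; linarith))))
    · rw [abs_lt] at h3
      exact faceValue_bottom T B M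
        ⟨⟨by simp; linarith, by simp; linarith⟩, ⟨h2, h1⟩, by simp [h4]⟩
  right p h1 h2 h3 h4 := by
    cases k
    · exact faceValue_middle T B M
        ⟨⟨by simp; linarith, by simp; linarith⟩, abs_lt.1 h3, by simp [h4]⟩
    · rw [abs_lt] at h3
      exact faceValue_top T B M ⟨⟨by simp; linarith, by simp; linarith⟩, ⟨h1, h2⟩, by simp [h4]⟩

end Face

/-- The overlaps worth studying are `up` with `down` and each remaining piece with these two. The
list is used both for the local constancy of the standard cocycle and for its universality. -/
theorem Piece.pair_induction {Q : Piece → Piece → Prop} (refl : ∀ i, Q i i)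
    (symm : ∀ i j, Q i j → Q j i) (up_down : Q Piece.up Piece.down)
    (outer_up : Q Piece.outer Piece.up) (outer_down : Q Piece.outer Piece.down)
    (box_up : ∀ k, Q (Piece.box k) Piece.up) (box_down : ∀ k, Q (Piece.box k) Piece.down)
    (box_outer : ∀ k, Q (Piece.box k) Piece.outer)
    (box_box : ∀ j k, j ≠ k → Q (Piece.box j) (Piece.box k)) (i j : Piece) : Q i j := by
  rcases i with _ | _ | _ | k <;> rcases j with _ | _ | _ | j
  · exact refl _
  · exact up_down
  · exact symm _ _ outer_up
  · exact symm _ _ (box_up j)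
  · exact symm _ _ up_down
  · exact refl _
  · exact symm _ _ outer_down
  · exact symm _ _ (box_down j)
  · exact outer_up
  · exact outer_down
  · exact refl _
  · exact symm _ _ (box_outer j)
  · exact box_up k
  · exact box_down k
  · exact box_outer k
  · by_cases h : k = j
    · exact h ▸ refl _
    · exact box_box k j h

theorem map_faceValue {G H : Type*} [Group G] [Group H] (f : G →* H) (T B M : G) (p : R3) :
    f (faceValue T B M p) = faceValue (f T) (f B) (f M) p := by
  unfold faceValue
  split_ifs <;> simp

/-! ### Cocycles on the cover as systems of face values -/

/-- The relations between face values imposed by the two twist regions. -/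
def IsFaceSystem {G : Type*} [Group G] (n : ℤ) (T B M : G) : Prop :=
  ∀ k, BoxRelation (boxFaces T B M k).1 (boxFaces T B M k).2.1 (boxFaces T B M k).2.2.1
    (boxFaces T B M k).2.2.2 (twists n k)

section Local

variable {H : Type*} {n : ℤ} {d : Piece → Piece → S3 → H}

theorem pieceSet_const (hd : ∀ i j x y, JoinedIn (piece n i ∩ piece n j) x y → d i j x = d i j y)
    {i j : Piece} {W : Set R3} (hW : IsPathConnected W) (hWi : W ⊆ pieceSet n i ∩ pieceSet n j)
    {p q : R3} (hp : p ∈ W) (hq : q ∈ W) : d i j p = d i j q := by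
  refine hd i j _ _ (((hW.image OnePoint.continuous_coe).joinedIn p ⟨p, hp, rfl⟩ q
    ⟨q, hq, rfl⟩).mono ?_)
  rintro _ ⟨v, hv, rfl⟩
  exact ⟨coe_mem_piece.2 (hWi hv).1, coe_mem_piece.2 (hWi hv).2⟩

theorem pieceSet_eventually_eq
    (hd : ∀ i j x y, JoinedIn (piece n i ∩ piece n j) x y → d i j x = d i j y)
    {i j : Piece} {p : R3} (hp : p ∈ pieceSet n i ∩ pieceSet n j) :
    ∀ᶠ q : R3 in 𝓝 p, d i j q = d i j p := by
  obtain ⟨ε, hε, h⟩ := Metric.isOpen_iff.1 ((isOpen_pieceSet n i).inter (isOpen_pieceSet n j)) p hp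
  filter_upwards [Metric.ball_mem_nhds p hε] with q hq
  exact pieceSet_const hd ((convex_ball p ε).isPathConnected ⟨p, Metric.mem_ball_self hε⟩) h hq
    (Metric.mem_ball_self hε)

end Local

/-- Every cocycle on the cover, constant along paths, comes from face values satisfying the two
relations. -/
theorem exists_faceSystem {H : Type*} [Group H] {n : ℤ} {d : Piece → Piece → S3 → H}
    (hc : IsCocycle (piece n) d)
    (hd : ∀ i j x y, JoinedIn (piece n i ∩ piece n j) x y → d i j x = d i j y) :
    ∃ (T B M : H) (h : Piece → H), IsFaceSystem n T B M ∧ h Piece.up = 1 ∧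
      (∀ p ∈ upSet ∩ downSet, d Piece.up Piece.down (p : R3) =
        faceValue T B M p * (h Piece.down)⁻¹) ∧
      (∀ p ∈ farSet ∩ upSet, d Piece.outer Piece.up (p : R3) = h Piece.outer) ∧
      (∀ p ∈ farSet ∩ downSet, d Piece.outer Piece.down (p : R3) =
        h Piece.outer * (h Piece.down)⁻¹) ∧
      ∀ k, (∀ q ∈ twistBox (twists n k) ∩ (boxChart k).symm ⁻¹' upSet, 0 < q.2.2 →
          d (Piece.box k) Piece.up ((boxChart k).symm q : R3) = h (Piece.box k) *
            boxValue (boxFaces T B M k).1 (boxFaces T B M k).2.1 (boxFaces T B M k).2.2.1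
              (twists n k) q) ∧
        ∀ q ∈ twistBox (twists n k) ∩ (boxChart k).symm ⁻¹' downSet, q.2.2 < 0 →
          d (Piece.box k) Piece.down ((boxChart k).symm q : R3) * h Piece.down = h (Piece.box k) *
            boxValue (boxFaces T B M k).1 (boxFaces T B M k).2.1 (boxFaces T B M k).2.2.1
              (twists n k) q := by
  have hcoc : ∀ i j k, ∀ p : R3, p ∈ pieceSet n i → p ∈ pieceSet n j → p ∈ pieceSet n k →
      d i j p * d j k p = d i k p := fun i j k p hi hj hk =>
    hc i j k p (coe_mem_piece.2 hi) (coe_mem_piece.2 hj) (coe_mem_piece.2 hk)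
  let p₀ : R3 := (10, 0, 0)
  have hO₀ : p₀ ∈ outerFace := Or.inl (by norm_num [p₀])
  have hud₀ := outerFace_subset_inter hO₀
  have hf₀ : p₀ ∈ farSet := mem_farSet.2 (Or.inl (by norm_num [p₀]))
  -- The change of trivialisation on `down` that gives the outer face the value 1; below it is also
  -- applied to the transitions from the boxes to `down`.
  let g : H := (d Piece.up Piece.down p₀)⁻¹
  let F : R3 → H := fun p => d Piece.up Piece.down p * g
  let T := F (0, 3 / 2, 0)
  let B := F (0, -3 / 2, 0)
  let M := F (0, 0, 0)
  have hface : ∀ p ∈ upSet ∩ downSet, F p = faceValue T B M p := by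
    intro p hp
    have key : ∀ {W : Set R3} (_ : IsPathConnected W) (_ : W ⊆ upSet ∩ downSet) {p q : R3},
        p ∈ W → q ∈ W → F p = F q := fun hW hWi p q hp hq =>
      congrArg (· * g) (pieceSet_const hd (i := Piece.up) (j := Piece.down) hW hWi hp hq)
    rcases face_of_mem hp.1 hp.2 with h | h | h | h
    · rw [faceValue_outer T B M h, key isPathConnected_outerFace outerFace_subset_inter h hO₀]
      exact mul_inv_cancel _
    · rw [faceValue_top T B M h]
      exact key isPathConnected_topFace topFace_subset_inter h (by norm_num [topFace])
    · rw [faceValue_bottom T B M h]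
      exact key isPathConnected_bottomFace bottomFace_subset_inter h (by norm_num [bottomFace])
    · rw [faceValue_middle T B M h]
      exact key isPathConnected_middleFace middleFace_subset_inter h (by norm_num [middleFace])
  have hbox : ∀ k, _ := fun k => (isBoxFrame_twists n k).exists_eq_mul_boxValue
    (isFaceFunction_faceValue T B M k)
    (dp := fun q => d (Piece.box k) Piece.up ((boxChart k).symm q : R3))
    (dm := fun q => d (Piece.box k) Piece.down ((boxChart k).symm q : R3) * g)
    (fun q hq => (boxChart k).symm.continuous.continuousAt.eventually
      (pieceSet_eventually_eq hd (i := Piece.box k) (j := Piece.up)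
        ⟨by simpa [pieceSet] using hq.1, hq.2⟩))
    (fun q hq => ((boxChart k).symm.continuous.continuousAt.eventually
      (pieceSet_eventually_eq hd (i := Piece.box k) (j := Piece.down)
        ⟨by simpa [pieceSet] using hq.1, hq.2⟩)).mono fun q hq => congrArg (· * g) hq)
    (fun q hq hu hdn => by
      have h1 := hcoc (Piece.box k) Piece.up Piece.down ((boxChart k).symm q)
        (by simpa [pieceSet] using hq) hu hdn
      rw [Function.comp_apply, ← hface _ ⟨hu, hdn⟩, ← mul_assoc, h1])
  choose hrel hk hup hdown using hbox
  refine ⟨T, B, M, fun i => match i with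
    | Piece.up => 1
    | Piece.down => g
    | Piece.outer => d Piece.outer Piece.up p₀
    | Piece.box k => hk k, hrel, rfl, ?_, ?_, ?_, fun k => ⟨hup k, hdown k⟩⟩
  · intro p hp
    rw [← hface p hp]
    exact (mul_inv_cancel_right _ _).symm
  · intro p hp
    have := isPathConnected_far_inter_upSet
    rw [inter_comm] at this
    exact pieceSet_const hd (i := Piece.outer) (j := Piece.up) this subset_rfl hp ⟨hf₀, hud₀.1⟩
  · intro p hp
    have := isPathConnected_far_inter_downSet
    rw [inter_comm] at this
    rw [pieceSet_const hd (i := Piece.outer) (j := Piece.down) this subset_rfl hp ⟨hf₀, hud₀.2⟩]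
    simp only [g, inv_inv]
    exact (hcoc Piece.outer Piece.up Piece.down p₀ hf₀ hud₀.1 hud₀.2).symm

/-- The fundamental group of the complement of the standard diagram `C(2n, 3)` is the universal
group with a system of face values. -/
theorem nonempty_mulEquiv_of_faceSystem {G : Type*} [Group G] {n : ℤ} {T B M : G}
    (hrel : IsFaceSystem n T B M) (hgen : Subgroup.closure {T, B, M} = ⊤)
    (huniv : ∀ (H : Type) [Group H] (T' B' M' : H), IsFaceSystem n T' B' M' →
      ∃ f : G →* H, f T = T' ∧ f B = B' ∧ f M = M')
    (x : ↥((conwayModel (2 * n) 3)ᶜ)) :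
    Nonempty (FundamentalGroup ↥((conwayModel (2 * n) 3)ᶜ) x ≃* G) := by
  have hglue : ∀ k, _ := fun k => (isBoxFrame_twists n k).exists_glue
    (isFaceFunction_faceValue T B M k) (isOpen_twistBox _) subset_rfl fun _ _ _ _ => hrel k
  choose cp cm hcp hcm hcF hcp' hcm' using hglue
  -- Formally `c` is the coboundary of `b`, so the cocycle identity is automatic. It is not trivial
  -- as a locally constant cocycle: `b` is not locally constant, only its quotients on overlaps are.
  -- The default value 1 at infinity is harmless, since only `outer` contains that point.
  let b : Piece → R3 → G := fun i p => match i with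
    | Piece.up => 1
    | Piece.down => (faceValue T B M p)⁻¹
    | Piece.outer => 1
    | Piece.box k => cp k (boxChart k p)
  let c : Piece → Piece → S3 → G := fun i j x =>
    x.elim 1 (b i) * (x.elim 1 (b j))⁻¹
  have hc_coe : ∀ i j (p : R3), c i j p = b i p * (b j p)⁻¹ := fun i j p => rfl
  have hcoc : IsCocycle (piece n) c := fun i j k x _ _ _ => by simp [c]
  have hcF' : ∀ k (p : R3), cp k (boxChart k p) * faceValue T B M p = cm k (boxChart k p) := by
    intro k p
    simpa using hcF k (boxChart k p)
  have hloc : ∀ i j, ∀ p ∈ pieceSet n i ∩ pieceSet n j,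
      ∀ᶠ q in 𝓝 p, b i q * (b j q)⁻¹ = b i p * (b j p)⁻¹ := by
    refine Piece.pair_induction ?_ ?_ ?_ ?_ ?_ ?_ ?_ ?_ ?_
    · intro i p _
      simp
    · intro i j h p hp
      filter_upwards [h p hp.symm] with q hq
      simpa using congrArg (·⁻¹) hq
    · intro p hp
      simpa [b] using eventually_faceValue_eq T B M hp.1 hp.2
    · intro p hp
      simp [b]
    · intro p hp
      filter_upwards [isOpen_farSet.mem_nhds hp.1] with q hq
      simp only [b, faceValue_far T B M hq, faceValue_far T B M hp.1]
    · intro k p hp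
      simpa [b] using (boxChart k).continuous.continuousAt.eventually
        (hcp k (boxChart k p) ⟨hp.1, by simpa [pieceSet] using hp.2⟩)
    · intro k p hp
      simpa [b, hcF'] using (boxChart k).continuous.continuousAt.eventually
        (hcm k (boxChart k p) ⟨hp.1, by simpa [pieceSet] using hp.2⟩)
    · intro k p hp
      exact absurd hp.2 (box_not_far hp.1)
    · intro j k hjk p hp
      exact absurd hp.2 (box_disjoint hjk hp.1)
  have hmem : ∀ i j (p : R3), p ∈ pieceSet n i → p ∈ pieceSet n j →
      (p : S3) ∈ piece n i ∩ piece n j := fun i j p hi hj =>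
    ⟨coe_mem_piece.2 hi, coe_mem_piece.2 hj⟩
  have hO : ((10, 0, 0) : R3) ∈ outerFace := Or.inl (by norm_num)
  refine nonempty_fundamentalGroup_mulEquiv_of_cover (isOpen_piece n)
    (fun x => mem_compl_conwayModel_iff) (isSimplyConnected_piece n) hcoc ?_ Piece.up ?_ ?_ ?_ x
  · intro i j x hx
    induction x using OnePoint.rec with
    | infty =>
      obtain rfl := infty_mem_piece.1 hx.1
      obtain rfl := infty_mem_piece.1 hx.2
      simp [c]
    | coe p =>
      rw [OnePoint.nhds_coe_eq, eventually_map]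
      exact hloc i j p ⟨coe_mem_piece.1 hx.1, coe_mem_piece.1 hx.2⟩
  · intro j
    have hu := outerFace_subset_inter hO
    cases j with
    | up => exact ⟨_, hmem _ _ _ hu.1 hu.1⟩
    | down => exact ⟨_, hmem _ _ _ hu.1 hu.2⟩
    | outer => exact ⟨_, hmem _ _ _ hu.1 (mem_farSet.2 (Or.inl (by norm_num)))⟩
    | box k =>
      have h1 : ((3 / 2, 0, 1 / 2) : R3) ∈ twistBox (twists n k) :=
        ⟨by norm_num [abs_lt], by norm_num, fun h => by norm_num at h⟩
      have h2 : ((3 / 2, 0, 1 / 2) : R3) ∉ twistCore := fun h => by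
        have := h.1
        norm_num [abs_le] at this
      exact ⟨_, hmem _ _ ((boxChart k).symm (3 / 2, 0, 1 / 2))
        ((isBoxFrame_twists n k).up_mem _ h1 h2 (by norm_num)) (by simpa [pieceSet] using h1)⟩
  · rw [← top_le_iff, ← hgen]
    refine Subgroup.closure_mono ?_
    -- A transition through `down` that starts in the outer face, where the value is 1, realises
    -- every other face value.
    have key : ∀ p ∈ upSet ∩ downSet, faceValue T B M p ∈
        {g | ∃ j, ∃ x ∈ piece n Piece.up ∩ piece n j, ∃ y ∈ piece n Piece.up ∩ piece n j,
          g = c Piece.up j y * (c Piece.up j x)⁻¹} := by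
      intro p hp
      refine ⟨Piece.down, _, hmem _ _ _ (outerFace_subset_inter hO).1
        (outerFace_subset_inter hO).2, p, hmem _ _ _ hp.1 hp.2, ?_⟩
      simp [hc_coe, b, faceValue_outer T B M hO]
    have hT : ((0, 3 / 2, 0) : R3) ∈ topFace := by norm_num [topFace]
    have hB : ((0, -3 / 2, 0) : R3) ∈ bottomFace := by norm_num [bottomFace]
    have hM : ((0, 0, 0) : R3) ∈ middleFace := by norm_num [middleFace]
    rintro g (rfl | rfl | rfl)
    · simpa only [faceValue_top _ _ _ hT] using key _ (topFace_subset_inter hT)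
    · simpa only [faceValue_bottom _ _ _ hB] using key _ (bottomFace_subset_inter hB)
    · simpa only [faceValue_middle _ _ _ hM] using key _ (middleFace_subset_inter hM)
  · intro H _ d hd hdj
    obtain ⟨T', B', M', h, hsys, h_up, h_ud, h_ou, h_od, h_box⟩ := exists_faceSystem hd hdj
    obtain ⟨f, rfl, rfl, rfl⟩ := huniv H T' B' M' hsys
    have hfaces : ∀ k, boxFaces (f T) (f B) (f M) k = (f (boxFaces T B M k).1,
        f (boxFaces T B M k).2.1, f (boxFaces T B M k).2.2.1, f (boxFaces T B M k).2.2.2) := by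
      intro k
      cases k <;> simp [boxFaces]
    simp only [hfaces] at h_box
    have hcmp : ∀ k, _ := fun k => (isBoxFrame_twists n k).exists_eq_mul_map f
      (F := faceValue T B M ∘ (boxChart k).symm)
      (F' := faceValue (f T) (f B) (f M) ∘ (boxChart k).symm)
      (fun p _ => (map_faceValue f T B M _).symm) (hcp k) (hcF k) (hcp' k) (hcm' k)
      (dp := fun q => d (Piece.box k) Piece.up ((boxChart k).symm q : R3))
      (dm := fun q => d (Piece.box k) Piece.down ((boxChart k).symm q : R3) * h Piece.down)
      (fun q hq => (boxChart k).symm.continuous.continuousAt.eventually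
        (pieceSet_eventually_eq hdj (i := Piece.box k) (j := Piece.up)
          ⟨by simpa [pieceSet] using hq.1, hq.2⟩))
      (fun q hq hu hdn => by
        have h1 := hd (Piece.box k) Piece.up Piece.down ((boxChart k).symm q : R3)
          (coe_mem_piece.2 (by simpa [pieceSet] using hq)) (coe_mem_piece.2 hu)
          (coe_mem_piece.2 hdn)
        rw [h_ud _ ⟨hu, hdn⟩, ← mul_assoc] at h1
        rw [Function.comp_apply, ← h1, inv_mul_cancel_right]) (h_box k).1 (h_box k).2
    refine ⟨f, h, ?_⟩
    have main : ∀ i j, ∀ p ∈ pieceSet n i ∩ pieceSet n j,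
        d i j (p : R3) = h i * f (b i p * (b j p)⁻¹) * (h j)⁻¹ := by
      refine Piece.pair_induction ?_ ?_ ?_ ?_ ?_ ?_ ?_ ?_ ?_
      · intro i p hp
        rw [hd.self (coe_mem_piece.2 hp.1)]
        simp
      · intro i j h1 p hp
        rw [← hd.inv (coe_mem_piece.2 hp.2) (coe_mem_piece.2 hp.1), h1 p hp.symm]
        simp [mul_assoc]
      · intro p hp
        rw [h_ud p hp]
        simp [b, h_up, map_faceValue]
      · intro p hp
        rw [h_ou p hp]
        simp [b, h_up]
      · intro p hp
        rw [h_od p hp]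
        simp [b, faceValue_far T B M hp.1]
      · intro k p hp
        have := (hcmp k).1 (boxChart k p) ⟨hp.1, by simpa [pieceSet] using hp.2⟩
        simpa [b, h_up] using this
      · intro k p hp
        have := (hcmp k).2 (boxChart k p) ⟨hp.1, by simpa [pieceSet] using hp.2⟩
        rw [eq_mul_inv_iff_mul_eq]
        simpa [b, hcF'] using this
      · intro k p hp
        exact absurd hp.2 (box_not_far hp.1)
      · intro j k hjk p hp
        exact absurd hp.2 (box_disjoint hjk hp.1)
    intro i j x hx
    induction x using OnePoint.rec with
    | infty =>
      obtain rfl := infty_mem_piece.1 hx.1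
      obtain rfl := infty_mem_piece.1 hx.2
      rw [hd.self hx.1]
      simp [c]
    | coe p => exact main i j p ⟨coe_mem_piece.1 hx.1, coe_mem_piece.1 hx.2⟩

/-! ### The presentation with two generators -/

section Presentation

variable {H : Type*} [Group H]

/-- The images of the two generators. -/
def genMap (σ τ : H) : Gen → H
  | Gen.s => σ
  | Gen.t => τ

theorem lift_relator (σ τ : H) (n : ℤ) : FreeGroup.lift (genMap σ τ) (relator n) =
    σ * (τ * σ⁻¹ * τ * σ * τ⁻¹ * σ) ^ n * τ⁻¹ * ((τ * σ⁻¹ * τ * σ * τ⁻¹ * σ) ^ n)⁻¹ := by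
  simp [relator, w, s, t, genMap]

/-- The face values of the diagram in terms of the generators: the bottom face is determined by the
vertical twist region, and the horizontal one gives the relator. -/
theorem isFaceSystem_iff {n : ℤ} {T B M : H} : IsFaceSystem n T B M ↔
    B = M * M * T⁻¹ * M⁻¹ ∧ FreeGroup.lift (genMap T⁻¹ (T⁻¹ * M)) (relator n) = 1 := by
  have h1 : IsFaceSystem n T B M ↔
      (B * T⁻¹) ^ n * M = T⁻¹ * ((B * T⁻¹) ^ n * T) ∧ B * M * T = M * M := by
    rw [IsFaceSystem, Bool.forall_bool]
    refine and_congr ?_ ?_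
    · simp only [BoxRelation, boxFaces, twists, if_pos (even_two_mul n),
        turnValue_sub_one_of_even _ _ (even_two_mul n), turnValue_even, one_mul]
    · have h3 : ¬ Even (3 : ℤ) := by decide
      have e2 : turnValue (1 : H) M (3 - 1) = M := by
        have := turnValue_even (1 : H) M 1
        simpa using this
      have e3 : turnValue (1 : H) M 3 = M * M := by
        have := turnValue_odd (1 : H) M 1
        simpa using this
      simp only [BoxRelation, boxFaces, twists, if_neg h3, e2, e3, inv_one, mul_one]
  have h2 : B * M * T = M * M ↔ B = M * M * T⁻¹ * M⁻¹ := by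
    rw [eq_mul_inv_iff_mul_eq, eq_mul_inv_iff_mul_eq]
  rw [h1, h2, and_comm]
  refine and_congr_right fun hB => ?_
  obtain ⟨σ, rfl⟩ : ∃ σ, T = σ⁻¹ := ⟨T⁻¹, (inv_inv T).symm⟩
  obtain ⟨τ, rfl⟩ : ∃ τ, M = σ⁻¹ * τ := ⟨σ * M, by group⟩
  -- Once `B` is eliminated, the base of the powers in the horizontal relation is a conjugate of the
  -- base of `w`. Taking `n`-th powers and cancelling the conjugation leaves `s w = w t`.
  have hconj : B * σ⁻¹⁻¹ = σ⁻¹ * (τ * σ⁻¹ * τ * σ * τ⁻¹ * σ) * σ⁻¹⁻¹ := by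
    rw [hB]; group
  rw [hconj, conj_zpow, lift_relator]
  simp only [inv_inv, mul_inv_cancel_left]
  generalize (τ * σ⁻¹ * τ * σ * τ⁻¹ * σ) ^ n = v
  rw [mul_inv_eq_one, mul_inv_eq_iff_eq_mul]
  constructor
  · intro h
    have : σ * (σ⁻¹ * v * σ * (σ⁻¹ * τ)) = σ * (σ * (σ⁻¹ * v * σ * σ⁻¹)) := by rw [h]
    simpa [mul_assoc] using this.symm
  · intro h
    simp only [mul_assoc, mul_inv_cancel_left, mul_inv_cancel, mul_one]
    rw [← h]
    group

end Presentation

/-- A system of face values amounts to a pair of elements satisfying the relator, since `B` is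
determined by the other two. Hence the presented group carries the universal system. -/
theorem nonempty_mulEquiv_knotGroup (n : ℤ) (x : ↥((conwayModel (2 * n) 3)ᶜ)) :
    Nonempty (FundamentalGroup ↥((conwayModel (2 * n) 3)ᶜ) x ≃* knotGroup n) := by
  let σ : knotGroup n := PresentedGroup.of Gen.s
  let τ : knotGroup n := PresentedGroup.of Gen.t
  let M : knotGroup n := σ⁻¹ * τ
  have hlift : FreeGroup.lift (genMap σ τ) = PresentedGroup.mk {relator n} := by
    ext g
    cases g <;> simp [genMap, σ, τ, PresentedGroup.of]
  refine nonempty_mulEquiv_of_faceSystem (T := σ⁻¹) (B := M * M * σ⁻¹⁻¹ * M⁻¹) (M := M) ?_ ?_ ?_ x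
  · refine isFaceSystem_iff.2 ⟨rfl, ?_⟩
    rw [inv_inv, mul_inv_cancel_left, hlift]
    exact PresentedGroup.one_of_mem rfl
  · rw [← top_le_iff, ← PresentedGroup.closure_range_of, Subgroup.closure_le]
    have hσ : σ ∈ Subgroup.closure {σ⁻¹, M * M * σ⁻¹⁻¹ * M⁻¹, M} :=
      inv_mem_iff.1 (Subgroup.subset_closure (by simp))
    rintro _ ⟨g, rfl⟩
    cases g
    · exact hσ
    · have hM : M ∈ Subgroup.closure {σ⁻¹, M * M * σ⁻¹⁻¹ * M⁻¹, M} :=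
        Subgroup.subset_closure (by simp)
      simpa [M] using mul_mem hσ hM
  · intro H _ T B M' hsys
    obtain ⟨rfl, h⟩ := isFaceSystem_iff.1 hsys
    refine ⟨PresentedGroup.toGroup (f := genMap T⁻¹ (T⁻¹ * M')) ?_, ?_⟩
    · rintro r rfl
      exact h
    · simp [M, σ, τ, genMap, mul_assoc]

end TwoBridge

namespace TwoBridge

/-! ### The words read from Schubert's normal form -/

theorem mk_map_range_mul (f : ℕ → Gen × Bool) {c : ℕ} (hf : ∀ k, f (k + c) = f k) (m : ℕ) :
    FreeGroup.mk ((List.range (c * m)).map f) = FreeGroup.mk ((List.range c).map f) ^ m := by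
  have hper : ∀ m k, f (c * m + k) = f k := by
    intro m k
    induction m with
    | zero => simp
    | succ m ih => rw [← ih, ← hf (c * m + k)]; congr 1; ring
  induction m with
  | zero => simp [FreeGroup.one_eq_mk]
  | succ m ih =>
    rw [Nat.mul_succ, List.range_add, List.map_append, ← FreeGroup.mul_mk, ih, pow_succ,
      List.map_map]
    congr 3
    funext k
    exact hper m k

theorem bridge_ne_succ (k : ℕ) : bridge k ≠ bridge (k + 1) := by
  by_cases h : Even k <;> simp [bridge, h, Nat.even_add_one]

/-- The letters of a word read along an underpass alternate, so the word is reduced, together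
with its surroundings. -/
theorem isReduced_bridge_word {m : ℕ} (hm : 0 < m) {f : ℕ → Gen × Bool}
    (hf : ∀ k, (f k).1 = bridge (k + 1)) (b₁ b₂ : Bool) {u : List (Gen × Bool)}
    (hu : u = (List.range (2 * m)).map f) :
    FreeGroup.IsReduced ([(Gen.s, b₁)] ++ u ++ [(Gen.t, b₂)] ++ FreeGroup.invRev u) ∧
      FreeGroup.IsReduced (u ++ [(Gen.t, b₂)] ++ FreeGroup.invRev u ++ [(Gen.s, b₁)]) := by
  have hR : ∀ {l : List (Gen × Bool)}, l.IsChain (fun a b => a.1 ≠ b.1) → FreeGroup.IsReduced l :=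
    fun h => h.imp fun a b hab h' => absurd h' hab
  have hchain : u.IsChain fun a b => a.1 ≠ b.1 := by
    rw [hu, List.isChain_map, List.isChain_range]
    intro k _
    rw [hf, hf]
    exact bridge_ne_succ _
  have hchain' : (FreeGroup.invRev u).IsChain fun a b => a.1 ≠ b.1 := by
    rw [FreeGroup.invRev, List.isChain_reverse, List.isChain_map]
    exact hchain.imp fun a b => Ne.symm
  have hhead : u.head? = some (f 0) := by
    rw [hu, List.head?_map, List.head?_range, if_neg (by omega)]
    rfl
  have hlast : u.getLast? = some (f (2 * m - 1)) := by
    rw [hu, List.getLast?_map, List.getLast?_range, if_neg (by omega)]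
    rfl
  have h0 : (f 0).1 = Gen.t := by simp [hf, bridge]
  have h1 : (f (2 * m - 1)).1 = Gen.s := by
    rw [hf, show 2 * m - 1 + 1 = 2 * m by omega]
    simp [bridge]
  have hhead' : (FreeGroup.invRev u).head? = some ((f (2 * m - 1)).1, !(f (2 * m - 1)).2) := by
    simp [FreeGroup.invRev, hlast]
  have hlast' : (FreeGroup.invRev u).getLast? = some ((f 0).1, !(f 0).2) := by
    simp [FreeGroup.invRev, hhead]
  constructor
  · refine hR ?_
    rw [List.isChain_append, List.isChain_append, List.isChain_append]
    refine ⟨⟨⟨List.isChain_singleton _, hchain, ?_⟩, List.isChain_singleton _, ?_⟩, hchain', ?_⟩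
    · simp [hhead, h0]
    · rw [List.getLast?_append, hlast]
      simp [h1]
    · rw [List.getLast?_append, hhead']
      simp [h1]
  · refine hR ?_
    rw [List.isChain_append, List.isChain_append, List.isChain_append]
    refine ⟨⟨⟨hchain, List.isChain_singleton _, ?_⟩, hchain', ?_⟩, List.isChain_singleton _, ?_⟩
    · simp [hlast, h1]
    · simp [hhead', h1]
    · rw [List.getLast?_append, hlast']
      simp [h0]

theorem toWord_mk_of_isReduced {L : List (Gen × Bool)} (h : FreeGroup.IsReduced L) :
    (FreeGroup.mk L).toWord = L := by
  rw [FreeGroup.toWord_mk]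
  exact h.reduce_eq

/-! ### Floors along the underpass and the resulting words -/

theorem den_div {a b : ℤ} (hb : 0 < b) (hab : IsCoprime a b) : (((a : ℚ) / b).den : ℤ) = b :=
  Rat.den_div_eq_of_coprime hb (Int.isCoprime_iff_nat_coprime.1 hab)

/-- The slope exceeds `2/3` by `1/(3b)`. For `i < b` the accumulated error is less than `1/3`, too
small to reach the next integer from a multiple of `1/3`. -/
theorem floor_mul_div_of_eq_add_one {a b i : ℤ} (hab : 3 * a = 2 * b + 1) (hi : 0 < i)
    (hib : i < b) : ⌊(i : ℚ) * ((a : ℚ) / b)⌋ = 2 * i / 3 := by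
  have hb : (0 : ℚ) < b := by exact_mod_cast hi.trans hib
  rw [mul_div_assoc', Int.floor_eq_iff, le_div_iff₀ hb, div_lt_iff₀ hb]
  have h1 : 3 * (i * a) = 2 * i * b + i := by linear_combination i * hab
  have h2 := Int.emod_add_mul_ediv (2 * i) 3
  have h3 := Int.emod_nonneg (2 * i) three_ne_zero
  have h4 := Int.emod_lt_of_pos (2 * i) three_pos
  generalize 2 * i / 3 = j at *
  generalize 2 * i % 3 = e at *
  have h5 : 3 * (i * a) = 3 * (j * b) + e * b + i := by rw [h1, ← h2]; ring
  have hb' : 0 < b := hi.trans hib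
  constructor
  · have : j * b ≤ i * a := by nlinarith
    exact_mod_cast this
  · have : i * a < (j + 1) * b := by nlinarith
    exact_mod_cast this

/-- The slope falls short of `2/3` by `1/(3b)`, so `i a / b` lies strictly between `(2i-1)/3` and
`2i/3`. -/
theorem floor_mul_div_of_add_one_eq {a b i : ℤ} (hab : 3 * a + 1 = 2 * b) (hi : 0 < i)
    (hib : i < b) : ⌊(i : ℚ) * ((a : ℚ) / b)⌋ = (2 * i - 1) / 3 := by
  have hb : (0 : ℚ) < b := by exact_mod_cast hi.trans hib
  rw [mul_div_assoc', Int.floor_eq_iff, le_div_iff₀ hb, div_lt_iff₀ hb]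
  have h1 : 3 * (i * a) = (2 * i - 1 + 1) * b - i := by linear_combination i * hab
  have h2 := Int.emod_add_mul_ediv (2 * i - 1) 3
  have h3 := Int.emod_nonneg (2 * i - 1) three_ne_zero
  have h4 := Int.emod_lt_of_pos (2 * i - 1) three_pos
  generalize (2 * i - 1) / 3 = j at *
  generalize (2 * i - 1) % 3 = e at *
  have h5 : 3 * (i * a) = 3 * (j * b) + (e + 1) * b - i := by rw [h1, ← h2]; ring
  have hb' : 0 < b := hi.trans hib
  constructor
  · have : j * b ≤ i * a := by nlinarith
    exact_mod_cast this
  · have : i * a < (j + 1) * b := by nlinarith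
    exact_mod_cast this

theorem schubertWord_eq {a b : ℤ} (hb : 0 < b) (hab : IsCoprime a b) {F : ℤ → ℤ}
    (hF : ∀ i, 0 < i → i < b → ⌊(i : ℚ) * ((a : ℚ) / b)⌋ = F i) {N : ℕ} (hN : b = N + 1) :
    schubertWord ((a : ℚ) / b) =
      (List.range N).map fun k => (bridge (k + 1), pointsUp (F ((k + 1 : ℕ) : ℤ))) := by
  have hden : ((a : ℚ) / b).den - 1 = N := by
    have := den_div hb hab
    omega
  rw [schubertWord, hden]
  refine List.map_congr_left fun k hk => ?_
  rw [List.mem_range] at hk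
  rw [← hF _ (by positivity) (by rw [hN]; exact_mod_cast Nat.succ_lt_succ hk)]
  simp

/-- Raising `i` by 6 raises the floor by 4 and preserves the parity of `i`. So the word has period
six, its length `6n` is a whole number of periods, and one period is the base of `w`. -/
theorem toWord_relator_of_pos {n : ℤ} (hn : 0 < n) {u : List (Gen × Bool)}
    (hu : u = schubertWord ((4 * (n : ℚ) + 1) / (6 * (n : ℚ) + 1))) :
    (relator n).toWord = [(Gen.s, true)] ++ u ++ [(Gen.t, false)] ++ FreeGroup.invRev u := by
  obtain ⟨m, rfl⟩ := Int.eq_ofNat_of_zero_le hn.le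
  let f : ℕ → Gen × Bool := fun k => (bridge (k + 1), pointsUp (2 * ((k + 1 : ℕ) : ℤ) / 3))
  have hu' : u = (List.range (6 * m)).map f := by
    rw [hu, ← schubertWord_eq (a := 4 * m + 1) (b := 6 * m + 1) (F := fun i => 2 * i / 3)
      (by omega) ⟨3, -2, by ring⟩ (fun i => floor_mul_div_of_eq_add_one (by ring)) (by simp)]
    push_cast
    rfl
  have hper : ∀ k, f (k + 6) = f k := by
    intro k
    have h1 : (2 * ((k + 6 + 1 : ℕ) : ℤ) / 3) = 2 * ((k + 1 : ℕ) : ℤ) / 3 + 4 := by omega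
    have h2 : bridge (k + 6 + 1) = bridge (k + 1) := by
      simp [bridge, show k + 6 + 1 = k + 1 + 6 by ring, Nat.even_add, show Even 6 by decide]
    simp only [f, h1, h2, pointsUp, Int.even_add, show Even (4 : ℤ) by decide, iff_true]
  have hmk : FreeGroup.mk u = w m := by
    rw [hu', mk_map_range_mul f hper, w, zpow_natCast]
    congr 1
  have hred := (isReduced_bridge_word (m := 3 * m) (by omega) (f := f) (fun _ => rfl) true false
    (u := u) (by rw [hu']; congr 2; ring)).1
  rw [← toWord_mk_of_isReduced hred]
  congr 1
  rw [← FreeGroup.mul_mk, ← FreeGroup.mul_mk, ← FreeGroup.mul_mk, ← FreeGroup.inv_mk, hmk]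
  rfl

/-- With `n = -(m + 1)` the word has length `6m + 4`, two letters short of `m + 1` periods. Since a
period is conjugate by `s` to the inverse of the base of `w`, restoring the letters gives `u = s w
t`, and `u t⁻¹ u⁻¹ s` is then the relator. -/
theorem toWord_relator_of_neg {n : ℤ} (hn : n < 0) {u : List (Gen × Bool)}
    (hu : u = schubertWord ((4 * (n : ℚ) + 1) / (6 * (n : ℚ) + 1))) :
    (relator n).toWord = u ++ [(Gen.t, false)] ++ FreeGroup.invRev u ++ [(Gen.s, true)] := by
  obtain ⟨m, rfl⟩ : ∃ m : ℕ, n = -((m : ℤ) + 1) := ⟨(-n - 1).toNat, by omega⟩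
  let f : ℕ → Gen × Bool := fun k => (bridge (k + 1), pointsUp ((2 * ((k + 1 : ℕ) : ℤ) - 1) / 3))
  have hu' : u = (List.range (6 * m + 4)).map f := by
    rw [hu, ← schubertWord_eq (a := 4 * m + 3) (b := 6 * m + 5) (F := fun i => (2 * i - 1) / 3)
      (by omega) ⟨-3, 2, by ring⟩ (fun i => floor_mul_div_of_add_one_eq (by ring))
      (by push_cast; ring)]
    congr 1
    push_cast
    rw [← neg_div_neg_eq]
    congr 1 <;> ring
  have hper : ∀ k, f (k + 6) = f k := by
    intro k
    have h1 : ((2 * ((k + 6 + 1 : ℕ) : ℤ) - 1) / 3) = (2 * ((k + 1 : ℕ) : ℤ) - 1) / 3 + 4 := by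
      omega
    have h2 : bridge (k + 6 + 1) = bridge (k + 1) := by
      simp [bridge, show k + 6 + 1 = k + 1 + 6 by ring, Nat.even_add, show Even 6 by decide]
    simp only [f, h1, h2, pointsUp, Int.even_add, show Even (4 : ℤ) by decide, iff_true]
  have hmk : FreeGroup.mk u = s * w (-((m : ℤ) + 1)) * t := by
    -- The missing last two letters of the final period are `t⁻¹` and `s⁻¹`.
    have h1 : FreeGroup.mk u * (t⁻¹ * s⁻¹) = (t * s⁻¹ * t⁻¹ * s * t⁻¹ * s⁻¹) ^ (m + 1) := by
      have h2 := mk_map_range_mul f hper (m + 1)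
      have h3 : FreeGroup.mk ((List.range 6).map f) = t * s⁻¹ * t⁻¹ * s * t⁻¹ * s⁻¹ := rfl
      have h4 : (List.range (6 * (m + 1))).map f = u ++ [(Gen.t, false), (Gen.s, false)] := by
        rw [hu', show 6 * (m + 1) = 6 * m + 4 + 2 by ring, List.range_succ, List.range_succ,
          List.map_append, List.map_append, List.append_assoc]
        congr 1
        have hper' : ∀ m k, f (6 * m + k) = f k := by
          intro m k
          induction m with
          | zero => simp
          | succ m ih => rw [← ih, ← hper (6 * m + k)]; congr 1; ring
        simp only [List.map_cons, List.map_nil, hper']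
        rfl
      rw [h4, h3, ← FreeGroup.mul_mk] at h2
      exact h2
    have h5 : t * s⁻¹ * t⁻¹ * s * t⁻¹ * s⁻¹ = s * (t * s⁻¹ * t * s * t⁻¹ * s)⁻¹ * s⁻¹ := by group
    rw [h5, conj_pow, inv_pow] at h1
    rw [w, zpow_neg, show ((m : ℤ) + 1) = ((m + 1 : ℕ) : ℤ) by push_cast; rfl, zpow_natCast]
    have h6 : FreeGroup.mk u = FreeGroup.mk u * (t⁻¹ * s⁻¹) * (s * t) := by group
    rw [h6, h1]
    group
  have hred := (isReduced_bridge_word (m := 3 * m + 2) (by omega) (f := f) (fun _ => rfl) true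
    false (u := u) (by rw [hu']; congr 2; ring)).2
  rw [← toWord_mk_of_isReduced hred]
  congr 1
  rw [← FreeGroup.mul_mk, ← FreeGroup.mul_mk, ← FreeGroup.mul_mk, ← FreeGroup.inv_mk, hmk]
  change _ = s * w (-((m : ℤ) + 1)) * t * t⁻¹ * (s * w (-((m : ℤ) + 1)) * t)⁻¹ * s
  rw [relator]
  group

end TwoBridge

open TwoBridge in
theorem proposition2p1 (n : ℤ) :
    -- the fundamental group, for every knot `K` with Conway's notation `C(2n, 3)`
    (∀ K : Set S3, HasConwayNotation (2 * n) 3 K →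
      (∀ x : ↥(Kᶜ), Nonempty (FundamentalGroup ↥(Kᶜ) x ≃* knotGroup n)) ∧
      (∀ φ : Circle × ℂ → S3, IsTubularNeighbourhood φ K →
        ∀ x : ↥(exterior φ), Nonempty (FundamentalGroup ↥(exterior φ) x ≃* knotGroup n))) ∧
    -- `n > 0`: the reduced relator is `s u t⁻¹ u⁻¹`, with `u` read from Schubert's normal form
    (0 < n → ∀ u : List (Gen × Bool),
      u = schubertWord ((4 * (n : ℚ) + 1) / (6 * (n : ℚ) + 1)) →
        (relator n).toWord = [(Gen.s, true)] ++ u ++ [(Gen.t, false)] ++ FreeGroup.invRev u) ∧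
    -- `n < 0`: it is `u t⁻¹ u⁻¹ s`, that is `u t⁻¹ u⁻¹ = s⁻¹`, the inverse of both sides
    -- of `u t u⁻¹ = s`
    (n < 0 → ∀ u : List (Gen × Bool),
      u = schubertWord ((4 * (n : ℚ) + 1) / (6 * (n : ℚ) + 1)) →
        (relator n).toWord = u ++ [(Gen.t, false)] ++ FreeGroup.invRev u ++ [(Gen.s, true)]) := by
  exact ⟨fun K hK => nonempty_fundamentalGroup_mulEquiv_of_ambientIsotopic hK
      (nonempty_mulEquiv_knotGroup n),
    fun hn u hu => toWord_relator_of_pos hn hu, fun hn u hu => toWord_relator_of_neg hn hu⟩
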